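/- Let $s,t\in(0,1]$ with $2t+4s>3$. Let $V\in C(\mathbb R^3)$ satisfy $\inf V>0$ and $|\{x: V(x)\le M\}|<\infty$ for every $M>0$. Let $f:\mathbb R^3\times\mathbb R\to\mathbb R$ be a Carathéodory function (measurable in $x$, continuous in $u$), put $F(x,u)=\int_0^u f(x,\tau)\,d\tau$, and assume: (A1) there are $C_1>0$ and $p\in[2,\tfrac{6}{3-2s})$ with $|f(x,u)|\le C_1(|u|+|u|^{p-1})$ for all $x\in\mathbb R^3$, $u\in\mathbb R$; (A3) there is $\mu>4$ with $0<\mu F(x,u)\le u f(x,u)$ for all $x\in\mathbb R^3$ and $u\in\mathbb R\setminus\{0\}$. Let $H^s(\mathbb R^3)$ be the Hilbert space of real-valued $u\in L^2(\mathbb R^3)$ with $(-\Delta)^{s/2}u\in L^2(\mathbb R^3)$ (where $(-\Delta)^{s/2}$ is the Fourier multiplier with symbol $|\omega|^s$, $\omega$ being the angular frequency), with norm $\|u\|_{H^s}^2=\int_{\mathbb R^3}(|(-\Delta)^{s/2}u|^2+u^2)\,dx$, and let $E=\{u\in H^s(\mathbb R^3):\int_{\mathbb R^3} Vu^2\,dx<\infty\}$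 with norm $\|u\|_E^2=\int_{\mathbb R^3}(|(-\Delta)^{s/2}u|^2+Vu^2)\,dx$. For $u\in H^s(\mathbb R^3)$ let $$\phi^t_u(x)=c_t\int_{\mathbb R^3}\frac{u(y)^2}{|x-y|^{3-2t}}\,dy,\qquad c_t=\frac{\Gamma(\frac{3-2t}{2})}{\pi^{3/2}2^{2t}\Gamma(t)},$$ be the Riesz potential solving $(-\Delta)^t\phi=u^2$, and put $$I(u)=\frac12\int_{\mathbb R^3}\big(|(-\Delta)^{s/2}u|^2+u^2\big)dx+\frac14\int_{\mathbb R^3}\phi^t_u u^2\,dx-\int_{\mathbb R^3}F(x,u)\,dx\quad(u\in H^s(\mathbb R^3)),$$ $$I_\lambda(u)=I(u)+\frac{\lambda}{2}\int_{\mathbb R^3}V(x)u^2\,dx\quad(u\in E,\ \lambda\in(0,1]).$$ Let $\lambda_n\in(0,1]$ with $\lambda_n\to0$, and let $u_n\in E$ be critical points of $I_{\lambda_n}$ (that is, the Fréchet derivative of $I_{\lambda_n}:E\to\mathbb R$ at $u_n$ exists and is $0$) such that $I_{\lambda_n}(u_n)\le C$ for all $n$, with a constant $C$ independent of $n$. Then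 there are a subsequence of $(u_n)$ and a $u\in H^s(\mathbb R^3)$ such that, along this subsequence, $u_n\rightharpoonup u$ weakly in $H^s(\mathbb R^3)$, and $u$ is a critical point of $I:H^s(\mathbb R^3)\to\mathbb R$ (the Fréchet derivative of $I$ at $u$ exists and is $0$). -/

import Mathlib

open MeasureTheory Filter Topology
open scoped FourierTransform

noncomputable section

/-- The Euclidean space `ℝ³`. -/
abbrev R3 : Type := EuclideanSpace ℝ (Fin 3)

namespace FracSP

/-! ### The space `H^s(ℝ³)` of real-valued functions and the fractional Laplacian -/

/-- Real-valued `L²` functions regarded as complex-valued ones. -/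
def toComplex : Lp ℝ 2 (volume : Measure R3) →L[ℝ] Lp ℂ 2 (volume : Measure R3) :=
  Complex.ofRealCLM.compLpL 2 volume

/-- The `L²` Fourier transform of a real-valued function, in the normalization
`∫ e^{-2πi x·ξ} u(x) dx`. -/
def fourierL2 (u : Lp ℝ 2 (volume : Measure R3)) : Lp ℂ 2 (volume : Measure R3) :=
  𝓕 (toComplex u)

theorem fourierL2_add (u v : Lp ℝ 2 (volume : Measure R3)) :
    fourierL2 (u + v) = fourierL2 u + fourierL2 v := by
  unfold fourierL2
  rw [map_add]
  exact (Lp.fourierTransformₗᵢ R3 ℂ).map_add _ _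

theorem fourierL2_smul (c : ℝ) (u : Lp ℝ 2 (volume : Measure R3)) :
    fourierL2 (c • u) = c • fourierL2 u := by
  unfold fourierL2
  rw [map_smul]
  exact ((Lp.fourierTransformₗᵢ R3 ℂ).toLinearEquiv.toLinearMap.restrictScalars ℝ).map_smul c _

/-- The function `ξ ↦ |2πξ|^s 𝓕u(ξ)`, i.e. the Fourier transform of `(-Δ)^{s/2} u`. -/
def symbolMul (s : ℝ) (u : Lp ℝ 2 (volume : Measure R3)) (ξ : R3) : ℂ :=
  ((2 * Real.pi * ‖ξ‖) ^ s : ℝ) • (fourierL2 u) ξ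

theorem symbolMul_add (s : ℝ) (u v : Lp ℝ 2 (volume : Measure R3)) :
    symbolMul s (u + v) =ᵐ[volume] symbolMul s u + symbolMul s v := by
  have h := Lp.coeFn_add (fourierL2 u) (fourierL2 v)
  rw [← fourierL2_add] at h
  filter_upwards [h] with ξ hξ
  simp only [symbolMul, Pi.add_apply, hξ, smul_add]

theorem symbolMul_smul (s c : ℝ) (u : Lp ℝ 2 (volume : Measure R3)) :
    symbolMul s (c • u) =ᵐ[volume] c • symbolMul s u := by
  have h := Lp.coeFn_smul c (fourierL2 u)
  rw [← fourierL2_smul] at h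
  filter_upwards [h] with ξ hξ
  simp only [symbolMul, Pi.smul_apply, hξ]
  rw [smul_comm]

/-- `H^s(ℝ³)` as a linear subspace of `L²(ℝ³; ℝ)`: those `u` with `|2πξ|^s 𝓕u ∈ L²`. -/
def sobolevSubmodule (s : ℝ) : Submodule ℝ (Lp ℝ 2 (volume : Measure R3)) where
  carrier := {u | MemLp (symbolMul s u) 2 volume}
  add_mem' := by
    intro u v hu hv
    exact (memLp_congr_ae (symbolMul_add s u v)).2 (MemLp.add hu hv)
  zero_mem' := by
    have h := symbolMul_smul s 0 0
    rw [zero_smul, zero_smul] at h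
    exact (memLp_congr_ae h).2 MemLp.zero
  smul_mem' := by
    intro c u hu
    exact (memLp_congr_ae (symbolMul_smul s c u)).2 (MemLp.const_smul hu c)

/-- The Sobolev space `H^s(ℝ³)`, with its own Hilbert space norm (below). -/
def HSob (s : ℝ) : Type := sobolevSubmodule s

instance (s : ℝ) : AddCommGroup (HSob s) := inferInstanceAs (AddCommGroup (sobolevSubmodule s))

instance (s : ℝ) : Module ℝ (HSob s) := inferInstanceAs (Module ℝ (sobolevSubmodule s))

namespace HSob

variable {s : ℝ}

/-- The inclusion `H^s(ℝ³) ⊆ L²(ℝ³)`. -/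
def toL2 : HSob s →ₗ[ℝ] Lp ℝ 2 (volume : Measure R3) := (sobolevSubmodule s).subtype

theorem toL2_injective : Function.Injective (toL2 : HSob s → Lp ℝ 2 (volume : Measure R3)) :=
  Subtype.val_injective

theorem memLp_symbolMul (u : HSob s) : MemLp (symbolMul s (toL2 u)) 2 volume := u.2

instance : CoeFun (HSob s) (fun _ => R3 → ℝ) := ⟨fun u => (toL2 u : R3 → ℝ)⟩

/-- `(-Δ)^{s/2} u = 𝓕⁻¹(|2πξ|^s 𝓕u) ∈ L²`, for `u ∈ H^s(ℝ³)`.  It is a real-valued function,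
here regarded as an element of the complex `L²` space. -/
def halfLap (u : HSob s) : Lp ℂ 2 (volume : Measure R3) :=
  𝓕⁻ ((memLp_symbolMul u).toLp (symbolMul s (toL2 u)))

theorem halfLap_add (u v : HSob s) : halfLap (u + v) = halfLap u + halfLap v := by
  have h : (memLp_symbolMul (u + v)).toLp (symbolMul s (toL2 (u + v))) =
      (memLp_symbolMul u).toLp (symbolMul s (toL2 u)) +
        (memLp_symbolMul v).toLp (symbolMul s (toL2 v)) := by
    rw [← MemLp.toLp_add]
    apply MemLp.toLp_congr
    rw [map_add]
    exact symbolMul_add s _ _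
  unfold halfLap
  rw [h]
  exact (Lp.fourierTransformₗᵢ R3 ℂ).symm.map_add _ _

theorem halfLap_smul (c : ℝ) (u : HSob s) : halfLap (c • u) = c • halfLap u := by
  have h : (memLp_symbolMul (c • u)).toLp (symbolMul s (toL2 (c • u))) =
      c • (memLp_symbolMul u).toLp (symbolMul s (toL2 u)) := by
    rw [← MemLp.toLp_const_smul]
    apply MemLp.toLp_congr
    rw [map_smul]
    exact symbolMul_smul s c _
  unfold halfLap
  rw [h]
  exact ((Lp.fourierTransformₗᵢ R3 ℂ).symm.toLinearEquiv.toLinearMap.restrictScalars ℝ).map_smul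
    c _

/-- The inner product
`⟨u,v⟩ = ∫ (-Δ)^{s/2}u (-Δ)^{s/2}v dx + ∫ u v dx` of `H^s(ℝ³)` (sum of two `L²` inner products). -/
@[reducible]
def innerCore (s : ℝ) : InnerProductSpace.Core ℝ (HSob s) where
  inner u v := inner ℝ (halfLap u) (halfLap v) + inner ℝ (toL2 u) (toL2 v)
  conj_inner_symm u v := by simp [real_inner_comm]
  re_inner_nonneg u := by
    simp only [RCLike.re_to_real]
    exact add_nonneg real_inner_self_nonneg real_inner_self_nonneg
  add_left u v w := by
    rw [halfLap_add, map_add, inner_add_left, inner_add_left]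
    ring
  smul_left u v c := by
    rw [halfLap_smul, map_smul, real_inner_smul_left, real_inner_smul_left]
    simp only [conj_trivial]
    ring
  definite u h := by
    have h1 : 0 ≤ inner ℝ (halfLap u) (halfLap u) := real_inner_self_nonneg
    have h2 : 0 ≤ inner ℝ (toL2 u) (toL2 u) := real_inner_self_nonneg
    have h3 : inner ℝ (toL2 u) (toL2 u) = 0 := by linarith
    have h4 : toL2 u = 0 := inner_self_eq_zero.1 h3
    exact toL2_injective (by rw [h4, map_zero])

instance : NormedAddCommGroup (HSob s) := (innerCore s).toNormedAddCommGroup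

instance : InnerProductSpace ℝ (HSob s) := InnerProductSpace.ofCore (innerCore s).toCore

theorem inner_def (u v : HSob s) :
    inner ℝ u v = inner ℝ (halfLap u) (halfLap v) + inner ℝ (toL2 u) (toL2 v) := rfl

end HSob

/-! ### The energy space `E` -/

/-- Potentials satisfying (V): continuous, bounded below by a positive constant, and with
sublevel sets of finite Lebesgue measure. -/
structure Potential where
  /-- the function `V` -/
  toFun : R3 → ℝ
  continuous' : Continuous toFun
  lower_bound' : ∃ V₀ : ℝ, 0 < V₀ ∧ ∀ x, V₀ ≤ toFun x
  sublevel' : ∀ M : ℝ, 0 < M → volume {x | toFun x ≤ M} < ⊤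

instance : CoeFun Potential (fun _ => R3 → ℝ) := ⟨Potential.toFun⟩

theorem Potential.pos (V : Potential) (x : R3) : 0 < V x := by
  obtain ⟨V₀, h0, h⟩ := V.lower_bound'
  exact h0.trans_le (h x)

theorem integrable_mul_of_sq (V : Potential) {u v : R3 → ℝ}
    (hu : AEStronglyMeasurable u volume) (hv : AEStronglyMeasurable v volume)
    (hVu : Integrable (fun x => V x * u x ^ 2)) (hVv : Integrable (fun x => V x * v x ^ 2)) :
    Integrable (fun x => V x * (u x * v x)) := by
  refine (hVu.add hVv).mono' (V.continuous'.aestronglyMeasurable.mul (hu.mul hv))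
    (Filter.Eventually.of_forall fun x => ?_)
  have hV := V.pos x
  rw [Real.norm_eq_abs, abs_mul, abs_of_pos hV, Pi.add_apply, ← mul_add]
  refine mul_le_mul_of_nonneg_left ?_ hV.le
  rw [abs_le]
  constructor <;> nlinarith [sq_nonneg (u x + v x), sq_nonneg (u x - v x), sq_nonneg (u x),
    sq_nonneg (v x)]

/-- `E = {u ∈ H^s(ℝ³) : ∫ V u² < ∞}` as a linear subspace of `H^s(ℝ³)`. -/
def energySubmodule (s : ℝ) (V : Potential) : Submodule ℝ (HSob s) where
  carrier := {u | Integrable (fun x => V x * u x ^ 2) volume}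
  add_mem' := by
    intro u v hu hv
    have huv := integrable_mul_of_sq V (Lp.aestronglyMeasurable (HSob.toL2 u))
      (Lp.aestronglyMeasurable (HSob.toL2 v)) hu hv
    refine ((hu.add (huv.const_mul 2)).add hv).congr ?_
    have h := Lp.coeFn_add (HSob.toL2 u) (HSob.toL2 v)
    rw [← map_add] at h
    filter_upwards [h] with x hx
    simp only [hx, Pi.add_apply]
    ring
  zero_mem' := by
    refine (integrable_zero R3 ℝ volume).congr ?_
    have h := Lp.coeFn_zero ℝ 2 (volume : Measure R3)
    rw [← map_zero (HSob.toL2 (s := s))] at h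
    filter_upwards [h] with x hx
    rw [hx]
    simp
  smul_mem' := by
    intro c u hu
    refine (Integrable.const_mul hu (c ^ 2)).congr ?_
    have h := Lp.coeFn_smul c (HSob.toL2 u)
    rw [← map_smul] at h
    filter_upwards [h] with x hx
    simp only [hx, Pi.smul_apply, smul_eq_mul]
    ring

/-- The space `E`, with its own Hilbert space norm (below). -/
def ESpace (s : ℝ) (V : Potential) : Type := energySubmodule s V

instance (s : ℝ) (V : Potential) : AddCommGroup (ESpace s V) :=
  inferInstanceAs (AddCommGroup (energySubmodule s V))

instance (s : ℝ) (V : Potential) : Module ℝ (ESpace s V) :=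
  inferInstanceAs (Module ℝ (energySubmodule s V))

namespace ESpace

variable {s : ℝ} {V : Potential}

/-- The inclusion `E ⊆ H^s(ℝ³)`. -/
def toHSob : ESpace s V →ₗ[ℝ] HSob s := (energySubmodule s V).subtype

theorem toHSob_injective : Function.Injective (toHSob : ESpace s V → HSob s) :=
  Subtype.val_injective

theorem integrable_sq (u : ESpace s V) : Integrable (fun x => V x * toHSob u x ^ 2) volume := u.2

theorem integrable_mul (u v : ESpace s V) :
    Integrable (fun x => V x * (toHSob u x * toHSob v x)) volume :=
  integrable_mul_of_sq V (Lp.aestronglyMeasurable _) (Lp.aestronglyMeasurable _)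
    u.integrable_sq v.integrable_sq

/-- The inner product `⟨u,v⟩_E = ∫ (-Δ)^{s/2}u (-Δ)^{s/2}v dx + ∫ V u v dx` of `E`. -/
@[reducible]
def innerCore (s : ℝ) (V : Potential) : InnerProductSpace.Core ℝ (ESpace s V) where
  inner u v := inner ℝ (HSob.halfLap (toHSob u)) (HSob.halfLap (toHSob v)) +
    ∫ x, V x * (toHSob u x * toHSob v x)
  conj_inner_symm u v := by
    simp only [conj_trivial]
    rw [real_inner_comm]
    congr 1
    refine integral_congr_ae (Filter.Eventually.of_forall fun x => ?_)
    simp only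
    ring
  re_inner_nonneg u := by
    simp only [RCLike.re_to_real]
    refine add_nonneg real_inner_self_nonneg (integral_nonneg fun x => ?_)
    exact mul_nonneg (V.pos x).le (mul_self_nonneg _)
  add_left u v w := by
    rw [map_add, HSob.halfLap_add, inner_add_left]
    have h := Lp.coeFn_add (HSob.toL2 (toHSob u)) (HSob.toL2 (toHSob v))
    rw [← map_add] at h
    have h2 : ∫ x, V x * ((toHSob u + toHSob v) x * toHSob w x) =
        ∫ x, (V x * (toHSob u x * toHSob w x) + V x * (toHSob v x * toHSob w x)) := by
      refine integral_congr_ae ?_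
      filter_upwards [h] with x hx
      simp only [hx, Pi.add_apply]
      ring
    rw [h2, integral_add (integrable_mul u w) (integrable_mul v w)]
    ring
  smul_left u v c := by
    rw [map_smul, HSob.halfLap_smul, real_inner_smul_left]
    have h := Lp.coeFn_smul c (HSob.toL2 (toHSob u))
    rw [← map_smul] at h
    have h2 : ∫ x, V x * ((c • toHSob u) x * toHSob v x) =
        ∫ x, c * (V x * (toHSob u x * toHSob v x)) := by
      refine integral_congr_ae ?_
      filter_upwards [h] with x hx
      simp only [hx, Pi.smul_apply, smul_eq_mul]
      ring
    rw [h2, integral_const_mul]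
    simp only [conj_trivial]
    ring
  definite u h := by
    have h1 : 0 ≤ inner ℝ (HSob.halfLap (toHSob u)) (HSob.halfLap (toHSob u)) :=
      real_inner_self_nonneg
    have hn : ∀ x, 0 ≤ V x * (toHSob u x * toHSob u x) := fun x =>
      mul_nonneg (V.pos x).le (mul_self_nonneg _)
    have h2 : 0 ≤ ∫ x, V x * (toHSob u x * toHSob u x) := integral_nonneg hn
    have h3 : ∫ x, V x * (toHSob u x * toHSob u x) = 0 := by linarith
    rw [integral_eq_zero_iff_of_nonneg hn (integrable_mul u u)] at h3
    have h4 : HSob.toL2 (toHSob u) = 0 := by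
      rw [Lp.eq_zero_iff_ae_eq_zero]
      filter_upwards [h3] with x hx
      have hx' : V x * (toHSob u x * toHSob u x) = 0 := hx
      simpa [(V.pos x).ne'] using hx'
    apply toHSob_injective
    apply HSob.toL2_injective
    rw [h4, map_zero, map_zero]

instance : NormedAddCommGroup (ESpace s V) := (innerCore s V).toNormedAddCommGroup

instance : InnerProductSpace ℝ (ESpace s V) := InnerProductSpace.ofCore (innerCore s V).toCore

theorem inner_def (u v : ESpace s V) :
    inner ℝ u v = inner ℝ (HSob.halfLap (toHSob u)) (HSob.halfLap (toHSob v)) +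
      ∫ x, V x * (toHSob u x * toHSob v x) := rfl

end ESpace

/-! ### The functionals -/

/-- The constant `c_t = Γ((3-2t)/2) / (π^{3/2} 2^{2t} Γ(t))`. -/
def rieszConst (t : ℝ) : ℝ :=
  Real.Gamma ((3 - 2 * t) / 2) / (Real.pi ^ (3 / 2 : ℝ) * 2 ^ (2 * t) * Real.Gamma t)

/-- `φ_u^t(x) = c_t ∫ u(y)² / |x-y|^{3-2t} dy`, the Riesz potential solving `(-Δ)^t φ = u²`. -/
def phi (t : ℝ) (u : R3 → ℝ) (x : R3) : ℝ :=
  rieszConst t * ∫ y, u y ^ 2 / ‖x - y‖ ^ (3 - 2 * t)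

/-- `F(x,u) = ∫₀ᵘ f(x,τ) dτ`. -/
def primitive (f : R3 → ℝ → ℝ) (x : R3) (u : ℝ) : ℝ := ∫ τ in (0 : ℝ)..u, f x τ

/-- `I(u) = ½ ∫ (|(-Δ)^{s/2}u|² + u²) + ¼ ∫ φ_u^t u² - ∫ F(x,u)` on `H^s(ℝ³)`. -/
def functional (s t : ℝ) (f : R3 → ℝ → ℝ) (u : HSob s) : ℝ :=
  1 / 2 * (∫ x, (‖HSob.halfLap u x‖ ^ 2 + u x ^ 2)) + 1 / 4 * (∫ x, phi t u x * u x ^ 2)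
    - ∫ x, primitive f x (u x)

/-- `I_λ(u) = I(u) + (λ/2) ∫ V u²` on `E`. -/
def perturbedFunctional (s t : ℝ) (f : R3 → ℝ → ℝ) (V : Potential) (lam : ℝ)
    (u : ESpace s V) : ℝ :=
  functional s t f u.toHSob + lam / 2 * ∫ x, V x * u.toHSob x ^ 2

/-- `u` is a critical point of `J`: the Fréchet derivative `J'(u)` exists and vanishes. -/
def IsCriticalPoint {X : Type*} [NormedAddCommGroup X] [NormedSpace ℝ X] (J : X → ℝ) (u : X) :
    Prop :=
  HasFDerivAt J (0 : X →L[ℝ] ℝ) u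

/-- Weak convergence in a normed space: convergence against every continuous linear functional. -/
def WeaklyConverges {X : Type*} [NormedAddCommGroup X] [NormedSpace ℝ X] (u : ℕ → X) (u₀ : X) :
    Prop :=
  ∀ L : X →L[ℝ] ℝ, Tendsto (fun n => L (u n)) atTop (𝓝 (L u₀))

/-! ### The hypotheses on the nonlinearity -/

/-- Carathéodory functions: (Lebesgue) measurable in `x`, continuous in `u`. -/
def IsCaratheodory (f : R3 → ℝ → ℝ) : Prop :=
  (∀ u : ℝ, AEMeasurable (fun x => f x u) volume) ∧ ∀ x : R3, Continuous (f x)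

/-- The growth condition (A1): `|f(x,u)| ≤ C₁(|u| + |u|^{p-1})` with
`2 ≤ p < 2*_s = 6/(3-2s)`. -/
def GrowthCondition (s : ℝ) (f : R3 → ℝ → ℝ) : Prop :=
  ∃ C₁ p : ℝ, 0 < C₁ ∧ 2 ≤ p ∧ p < 6 / (3 - 2 * s) ∧
    ∀ x u, |f x u| ≤ C₁ * (|u| + |u| ^ (p - 1))

/-- The superquadraticity condition (A3): `0 < μ F(x,u) ≤ u f(x,u)` for `u ≠ 0`, with `μ > 4`. -/
def SuperquadraticCondition (f : R3 → ℝ → ℝ) : Prop :=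
  ∃ μ : ℝ, 4 < μ ∧
    ∀ x u, u ≠ 0 → 0 < μ * primitive f x u ∧ μ * primitive f x u ≤ u * f x u

end FracSP

end

/-!
The proof follows the compactness method for the Schrödinger-Poisson equation: critical points of
the perturbed functionals are bounded in `H^s(ℝ³)`, and their weak limits inherit the
Euler-Lagrange equation of `I`.

*Structure of the functional.* The nonlocal term is the square of a Hilbert space norm: with the
bounded bilinear map `P(u, v) = u(x) v(y)` into `L²(|x-y|^{-(3-2t)} dx dy)` (`exists_tensor`),
`∫ φ_u u² = c_t ‖P(u, u)‖²` (`integral_phi_mul_sq`). Its boundedness is where `2t + 4s > 3`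
enters: the singular part of the kernel is treated by Young's inequality with an exponent that is
strictly subcritical for the Sobolev embedding, the remaining part is bounded
(`exists_lintegral_rieszKernel_le`). Hence this term is differentiable for free. For
`∫ F(x, u) dx` the differences `f(x, u + w) - f(x, u)` are bounded, uniformly in `w`, by
`K (|w| + |w|^{p-1})` plus an `excess` that depends on `u` only and is small in the dual of
`L² ∩ L^p` for large `K` (`exists_excess_small`); this one estimate gives both the
differentiability (`hasFDerivAt_superposition`) and the passage to the limit
(`tendsto_integral_comp_mul`).

*Bounds.* The combination `μ I_λ(u) - I_λ'(u) u` with `μ > 4` from the superquadraticity condition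
controls `‖u‖² + λ ∫ V u²` (`norm_sq_add_le`). So `uₙ` is bounded in `H^s`, a subsequence converges
weakly to some `u₀`, and the contribution `λₙ ∫ V uₙ h` to the equation is `O(√λₙ)` for every
fixed `h ∈ E` (`abs_mul_integral_le`).

*Limit equation.* Tested against a continuous `h` of compact support, the derivative of `I` is
continuous along bounded weakly convergent sequences (`tendsto_energyDeriv`), by local compactness
(`HSob.tendsto_eLpNorm_ball`). Therefore `I'(u₀) h = 0` for those `h`, and as these are total in
`H^s(ℝ³)` (`HSob.eq_zero_of_inner_contDiff`), `I'(u₀) = 0`.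

The facts about `H^s(ℝ³)` all come from splitting `u` into low and high frequencies: the low part
is bounded, by Cauchy-Schwarz, and depends continuously on `u` at every point, and the high part
is small in `L²`. This yields the subcritical embeddings (`HSob.exists_eLpNorm_le`) through a
weak-type bound, and the local compactness.
-/

open scoped ENNReal

noncomputable section

namespace FracSP

/-! ### The `L²` Fourier transform -/

/-- On `L¹ ∩ L²` the inverse Fourier transform of `L²` is given by the Fourier integral. -/
theorem coeFn_fourierInv_of_integrable (g : Lp ℂ 2 (volume : Measure R3))
    (hg : Integrable (g : R3 → ℂ)) :
    (𝓕⁻ g : Lp ℂ 2 (volume : Measure R3)) =ᵐ[volume] 𝓕⁻ (g : R3 → ℂ) := by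
  have hcont : Continuous (𝓕⁻ (g : R3 → ℂ)) := by
    rw [Real.fourierInv_eq_fourier_comp_neg]
    exact VectorFourier.fourierIntegral_continuous Real.continuous_fourierChar
      (innerSL ℝ).continuous₂ hg.comp_neg
  refine ae_eq_of_integral_contDiff_smul_eq
    ((Lp.memLp _).locallyIntegrable (by norm_num)) hcont.locallyIntegrable ?_
  intro φ hφ hφc
  have h₁ : HasCompactSupport (Complex.ofRealCLM ∘ φ) := hφc.comp_left rfl
  have h₂ : ContDiff ℝ (⊤ : ℕ∞) (Complex.ofRealCLM ∘ φ) := by fun_prop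
  set ψ := h₁.toSchwartzMap h₂
  have hψ : ∀ x, ψ x = (φ x : ℂ) := fun x => rfl
  have e := congrArg (fun T => T ψ) (Lp.fourierInv_toTemperedDistribution_eq g)
  simp only [TemperedDistribution.fourierInv_apply, Lp.toTemperedDistribution_apply, hψ] at e
  calc ∫ x, φ x • (𝓕⁻ g : Lp ℂ 2 (volume : Measure R3)) x
      = ∫ x, (φ x : ℂ) • (𝓕⁻ g : Lp ℂ 2 (volume : Measure R3)) x := by
        simp
    _ = ∫ x, (𝓕⁻ ψ) x • g x := e.symm
    _ = ∫ x, ψ x • 𝓕⁻ (g : R3 → ℂ) x := by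
        rw [SchwartzMap.fourierInv_coe]
        have := VectorFourier.integral_fourierIntegral_smul_eq_flip (L := -innerₗ R3)
          (f := (ψ : R3 → ℂ)) (g := (g : R3 → ℂ)) (μ := volume) (ν := volume)
          Real.continuous_fourierChar (by simpa using! continuous_inner.neg) ψ.integrable hg
        have hfl : (-innerₗ R3).flip = -innerₗ R3 := by
          ext x y
          simp [real_inner_comm]
        rw [hfl] at this
        exact this
    _ = _ := by simp [hψ]

/-- The Fourier transform of a real-valued function is Hermitian. -/
theorem fourierL2_neg (u : Lp ℝ 2 (volume : Measure R3)) :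
    ∀ᵐ ξ, fourierL2 u (-ξ) = (starRingEnd ℂ) (fourierL2 u ξ) := by
  set U := fourierL2 u with hU
  have hUm : MemLp (U : R3 → ℂ) 2 := Lp.memLp U
  have hneg : MemLp (fun ξ => U (-ξ)) 2 :=
    hUm.comp_measurePreserving (Measure.measurePreserving_neg volume)
  have hconj : MemLp (fun ξ => (starRingEnd ℂ) (U ξ)) 2 := hUm.star
  refine ae_eq_of_integral_contDiff_smul_eq
    (hneg.locallyIntegrable (by norm_num)) (hconj.locallyIntegrable (by norm_num)) ?_
  intro φ hφ hφc
  have key : ∀ χ : R3 → ℝ, ContDiff ℝ (⊤ : ℕ∞) χ → HasCompactSupport χ →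
      ∫ ξ, (χ ξ : ℂ) * U ξ = ∫ x, 𝓕 (fun y => (χ y : ℂ)) x * (u x : ℂ) := by
    intro χ hχ hχc
    have h₁ : HasCompactSupport (Complex.ofRealCLM ∘ χ) := hχc.comp_left rfl
    have h₂ : ContDiff ℝ (⊤ : ℕ∞) (Complex.ofRealCLM ∘ χ) := by fun_prop
    set ψ := h₁.toSchwartzMap h₂
    have hψ : ∀ x, ψ x = (χ x : ℂ) := fun x => rfl
    have e := congrArg (fun T => T ψ) (Lp.fourier_toTemperedDistribution_eq (toComplex u))
    simp only [TemperedDistribution.fourier_apply, Lp.toTemperedDistribution_apply, hψ,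
      smul_eq_mul] at e
    rw [hU, fourierL2, ← e]
    refine integral_congr_ae ?_
    filter_upwards [ContinuousLinearMap.coeFn_compLpL (p := 2) (μ := volume)
      Complex.ofRealCLM u] with x hx
    have : toComplex u x = (u x : ℂ) := by simpa [toComplex] using hx
    rw [this, SchwartzMap.fourier_coe]
    rfl
  have hφn : ContDiff ℝ (⊤ : ℕ∞) (fun x => φ (-x)) := hφ.comp contDiff_neg
  have hφcn : HasCompactSupport (fun x => φ (-x)) :=
    hφc.comp_homeomorph (Homeomorph.neg R3)
  have hF : ∀ x, 𝓕 (fun y => ((φ (-y) : ℝ) : ℂ)) x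
      = (starRingEnd ℂ) (𝓕 (fun y => ((φ y : ℝ) : ℂ)) x) := by
    intro x
    rw [← Real.fourierInv_eq_fourier_comp_neg (fun y => ((φ y : ℝ) : ℂ)),
      Real.fourierInv_eq', Real.fourier_eq', ← integral_conj]
    congr 1
    ext y
    simp only [smul_eq_mul, map_mul, Complex.conj_ofReal, ← Complex.exp_conj, Complex.conj_I]
    congr 2
    push_cast
    ring
  calc ∫ x, φ x • U (-x) = ∫ x, φ (-x) • U x := by
        rw [← integral_neg_eq_self]
        simp
    _ = ∫ x, ((φ (-x) : ℝ) : ℂ) * U x := by simp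
    _ = ∫ x, (starRingEnd ℂ) (𝓕 (fun y => ((φ y : ℝ) : ℂ)) x * (u x : ℂ)) := by
        rw [key _ hφn hφcn]
        congr 1
        ext x
        rw [hF, map_mul, Complex.conj_ofReal]
    _ = (starRingEnd ℂ) (∫ x, (φ x : ℂ) * U x) := by rw [integral_conj, key φ hφ hφc]
    _ = _ := by
        rw [← integral_conj]
        simp

theorem norm_toComplex (u : Lp ℝ 2 (volume : Measure R3)) : ‖toComplex u‖ = ‖u‖ := by
  rw [Lp.norm_def, Lp.norm_def]
  congr 1
  refine eLpNorm_congr_norm_ae ?_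
  filter_upwards [ContinuousLinearMap.coeFn_compLpL (p := 2) (μ := volume)
      Complex.ofRealCLM u] with x hx
  have : toComplex u x = (u x : ℂ) := by simpa [toComplex] using hx
  rw [this, Complex.norm_real]

theorem norm_fourierL2 (u : Lp ℝ 2 (volume : Measure R3)) : ‖fourierL2 u‖ = ‖u‖ := by
  rw [fourierL2, Lp.norm_fourier_eq, norm_toComplex]

/-- `fourierL2` as a continuous real-linear map. -/
def fourierCLM : Lp ℝ 2 (volume : Measure R3) →L[ℝ] Lp ℂ 2 (volume : Measure R3) :=
  LinearMap.mkContinuous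
    { toFun := fourierL2, map_add' := fourierL2_add, map_smul' := fourierL2_smul } 1
    (fun u => by rw [one_mul]; exact (norm_fourierL2 u).le)

/-! ### The Hilbert space `H^s(ℝ³)` -/

namespace HSob

variable {s : ℝ}

theorem norm_sq (u : HSob s) : ‖u‖ ^ 2 = ‖halfLap u‖ ^ 2 + ‖toL2 u‖ ^ 2 := by
  rw [← real_inner_self_eq_norm_sq, inner_def, real_inner_self_eq_norm_sq,
    real_inner_self_eq_norm_sq]

theorem norm_toL2_le (u : HSob s) : ‖toL2 u‖ ≤ ‖u‖ := by
  refine le_of_sq_le_sq ?_ (norm_nonneg _)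
  rw [norm_sq]
  nlinarith [sq_nonneg ‖halfLap u‖]

theorem norm_halfLap_le (u : HSob s) : ‖halfLap u‖ ≤ ‖u‖ := by
  refine le_of_sq_le_sq ?_ (norm_nonneg _)
  rw [norm_sq]
  nlinarith [sq_nonneg ‖toL2 u‖]

/-- The inclusion `H^s ⊆ L²` as a continuous linear map. -/
def toL2CLM : HSob s →L[ℝ] Lp ℝ 2 (volume : Measure R3) :=
  LinearMap.mkContinuous toL2 1 (fun u => by rw [one_mul]; exact norm_toL2_le u)

/-- `(-Δ)^{s/2}` as a continuous linear map. -/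
def halfLapCLM : HSob s →L[ℝ] Lp ℂ 2 (volume : Measure R3) :=
  LinearMap.mkContinuous
    { toFun := halfLap, map_add' := halfLap_add, map_smul' := halfLap_smul } 1
    (fun u => by
      rw [one_mul]; exact norm_halfLap_le u)

theorem fourier_halfLap (u : HSob s) :
    𝓕 (halfLap u) = (memLp_symbolMul u).toLp (symbolMul s (toL2 u)) := by
  rw [halfLap, FourierTransform.fourier_fourierInv_eq]

theorem coeFn_fourier_halfLap (u : HSob s) :
    (𝓕 (halfLap u) : Lp ℂ 2 (volume : Measure R3)) =ᵐ[volume] symbolMul s (toL2 u) := by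
  rw [fourier_halfLap]
  exact MemLp.coeFn_toLp _

/-- The pair `((-Δ)^{s/2} u, u)`, an embedding of `H^s` into a product of `L²` spaces. -/
def pairCLM : HSob s →L[ℝ] Lp ℂ 2 (volume : Measure R3) × Lp ℝ 2 (volume : Measure R3) :=
  halfLapCLM.prod toL2CLM

theorem norm_le_pairCLM (u : HSob s) : ‖u‖ ≤ 2 * ‖pairCLM u‖ := by
  have h1 : ‖halfLap u‖ ≤ ‖pairCLM u‖ := norm_fst_le (pairCLM u)
  have h2 : ‖toL2 u‖ ≤ ‖pairCLM u‖ := norm_snd_le (pairCLM u)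
  have h3 := norm_sq u
  nlinarith [norm_nonneg u, norm_nonneg (halfLap u), norm_nonneg (toL2 u),
    norm_nonneg (pairCLM u)]

theorem antilipschitz_pairCLM : AntilipschitzWith 2 (pairCLM : HSob s →L[ℝ] _) :=
  AddMonoidHomClass.antilipschitz_of_bound _ (fun u => norm_le_pairCLM u)

instance : SecondCountableTopology (HSob s) :=
  haveI : Fact ((2 : ENNReal) ≠ ⊤) := ⟨by norm_num⟩
  haveI h1 : SecondCountableTopology (Lp ℝ 2 (volume : Measure R3)) := Lp.SecondCountableTopology
  haveI h2 : SecondCountableTopology (Lp ℂ 2 (volume : Measure R3)) := Lp.SecondCountableTopology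
  haveI h3 := @TopologicalSpace.instSecondCountableTopologyProd _ _ _ _ h2 h1
  (antilipschitz_pairCLM.isUniformInducing
    (pairCLM : HSob s →L[ℝ] _).uniformContinuous).isInducing.secondCountableTopology

/-- Multiplication by the symbol `|2πξ|^s` is a closed operator on `L²`. -/
theorem symbolMul_ae_eq_of_tendsto {u : ℕ → HSob s} {v : Lp ℝ 2 (volume : Measure R3)}
    {g : Lp ℂ 2 (volume : Measure R3)} (hv : Tendsto (fun n => toL2 (u n)) atTop (𝓝 v))
    (hg : Tendsto (fun n => (𝓕 (halfLap (u n)) : Lp ℂ 2 (volume : Measure R3))) atTop (𝓝 g)) :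
    symbolMul s v =ᵐ[volume] g := by
  have h1 : Tendsto (fun n => fourierL2 (toL2 (u n))) atTop (𝓝 (fourierL2 v)) :=
    (fourierCLM.continuous.tendsto v).comp hv
  obtain ⟨k, hk, hk'⟩ := (tendstoInMeasure_of_tendsto_Lp h1).exists_seq_tendsto_ae
  obtain ⟨l, hl, hl'⟩ := (tendstoInMeasure_of_tendsto_Lp
    (hg.comp hk.tendsto_atTop)).exists_seq_tendsto_ae
  have h2 : ∀ᵐ ξ, ∀ n, (𝓕 (halfLap (u n)) : Lp ℂ 2 (volume : Measure R3)) ξ =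
      symbolMul s (toL2 (u n)) ξ := ae_all_iff.2 fun n => coeFn_fourier_halfLap (u n)
  filter_upwards [hk', hl', h2] with ξ h3 h4 h5
  refine tendsto_nhds_unique ?_ h4
  simp only [Function.comp_apply, h5, symbolMul]
  exact (h3.comp hl.tendsto_atTop).const_smul _

instance : CompleteSpace (HSob s) := by
  refine Metric.complete_of_cauchySeq_tendsto fun u hu => ?_
  have h1 := hu.map (toL2CLM : HSob s →L[ℝ] _).uniformContinuous
  have h2 := hu.map (halfLapCLM : HSob s →L[ℝ] _).uniformContinuous
  obtain ⟨v, hv⟩ := cauchySeq_tendsto_of_complete h1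
  obtain ⟨g, hg⟩ := cauchySeq_tendsto_of_complete h2
  have hg' : Tendsto (fun n => (𝓕 (halfLap (u n)) : Lp ℂ 2 (volume : Measure R3))) atTop
      (𝓝 (𝓕 g)) := ((Lp.fourierTransformₗᵢ R3 ℂ).continuous.tendsto g).comp hg
  have hae := symbolMul_ae_eq_of_tendsto hv hg'
  have hmem : MemLp (symbolMul s v) 2 := (memLp_congr_ae hae).2 (Lp.memLp _)
  let w : HSob s := ⟨v, hmem⟩
  have hw1 : toL2 w = v := rfl
  have hw2 : halfLap w = g := by
    have : (memLp_symbolMul w).toLp (symbolMul s (toL2 w)) = 𝓕 g := by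
      rw [Lp.ext_iff]
      exact (MemLp.coeFn_toLp _).trans hae
    rw [halfLap, this, FourierTransform.fourierInv_fourier_eq]
  refine ⟨w, (antilipschitz_pairCLM.isUniformInducing
    (pairCLM : HSob s →L[ℝ] _).uniformContinuous).isInducing.tendsto_nhds_iff.2 ?_⟩
  have hw3 : pairCLM w = (g, v) := Prod.ext hw2 hw1
  rw [hw3]
  exact hg.prodMk_nhds hv

end HSob

/-- Bounded sequences in a separable real Hilbert space have weakly convergent subsequences. -/
theorem exists_weaklyConverges_subseq {H : Type*} [NormedAddCommGroup H] [InnerProductSpace ℝ H]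
    [CompleteSpace H] [SecondCountableTopology H] (u : ℕ → H) (C : ℝ) (hu : ∀ n, ‖u n‖ ≤ C) :
    ∃ k : ℕ → ℕ, StrictMono k ∧ ∃ u₀ : H, WeaklyConverges (fun n => u (k n)) u₀ := by
  let D := InnerProductSpace.toDual ℝ H
  have hmem : ∀ n, StrongDual.toWeakDual (D (u n)) ∈
      (WeakDual.toStrongDual ⁻¹' Metric.closedBall (0 : StrongDual ℝ H) C) := by
    intro n
    simpa using hu n
  obtain ⟨a, ha, k, hk, hlim⟩ := WeakDual.isSeqCompact_closedBall ℝ H (0 : StrongDual ℝ H) C hmem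
  refine ⟨k, hk, D.symm (WeakDual.toStrongDual a), fun L => ?_⟩
  have h := (WeakDual.eval_continuous (𝕜 := ℝ) (E := H) (D.symm L)).tendsto a |>.comp hlim
  have e1 : ∀ v : H, L v = D v (D.symm L) := by
    intro v
    rw [InnerProductSpace.toDual_apply_apply, real_inner_comm,
      ← InnerProductSpace.toDual_apply_apply]
    simp [D]
  simp only [e1]
  simpa using! h

theorem Lp_two_norm_sq {α F : Type*} [MeasurableSpace α] {μ : Measure α} [NormedAddCommGroup F]
    [InnerProductSpace ℝ F] (f : Lp F 2 μ) : ‖f‖ ^ 2 = ∫ x, ‖f x‖ ^ 2 ∂μ := by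
  rw [← real_inner_self_eq_norm_sq, L2.inner_def]
  simp only [real_inner_self_eq_norm_sq]

/-! ### Powers of the distance to the origin -/

theorem integrableOn_ball_rpow_neg {a : ℝ} (ha : a < 3) (R : ℝ) :
    IntegrableOn (fun x : R3 => ‖x‖ ^ (-a)) (Metric.ball 0 R) := by
  rcases le_or_gt R 0 with hR | hR
  · rw [Metric.ball_eq_empty.2 hR]
    exact integrableOn_empty
  rw [integrableOn_fun_norm_addHaar (volume : Measure R3) (f := fun r : ℝ => r ^ (-a))]
  have h := (intervalIntegral.integrableOn_Ioo_rpow_iff (s := 2 - a) hR).2 (by linarith)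
  refine h.congr_fun (fun y hy => ?_) measurableSet_Ioo
  have h3 : Module.finrank ℝ R3 - 1 = 2 := by simp
  simp only [h3, smul_eq_mul]
  rw [← Real.rpow_natCast, ← Real.rpow_add hy.1]
  congr 1

theorem integral_ball_rpow_neg (a : ℝ) {R : ℝ} (hR : 0 < R) :
    ∫ x in Metric.ball (0 : R3) R, ‖x‖ ^ (-a) =
      R ^ (3 - a) * ∫ x in Metric.ball (0 : R3) 1, ‖x‖ ^ (-a) := by
  have h := Measure.setIntegral_comp_smul_of_pos (volume : Measure R3)
    (fun x : R3 => ‖x‖ ^ (-a)) (Metric.ball 0 1) hR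
  rw [smul_ball hR.ne', smul_zero, mul_one, Real.norm_of_nonneg hR.le] at h
  have h3 : Module.finrank ℝ R3 = 3 := by simp
  have h4 : ∀ x : R3, ‖R • x‖ ^ (-a) = R ^ (-a) * ‖x‖ ^ (-a) := by
    intro x
    rw [norm_smul, Real.norm_of_nonneg hR.le, Real.mul_rpow hR.le (norm_nonneg _)]
  simp only [h4] at h
  rw [integral_const_mul, h3, smul_eq_mul] at h
  have h5 : R ^ (3 - a) = R ^ 3 * R ^ (-a) := by
    rw [← Real.rpow_natCast, ← Real.rpow_add hR]
    congr 1
  rw [h5, mul_assoc, h]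
  field_simp

/-! ### Splitting into low and high frequencies -/

namespace HSob

variable {s : ℝ}

theorem integrable_indicator_fourierL2 (R : ℝ) (u : HSob s) :
    Integrable ((Metric.ball (0 : R3) R).indicator (fourierL2 (toL2 u))) := by
  rw [integrable_indicator_iff measurableSet_ball]
  have : IsFiniteMeasure (volume.restrict (Metric.ball (0 : R3) R)) :=
    ⟨by rw [Measure.restrict_apply_univ]; exact measure_ball_lt_top⟩
  exact ((Lp.memLp (fourierL2 (toL2 u))).restrict _).integrable (by norm_num)

/-- The part of `u` with frequencies in the ball of radius `R`,
`x ↦ ∫_{|ξ| < R} e^{2πi x·ξ} 𝓕u(ξ) dξ`. -/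
def lowFreq (R : ℝ) (u : HSob s) : R3 → ℂ :=
  𝓕⁻ ((Metric.ball (0 : R3) R).indicator (fourierL2 (toL2 u)))

theorem continuous_lowFreq (R : ℝ) (u : HSob s) : Continuous (lowFreq R u) := by
  rw [lowFreq, Real.fourierInv_eq_fourier_comp_neg]
  exact VectorFourier.fourierIntegral_continuous Real.continuous_fourierChar
    (innerSL ℝ).continuous₂ (integrable_indicator_fourierL2 R u).comp_neg

theorem coeFn_toComplex (u : Lp ℝ 2 (volume : Measure R3)) :
    toComplex u =ᵐ[volume] fun x => (u x : ℂ) := by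
  filter_upwards [ContinuousLinearMap.coeFn_compLpL (p := 2) (μ := volume)
      Complex.ofRealCLM u] with x hx
  simpa [toComplex] using hx

/-- High frequencies are small in `L²`. -/
theorem eLpNorm_sub_lowFreq_le (hs : 0 ≤ s) {R : ℝ} (hR : 0 < R) (u : HSob s) :
    eLpNorm (fun x => (u x : ℂ) - lowFreq R u x) 2 volume ≤
      ENNReal.ofReal ((2 * Real.pi * R) ^ (-s) * ‖u‖) := by
  have hmem := (Lp.memLp (fourierL2 (toL2 u))).indicator
    (measurableSet_ball (x := (0 : R3)) (ε := R))
  set g : Lp ℂ 2 (volume : Measure R3) := hmem.toLp _ with hg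
  have hgae : g =ᵐ[volume] (Metric.ball (0 : R3) R).indicator (fourierL2 (toL2 u)) :=
    MemLp.coeFn_toLp _
  have hlow : (𝓕⁻ g : Lp ℂ 2 (volume : Measure R3)) =ᵐ[volume] lowFreq R u := by
    refine (coeFn_fourierInv_of_integrable g
      ((integrable_indicator_fourierL2 R u).congr hgae.symm)).trans ?_
    refine Eventually.of_forall fun x => ?_
    rw [lowFreq, Real.fourierInv_eq_fourier_comp_neg, Real.fourierInv_eq_fourier_comp_neg]
    refine Real.fourier_congr_ae ?_ x
    exact (quasiMeasurePreserving_neg volume).ae hgae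
  have h1 : eLpNorm (fun x => (u x : ℂ) - lowFreq R u x) 2 volume =
      eLpNorm (toComplex (toL2 u) - 𝓕⁻ g : Lp ℂ 2 (volume : Measure R3)) 2 volume := by
    refine eLpNorm_congr_ae ?_
    filter_upwards [hlow, coeFn_toComplex (toL2 u),
      Lp.coeFn_sub (toComplex (toL2 u)) (𝓕⁻ g)] with x h1 h2 h3
    rw [h3, Pi.sub_apply, h1, h2]
  have h2 : ‖toComplex (toL2 u) - 𝓕⁻ g‖ = ‖fourierL2 (toL2 u) - g‖ := by
    rw [← Lp.norm_fourier_eq]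
    congr 1
    have : 𝓕 (toComplex (toL2 u) - 𝓕⁻ g) = 𝓕 (toComplex (toL2 u)) - 𝓕 (𝓕⁻ g) :=
      (Lp.fourierTransformₗᵢ R3 ℂ).map_sub _ _
    rw [this, FourierTransform.fourier_fourierInv_eq, fourierL2]
  have h3 : ‖fourierL2 (toL2 u) - g‖ ≤
      (2 * Real.pi * R) ^ (-s) * ‖(𝓕 (halfLap u) : Lp ℂ 2 (volume : Measure R3))‖ := by
    refine Lp.norm_le_mul_norm_of_ae_le_mul ?_
    filter_upwards [Lp.coeFn_sub (fourierL2 (toL2 u)) g, hgae, coeFn_fourier_halfLap u]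
      with ξ h1 h2 h3
    rw [h1, Pi.sub_apply, h2, h3]
    by_cases hξ : ξ ∈ Metric.ball (0 : R3) R
    · rw [Set.indicator_of_mem hξ, sub_self, norm_zero]
      positivity
    · rw [Set.indicator_of_notMem hξ, sub_zero, symbolMul, norm_smul]
      have hξ' : R ≤ ‖ξ‖ := by simpa using hξ
      have hpos : 0 < 2 * Real.pi * R := by positivity
      have hle : 2 * Real.pi * R ≤ 2 * Real.pi * ‖ξ‖ := by gcongr
      rw [Real.norm_of_nonneg (by positivity), ← mul_assoc, Real.rpow_neg hpos.le]
      refine le_mul_of_one_le_left (norm_nonneg _) ?_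
      rw [inv_mul_eq_div, one_le_div (by positivity)]
      exact Real.rpow_le_rpow hpos.le hle hs
  rw [h1, ← Lp.enorm_def, ← ofReal_norm, h2]
  refine ENNReal.ofReal_le_ofReal (h3.trans ?_)
  rw [Lp.norm_fourier_eq]
  gcongr
  exact norm_halfLap_le u

/-- Low frequencies are bounded functions: Cauchy-Schwarz, with `|ξ|^{-2s}` locally integrable. -/
theorem exists_norm_lowFreq_le (hs3 : 2 * s < 3) :
    ∃ C : ℝ, 0 < C ∧ ∀ (R : ℝ), 0 < R → ∀ (u : HSob s) (x : R3),
      ‖lowFreq R u x‖ ≤ C * R ^ ((3 - 2 * s) / 2) * ‖u‖ := by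
  set κ := ∫ x in Metric.ball (0 : R3) 1, ‖x‖ ^ (-(2 * s)) with hκ
  have hκ0 : 0 ≤ κ := integral_nonneg fun x => by positivity
  refine ⟨((2 * Real.pi) ^ (-(2 * s)) * κ) ^ (1 / 2 : ℝ) + 1, by positivity,
    fun R hR u x => ?_⟩
  set B := Metric.ball (0 : R3) R
  set U := fourierL2 (toL2 u)
  set G : Lp ℂ 2 (volume : Measure R3) := 𝓕 (halfLap u) with hG
  have hGae : G =ᵐ[volume] symbolMul s (toL2 u) := coeFn_fourier_halfLap u
  have step1 : ‖lowFreq R u x‖ ≤ ∫ ξ in B, ‖U ξ‖ := by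
    rw [lowFreq, Real.fourierInv_eq]
    refine (norm_integral_le_integral_norm _).trans (le_of_eq ?_)
    rw [← integral_indicator measurableSet_ball]
    congr 1
    ext ξ
    rw [Circle.norm_smul, norm_indicator_eq_indicator_norm]
  have step2 : ∫ ξ in B, ‖U ξ‖ = ∫ ξ in B, (2 * Real.pi * ‖ξ‖) ^ (-s) * ‖G ξ‖ := by
    refine integral_congr_ae (ae_restrict_of_ae ?_)
    filter_upwards [hGae, Measure.ae_ne volume (0 : R3)] with ξ h1 h2
    have : 0 < 2 * Real.pi * ‖ξ‖ := by positivity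
    rw [h1, symbolMul, norm_smul, Real.norm_of_nonneg (by positivity), ← mul_assoc,
      ← Real.rpow_add this]
    simp [U]
  have hsq : ∀ ξ : R3, ((2 * Real.pi * ‖ξ‖) ^ (-s)) ^ 2 =
      (2 * Real.pi) ^ (-(2 * s)) * ‖ξ‖ ^ (-(2 * s)) := by
    intro ξ
    rw [← Real.rpow_natCast, ← Real.rpow_mul (by positivity),
      Real.mul_rpow (by positivity) (by positivity)]
    congr 2 <;> push_cast <;> ring
  have hint : IntegrableOn (fun ξ : R3 => ((2 * Real.pi * ‖ξ‖) ^ (-s)) ^ 2) B := by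
    simp only [hsq]
    exact (integrableOn_ball_rpow_neg hs3 R).const_mul _
  have hmeas : AEStronglyMeasurable (fun ξ : R3 => (2 * Real.pi * ‖ξ‖) ^ (-s))
      (volume.restrict B) := by
    apply Measurable.aestronglyMeasurable
    fun_prop
  have hmem : MemLp (fun ξ : R3 => (2 * Real.pi * ‖ξ‖) ^ (-s)) 2 (volume.restrict B) :=
    (memLp_two_iff_integrable_sq hmeas).2 hint
  have hGm : MemLp (fun ξ => ‖G ξ‖) 2 (volume.restrict B) := ((Lp.memLp G).restrict B).norm
  have step3 := integral_mul_le_Lp_mul_Lq_of_nonneg (μ := volume.restrict B)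
    (p := 2) (q := 2) Real.HolderConjugate.two_two
    (f := fun ξ : R3 => (2 * Real.pi * ‖ξ‖) ^ (-s)) (g := fun ξ => ‖G ξ‖)
    (Eventually.of_forall fun ξ => by positivity) (Eventually.of_forall fun ξ => norm_nonneg _)
    (by simpa using hmem) (by simpa using hGm)
  have step4 : ∫ ξ in B, ‖G ξ‖ ^ (2 : ℝ) ≤ ‖u‖ ^ 2 := by
    have h1 : ∫ ξ in B, ‖G ξ‖ ^ (2 : ℝ) ≤ ∫ ξ, ‖G ξ‖ ^ 2 := by
      simp only [Real.rpow_two]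
      refine setIntegral_le_integral ?_ (Eventually.of_forall fun ξ => by positivity)
      exact (memLp_two_iff_integrable_sq_norm (Lp.memLp G).1).1 (Lp.memLp G)
    refine h1.trans ?_
    rw [← Lp_two_norm_sq G, hG, Lp.norm_fourier_eq]
    gcongr
    exact norm_halfLap_le u
  have step5 : ∫ ξ in B, ((2 * Real.pi * ‖ξ‖) ^ (-s)) ^ (2 : ℝ) =
      (2 * Real.pi) ^ (-(2 * s)) * κ * R ^ (3 - 2 * s) := by
    simp only [Real.rpow_two, hsq]
    rw [integral_const_mul, integral_ball_rpow_neg _ hR]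
    ring
  rw [step5] at step3
  calc ‖lowFreq R u x‖ ≤ _ := step1
    _ = _ := step2
    _ ≤ _ := step3
    _ ≤ ((2 * Real.pi) ^ (-(2 * s)) * κ * R ^ (3 - 2 * s)) ^ (1 / 2 : ℝ) *
        (‖u‖ ^ 2) ^ (1 / 2 : ℝ) := by
        gcongr
    _ = ((2 * Real.pi) ^ (-(2 * s)) * κ) ^ (1 / 2 : ℝ) * R ^ ((3 - 2 * s) / 2) * ‖u‖ := by
        rw [Real.mul_rpow (by positivity) (by positivity), ← Real.rpow_mul hR.le,
          ← Real.sqrt_eq_rpow (‖u‖ ^ 2), Real.sqrt_sq (norm_nonneg _)]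
        congr 3
        ring
    _ ≤ _ := by
        gcongr
        linarith

/-! ### The subcritical Sobolev embedding -/

/-- The weak-type endpoint: choosing the cutoff frequency `R` so that the low frequencies are at
most `A / 2` reduces the level set of `u` to one of the high-frequency part. -/
theorem exists_measure_lt_le (hs : 0 ≤ s) (hs3 : 2 * s < 3) :
    ∃ K : ℝ, 0 ≤ K ∧ ∀ u : HSob s, ‖u‖ ≤ 1 → ∀ A : ℝ, 0 < A →
      volume {x | A < |u x|} ≤ ENNReal.ofReal (K * A ^ (-(6 / (3 - 2 * s)))) := by
  obtain ⟨C, hC, hlow⟩ := exists_norm_lowFreq_le hs3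
  have h3 : 0 < 3 - 2 * s := by linarith
  refine ⟨4 * (2 * Real.pi) ^ (-(2 * s)) * (2 * C) ^ (4 * s / (3 - 2 * s)), by positivity,
    fun u hu A hA => ?_⟩
  set R := (A / (2 * C)) ^ (2 / (3 - 2 * s)) with hR
  have hAC : 0 < A / (2 * C) := by positivity
  have hR0 : 0 < R := by positivity
  have hRC : C * R ^ ((3 - 2 * s) / 2) = A / 2 := by
    rw [hR, ← Real.rpow_mul hAC.le, div_mul_div_cancel₀ h3.ne', div_self two_ne_zero,
      Real.rpow_one]
    field_simp
  have hbd : ∀ x, ‖lowFreq R u x‖ ≤ A / 2 := by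
    intro x
    refine (hlow R hR0 u x).trans ?_
    rw [hRC]
    exact mul_le_of_le_one_right (by positivity) hu
  set v : R3 → ℂ := fun x => (u x : ℂ) - lowFreq R u x
  have hv : AEStronglyMeasurable v volume :=
    (Complex.continuous_ofReal.comp_aestronglyMeasurable (Lp.aestronglyMeasurable _)).sub
      (continuous_lowFreq R u).aestronglyMeasurable
  have hsub : {x | A < |u x|} ⊆ {x | ENNReal.ofReal (A / 2) ≤ ‖v x‖ₑ} := by
    intro x hx
    have hx' : A < |u x| := hx
    rw [Set.mem_ofPred_eq, ← ofReal_norm]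
    refine ENNReal.ofReal_le_ofReal ?_
    have h1 : ‖(u x : ℂ)‖ ≤ ‖v x‖ + ‖lowFreq R u x‖ := by
      simpa [v] using norm_add_le (v x) (lowFreq R u x)
    rw [Complex.norm_real, Real.norm_eq_abs] at h1
    linarith [hbd x]
  refine (measure_mono hsub).trans ((meas_ge_le_mul_pow_eLpNorm_enorm volume two_ne_zero
    ENNReal.ofNat_ne_top hv (by simpa using hA) (by simp)).trans ?_)
  have h1 : eLpNorm v 2 volume ≤ ENNReal.ofReal ((2 * Real.pi * R) ^ (-s)) :=
    (eLpNorm_sub_lowFreq_le hs hR0 u).trans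
      (ENNReal.ofReal_le_ofReal (mul_le_of_le_one_right (by positivity) hu))
  calc (ENNReal.ofReal (A / 2))⁻¹ ^ (2 : ENNReal).toReal * eLpNorm v 2 volume ^
        (2 : ENNReal).toReal
      ≤ (ENNReal.ofReal (A / 2))⁻¹ ^ (2 : ENNReal).toReal *
        ENNReal.ofReal ((2 * Real.pi * R) ^ (-s)) ^ (2 : ENNReal).toReal := by gcongr
    _ = ENNReal.ofReal (((A / 2)⁻¹) ^ 2 * ((2 * Real.pi * R) ^ (-s)) ^ 2) := by
        rw [← ENNReal.ofReal_inv_of_pos (by positivity), ENNReal.toReal_ofNat,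
          ENNReal.rpow_ofNat, ENNReal.rpow_ofNat, ← ENNReal.ofReal_pow (by positivity),
          ← ENNReal.ofReal_pow (by positivity), ← ENNReal.ofReal_mul (by positivity)]
    _ = _ := by
        congr 1
        have e1 : ((2 * Real.pi * R) ^ (-s)) ^ 2 =
            (2 * Real.pi) ^ (-(2 * s)) * (A / (2 * C)) ^ (-(4 * s / (3 - 2 * s))) := by
          rw [← Real.rpow_natCast, ← Real.rpow_mul (by positivity),
            Real.mul_rpow (by positivity) hR0.le, hR, ← Real.rpow_mul hAC.le]
          congr 2 <;> push_cast <;> ring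
        have e2 : (A / (2 * C)) ^ (-(4 * s / (3 - 2 * s))) =
            A ^ (-(4 * s / (3 - 2 * s))) * (2 * C) ^ (4 * s / (3 - 2 * s)) := by
          rw [Real.div_rpow hA.le (by positivity), Real.rpow_neg (x := 2 * C) (by positivity),
            div_inv_eq_mul]
        have e3 : A ^ (-(6 / (3 - 2 * s))) = (A ^ 2)⁻¹ * A ^ (-(4 * s / (3 - 2 * s))) := by
          rw [← Real.rpow_natCast, ← Real.rpow_neg hA.le, ← Real.rpow_add hA]
          congr 1
          push_cast
          field_simp
          ring
        rw [e1, e2, e3, inv_div, div_pow]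
        ring

/-- The subcritical embedding on the unit ball of `H^s`. By the layer-cake formula, the weak-type
bound of order `β = 6 / (3 - 2s) > q` controls the levels of `|u|` above `1`; where `|u| ≤ 1`,
`|u|^q ≤ |u|²`. -/
theorem exists_lintegral_rpow_le (hs : 0 ≤ s) (hs3 : 2 * s < 3) {q : ℝ} (hq : 2 ≤ q)
    (hq' : q < 6 / (3 - 2 * s)) :
    ∃ M : ℝ, 0 ≤ M ∧ ∀ u : HSob s, ‖u‖ ≤ 1 →
      ∫⁻ x, ENNReal.ofReal (|u x| ^ q) ≤ ENNReal.ofReal M := by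
  obtain ⟨K, hK, hlev⟩ := exists_measure_lt_le hs hs3
  set β := 6 / (3 - 2 * s)
  set J := ∫ t in Set.Ioi (1 : ℝ), t ^ (q - 1 - β) with hJ
  have hJint : IntegrableOn (fun t : ℝ => t ^ (q - 1 - β)) (Set.Ioi 1) :=
    integrableOn_Ioi_rpow_of_lt (by linarith) one_pos
  have hJ0 : 0 ≤ J := setIntegral_nonneg measurableSet_Ioi fun t ht => by
    have : (0 : ℝ) < t := one_pos.trans ht
    positivity
  refine ⟨1 + q * (K + K * J), by positivity, fun u hu => ?_⟩
  set v : R3 → ℝ := {x | 1 < |u x|}.indicator (fun x => |u x|) with hv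
  have hum : AEMeasurable (fun x => |u x|) := (Lp.aestronglyMeasurable _).aemeasurable.abs
  have hvm : AEMeasurable v :=
    hum.indicator₀ (nullMeasurableSet_lt aemeasurable_const hum)
  have hv0 : ∀ x, 0 ≤ v x := fun x => Set.indicator_nonneg (fun _ _ => abs_nonneg _) x
  have hpt : ∀ x, ENNReal.ofReal (|u x| ^ q) ≤
      ENNReal.ofReal (|u x| ^ 2) + ENNReal.ofReal (v x ^ q) := by
    intro x
    by_cases hx : 1 < |u x|
    · have : v x = |u x| := Set.indicator_of_mem (s := {x | 1 < |u x|}) hx _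
      rw [this]
      exact le_add_self
    · refine le_add_right (ENNReal.ofReal_le_ofReal ?_)
      have := Real.rpow_le_rpow_of_exponent_ge' (abs_nonneg (u x)) (not_lt.1 hx) zero_le_two hq
      simpa using this
  have hL2 : ∫⁻ x, ENNReal.ofReal (|u x| ^ 2) ≤ 1 := by
    have h1 : ∫⁻ x, ENNReal.ofReal (|u x| ^ 2) = ENNReal.ofReal (‖toL2 u‖ ^ 2) := by
      rw [Lp_two_norm_sq, ofReal_integral_eq_lintegral_ofReal]
      · rfl
      · exact (memLp_two_iff_integrable_sq_norm (Lp.aestronglyMeasurable _)).1 (Lp.memLp _)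
      · exact Eventually.of_forall fun x => by positivity
    rw [h1, ← ENNReal.ofReal_one]
    refine ENNReal.ofReal_le_ofReal ?_
    exact pow_le_one₀ (norm_nonneg _) ((norm_toL2_le u).trans hu)
  have hlevv : ∀ t : ℝ, 0 < t → volume {x | t < v x} ≤
      ENNReal.ofReal (K * (max t 1) ^ (-β)) := by
    intro t ht
    refine (measure_mono ?_).trans (hlev u hu (max t 1) (by positivity))
    intro x hx
    have hx' : t < v x := hx
    have hx1 : 1 < |u x| := by
      by_contra hcon
      have : v x = 0 := Set.indicator_of_notMem (s := {x | 1 < |u x|}) hcon _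
      linarith
    have : v x = |u x| := Set.indicator_of_mem (s := {x | 1 < |u x|}) hx1 _
    show max t 1 < |u x|
    rw [this] at hx'
    exact max_lt hx' hx1
  have hlow : ∫⁻ t in Set.Ioc (0 : ℝ) 1, volume {x | t < v x} * ENNReal.ofReal (t ^ (q - 1)) ≤
      ENNReal.ofReal K := by
    calc _ ≤ ∫⁻ t in Set.Ioc (0 : ℝ) 1, ENNReal.ofReal K := by
          refine setLIntegral_mono measurable_const fun t ht => ?_
          calc _ ≤ ENNReal.ofReal (K * (max t 1) ^ (-β)) * 1 := by
                refine mul_le_mul' (hlevv t ht.1) ?_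
                rw [← ENNReal.ofReal_one]
                exact ENNReal.ofReal_le_ofReal
                  (Real.rpow_le_one ht.1.le ht.2 (by linarith))
            _ = _ := by rw [max_eq_right ht.2]; simp
      _ = _ := by simp
  have hhigh : ∫⁻ t in Set.Ioi (1 : ℝ), volume {x | t < v x} * ENNReal.ofReal (t ^ (q - 1)) ≤
      ENNReal.ofReal (K * J) := by
    calc _ ≤ ∫⁻ t in Set.Ioi (1 : ℝ), ENNReal.ofReal (K * t ^ (q - 1 - β)) := by
          refine setLIntegral_mono (by fun_prop) fun t ht => ?_
          have ht0 : (0 : ℝ) < t := one_pos.trans ht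
          refine (mul_le_mul_left (hlevv t ht0) _).trans (le_of_eq ?_)
          rw [max_eq_left (le_of_lt ht), ← ENNReal.ofReal_mul (by positivity), mul_assoc,
            ← Real.rpow_add ht0]
          congr 3
          ring
      _ = ENNReal.ofReal (K * J) := by
          rw [← ofReal_integral_eq_lintegral_ofReal (hJint.const_mul K)]
          · rw [integral_const_mul]
          · refine (ae_restrict_iff' measurableSet_Ioi).2 (Eventually.of_forall fun t ht => ?_)
            have ht0 : (0 : ℝ) < t := one_pos.trans ht
            show 0 ≤ K * t ^ (q - 1 - β)
            positivity
  have hv_int : ∫⁻ x, ENNReal.ofReal (v x ^ q) ≤ ENNReal.ofReal (q * (K + K * J)) := by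
    rw [lintegral_rpow_eq_lintegral_meas_lt_mul volume (Eventually.of_forall hv0) hvm
      (by linarith), ← Set.Ioc_union_Ioi_eq_Ioi zero_le_one,
      lintegral_union measurableSet_Ioi (Set.Ioc_disjoint_Ioi le_rfl),
      ENNReal.ofReal_mul (by linarith), ENNReal.ofReal_add hK (by positivity)]
    gcongr
  calc ∫⁻ x, ENNReal.ofReal (|u x| ^ q)
      ≤ ∫⁻ x, (ENNReal.ofReal (|u x| ^ 2) + ENNReal.ofReal (v x ^ q)) := lintegral_mono hpt
    _ = (∫⁻ x, ENNReal.ofReal (|u x| ^ 2)) + ∫⁻ x, ENNReal.ofReal (v x ^ q) :=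
        lintegral_add_left' (hum.pow_const 2).ennreal_ofReal _
    _ ≤ 1 + ENNReal.ofReal (q * (K + K * J)) := add_le_add hL2 hv_int
    _ = _ := by rw [ENNReal.ofReal_add zero_le_one (by positivity), ENNReal.ofReal_one]

/-- The embedding `H^s ⊆ L^q` for `2 ≤ q < 6 / (3 - 2s)`. -/
theorem exists_eLpNorm_le (hs : 0 ≤ s) (hs3 : 2 * s < 3) {q : ℝ} (hq : 2 ≤ q)
    (hq' : q < 6 / (3 - 2 * s)) :
    ∃ C : ℝ, 0 ≤ C ∧ ∀ u : HSob s,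
      eLpNorm u (ENNReal.ofReal q) volume ≤ ENNReal.ofReal (C * ‖u‖) := by
  obtain ⟨M, hM, h⟩ := exists_lintegral_rpow_le hs hs3 hq hq'
  have hq0 : 0 < q := by linarith
  refine ⟨M ^ (1 / q), by positivity, fun u => ?_⟩
  rcases eq_or_ne u 0 with rfl | hu
  · have : (toL2 (0 : HSob s) : R3 → ℝ) =ᵐ[volume] 0 := by
      rw [map_zero]; exact Lp.coeFn_zero _ _ _
    rw [eLpNorm_congr_ae this]
    simp
  have hn : 0 < ‖u‖ := norm_pos_iff.2 hu
  set w := ‖u‖⁻¹ • u with hw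
  have hw1 : ‖w‖ ≤ 1 := by
    rw [hw, norm_smul, norm_inv, norm_norm, inv_mul_cancel₀ hn.ne']
  have hae : (u : R3 → ℝ) =ᵐ[volume] ‖u‖ • (w : R3 → ℝ) := by
    have h1 : toL2 u = ‖u‖ • toL2 w := by
      rw [hw, map_smul, smul_smul, mul_inv_cancel₀ hn.ne', one_smul]
    have h2 := Lp.coeFn_smul ‖u‖ (toL2 w)
    rw [← h1] at h2
    exact h2
  have hbd : eLpNorm w (ENNReal.ofReal q) volume ≤ ENNReal.ofReal (M ^ (1 / q)) := by
    rw [eLpNorm_eq_lintegral_rpow_enorm_toReal (by simpa using hq0) ENNReal.ofReal_ne_top,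
      ENNReal.toReal_ofReal hq0.le, ← ENNReal.ofReal_rpow_of_nonneg hM (by positivity)]
    refine ENNReal.rpow_le_rpow (le_trans (le_of_eq ?_) (h w hw1)) (by positivity)
    refine lintegral_congr fun x => ?_
    rw [← ENNReal.ofReal_rpow_of_nonneg (abs_nonneg _) hq0.le, ← Real.norm_eq_abs, ofReal_norm]
  rw [eLpNorm_congr_ae hae, eLpNorm_const_smul, mul_comm, ENNReal.ofReal_mul (by positivity)]
  refine mul_le_mul' hbd (le_of_eq ?_)
  rw [← ofReal_norm, norm_norm]

/-! ### Local compactness -/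

theorem lowFreq_add (R : ℝ) (u v : HSob s) (x : R3) :
    lowFreq R (u + v) x = lowFreq R u x + lowFreq R v x := by
  simp only [lowFreq, Real.fourierInv_eq]
  rw [← integral_add]
  · refine integral_congr_ae ?_
    have h := Lp.coeFn_add (fourierL2 (toL2 u)) (fourierL2 (toL2 v))
    rw [← fourierL2_add, ← map_add] at h
    filter_upwards [h] with ξ hξ
    by_cases hb : ξ ∈ Metric.ball (0 : R3) R
    · simp only [Set.indicator_of_mem hb, hξ, Pi.add_apply, smul_add]
    · simp [Set.indicator_of_notMem hb]
  · simpa using! (Real.fourierIntegral_convergent_iff (μ := volume) (-x)).2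
      (integrable_indicator_fourierL2 R u)
  · simpa using! (Real.fourierIntegral_convergent_iff (μ := volume) (-x)).2
      (integrable_indicator_fourierL2 R v)

theorem lowFreq_smul (R c : ℝ) (u : HSob s) (x : R3) :
    lowFreq R (c • u) x = c • lowFreq R u x := by
  simp only [lowFreq, Real.fourierInv_eq]
  rw [← integral_smul]
  refine integral_congr_ae ?_
  have h := Lp.coeFn_smul c (fourierL2 (toL2 u))
  rw [← fourierL2_smul, ← map_smul] at h
  filter_upwards [h] with ξ hξ
  by_cases hb : ξ ∈ Metric.ball (0 : R3) R
  · simp only [Set.indicator_of_mem hb, hξ, Pi.smul_apply]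
    rw [smul_comm]
  · simp [Set.indicator_of_notMem hb]

/-- Rellich: a bounded sequence in `H^s` converging weakly to zero converges to zero in `L²` of
every ball. The low frequencies converge pointwise, being continuous functionals of `u`, and the
high frequencies are uniformly small. -/
theorem tendsto_eLpNorm_ball (hs : 0 < s) (hs3 : 2 * s < 3) {w : ℕ → HSob s} {C : ℝ}
    (hC : ∀ n, ‖w n‖ ≤ C) (hw : WeaklyConverges w 0) (T : ℝ) :
    Tendsto (fun n => eLpNorm (w n) 2 (volume.restrict (Metric.ball 0 T))) atTop (𝓝 0) := by
  have hC0 : 0 ≤ C := (norm_nonneg _).trans (hC 0)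
  obtain ⟨D, hD, hlow⟩ := exists_norm_lowFreq_le hs3
  set μ := volume.restrict (Metric.ball (0 : R3) T)
  have hfin : IsFiniteMeasure μ :=
    ⟨by rw [Measure.restrict_apply_univ]; exact measure_ball_lt_top⟩
  have hpt : ∀ R, 0 < R → ∀ x, Tendsto (fun n => lowFreq R (w n) x) atTop (𝓝 0) := by
    intro R hR x
    let Λ : HSob s →L[ℝ] ℂ := LinearMap.mkContinuous
      { toFun := fun u => lowFreq R u x
        map_add' := fun u v => lowFreq_add R u v x
        map_smul' := fun c u => lowFreq_smul R c u x } (D * R ^ ((3 - 2 * s) / 2))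
      (fun u => hlow R hR u x)
    have hre : Tendsto (fun n => (Λ (w n)).re) atTop (𝓝 0) := by
      simpa using hw (Complex.reCLM.comp Λ)
    have him : Tendsto (fun n => (Λ (w n)).im) atTop (𝓝 0) := by
      simpa using hw (Complex.imCLM.comp Λ)
    have h := ((Complex.continuous_ofReal.tendsto 0).comp hre).add
      (((Complex.continuous_ofReal.tendsto 0).comp him).mul_const Complex.I)
    simpa [Function.comp_def, Complex.re_add_im] using! h
  have hL : ∀ R, 0 < R → Tendsto (fun n => eLpNorm (lowFreq R (w n)) 2 μ) atTop (𝓝 0) := by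
    intro R hR
    set b := D * R ^ ((3 - 2 * s) / 2) * C
    have hb0 : 0 ≤ b := by positivity
    have h := tendsto_lintegral_of_dominated_convergence (μ := μ)
      (F := fun n x => ‖lowFreq R (w n) x‖ₑ ^ 2) (f := fun _ => 0)
      (fun _ => ENNReal.ofReal b ^ 2)
      (fun n => ((continuous_lowFreq R (w n)).measurable.enorm).pow_const 2)
      (fun n => Eventually.of_forall fun x => by
        simp only [← ofReal_norm]
        gcongr
        exact (hlow R hR (w n) x).trans (mul_le_mul_of_nonneg_left (hC n) (by positivity)))
      (by
        rw [lintegral_const]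
        exact ENNReal.mul_ne_top (by simp) (measure_ne_top _ _))
      (Eventually.of_forall fun x => by
        have h1 := (hpt R hR x).enorm
        have h2 := (ENNReal.continuous_pow 2).tendsto _ |>.comp h1
        simpa [Function.comp_def] using h2)
    rw [lintegral_zero] at h
    have h2 := (ENNReal.continuous_rpow_const (y := 1 / 2)).tendsto 0 |>.comp h
    have h0 : (0 : ENNReal) ^ (1 / 2 : ℝ) = 0 := ENNReal.zero_rpow_of_pos (by norm_num)
    rw [h0] at h2
    refine h2.congr fun n => ?_
    rw [eLpNorm_eq_lintegral_rpow_enorm_toReal two_ne_zero ENNReal.ofNat_ne_top]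
    simp
  rw [ENNReal.tendsto_nhds_zero]
  intro ε hε
  have hR : ∃ R : ℝ, 0 < R ∧ ENNReal.ofReal ((2 * Real.pi * R) ^ (-s) * C) ≤ ε / 2 := by
    have h1 : Tendsto (fun R : ℝ => (2 * Real.pi * R) ^ (-s) * C) atTop (𝓝 (0 * C)) :=
      ((tendsto_rpow_neg_atTop hs).comp
        (tendsto_id.const_mul_atTop (by positivity : 0 < 2 * Real.pi))).mul_const C
    rw [zero_mul] at h1
    have h2 := (ENNReal.tendsto_ofReal h1)
    rw [ENNReal.ofReal_zero, ENNReal.tendsto_nhds_zero] at h2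
    obtain ⟨R, h3, h4⟩ := ((h2 (ε / 2) (ENNReal.half_pos hε.ne')).and
      (eventually_gt_atTop 0)).exists
    exact ⟨R, h4, h3⟩
  obtain ⟨R, hR0, hR⟩ := hR
  filter_upwards [ENNReal.tendsto_nhds_zero.1 (hL R hR0) (ε / 2) (ENNReal.half_pos hε.ne')]
    with n hn
  have h1 : eLpNorm (w n) 2 μ = eLpNorm (fun x => (w n x : ℂ)) 2 μ :=
    eLpNorm_congr_norm_ae (Eventually.of_forall fun x => by simp)
  have hm1 : AEStronglyMeasurable (fun x => (w n x : ℂ) - lowFreq R (w n) x) μ :=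
    ((Complex.continuous_ofReal.comp_aestronglyMeasurable (Lp.aestronglyMeasurable _)).sub
      (continuous_lowFreq R (w n)).aestronglyMeasurable).restrict
  have h2 : (fun x => (w n x : ℂ)) =
      (fun x => (w n x : ℂ) - lowFreq R (w n) x) + lowFreq R (w n) := by
    ext x; simp
  rw [h1, h2]
  refine (eLpNorm_add_le hm1 (continuous_lowFreq R (w n)).aestronglyMeasurable
    (by norm_num)).trans ?_
  rw [← ENNReal.add_halves ε]
  refine add_le_add ?_ hn
  refine (eLpNorm_mono_measure _ Measure.restrict_le_self).trans
    ((eLpNorm_sub_lowFreq_le hs.le hR0 (w n)).trans (le_trans ?_ hR))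
  exact ENNReal.ofReal_le_ofReal (by gcongr; exact hC n)

end HSob

/-! ### The Riesz kernel and Young's inequality -/

/-- The kernel `|x|^{-(3-2t)}`. Its value at the origin is immaterial. -/
def rieszKernel (t : ℝ) (x : R3) : ℝ≥0∞ := ENNReal.ofReal (1 / ‖x‖ ^ (3 - 2 * t))

/-- The part of the Riesz kernel inside the unit ball. -/
def localKernel (t : ℝ) : R3 → ℝ≥0∞ := (Metric.ball 0 1).indicator (rieszKernel t)

theorem measurable_rieszKernel (t : ℝ) : Measurable (rieszKernel t) := by
  unfold rieszKernel
  fun_prop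

theorem measurable_localKernel (t : ℝ) : Measurable (localKernel t) :=
  (measurable_rieszKernel t).indicator measurableSet_ball

theorem rieszKernel_le_of_le {t : ℝ} (ht : t ≤ 1) {T : ℝ} (hT : 0 < T) {x : R3} (hx : T ≤ ‖x‖) :
    rieszKernel t x ≤ ENNReal.ofReal (1 / T ^ (3 - 2 * t)) := by
  refine ENNReal.ofReal_le_ofReal ?_
  have : T ^ (3 - 2 * t) ≤ ‖x‖ ^ (3 - 2 * t) := Real.rpow_le_rpow hT.le hx (by linarith)
  gcongr

theorem rieszKernel_le {t : ℝ} (ht : t ≤ 1) (x : R3) :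
    rieszKernel t x ≤ localKernel t x + 1 := by
  by_cases hx : x ∈ Metric.ball (0 : R3) 1
  · rw [localKernel, Set.indicator_of_mem hx]
    exact le_self_add
  · have hx' : 1 ≤ ‖x‖ := by simpa using hx
    refine (rieszKernel_le_of_le ht one_pos hx').trans ?_
    simp

theorem lintegral_localKernel_rpow_lt_top {t r : ℝ} (hr : 0 < r) (hrt : r * (3 - 2 * t) < 3) :
    ∫⁻ x, localKernel t x ^ r < ∞ := by
  have h := (integrableOn_ball_rpow_neg hrt 1).lintegral_lt_top
  refine lt_of_le_of_lt (le_of_eq ?_) h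
  rw [← lintegral_indicator measurableSet_ball]
  refine lintegral_congr fun x => ?_
  by_cases hx : x ∈ Metric.ball (0 : R3) 1
  · rw [localKernel, Set.indicator_of_mem hx, Set.indicator_of_mem hx, rieszKernel,
      ENNReal.ofReal_rpow_of_nonneg (by positivity) hr.le, one_div,
      ← Real.rpow_neg (norm_nonneg _), ← Real.rpow_mul (norm_nonneg _)]
    congr 2
    ring
  · rw [localKernel, Set.indicator_of_notMem hx, Set.indicator_of_notMem hx,
      ENNReal.zero_rpow_of_pos hr]

/-- Young's convolution inequality in its trilinear form, with two equal exponents: Hölder's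
inequality for the three products of pairs out of `a(x)^ρ`, `b(y)^ρ`, `k(x-y)^r`. -/
theorem lintegral_mul_mul_sub_le {a b k : R3 → ℝ≥0∞} (ha : AEMeasurable a) (hb : AEMeasurable b)
    (hk : Measurable k) {ρ r : ℝ} (hρ : 1 ≤ ρ) (hr : 1 ≤ r) (h : 2 / ρ + 1 / r = 2) :
    ∫⁻ z : R3 × R3, a z.1 * b z.2 * k (z.1 - z.2) ≤
      (∫⁻ x, a x ^ ρ) ^ (1 / ρ) * (∫⁻ x, b x ^ ρ) ^ (1 / ρ) * (∫⁻ x, k x ^ r) ^ (1 / r) := by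
  have hρ0 : 0 < ρ := by linarith
  have hr0 : 0 < r := by linarith
  set p₁ := 1 - 1 / r with hp₁
  set p₂ := 1 - 1 / ρ with hp₂
  have h1 : 0 ≤ p₁ := by
    rw [hp₁, sub_nonneg, div_le_one hr0]; exact hr
  have h2 : 0 ≤ p₂ := by
    rw [hp₂, sub_nonneg, div_le_one hρ0]; exact hρ
  have hh : 2 * (1 / ρ) + 1 / r = 2 := by rw [mul_one_div, h]
  have hsum : p₁ + p₂ = 1 / ρ := by rw [hp₁, hp₂]; linarith
  have hsum2 : p₂ + p₂ = 1 / r := by rw [hp₂]; linarith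
  have ha' : AEMeasurable (fun z : R3 × R3 => a z.1) (volume.prod volume) := ha.comp_fst
  have hb' : AEMeasurable (fun z : R3 × R3 => b z.2) (volume.prod volume) := hb.comp_snd
  have hk' : AEMeasurable (fun z : R3 × R3 => k (z.1 - z.2)) (volume.prod volume) :=
    (hk.comp (measurable_fst.sub measurable_snd)).aemeasurable
  let f : Fin 3 → R3 × R3 → ℝ≥0∞ := ![fun z => a z.1 ^ ρ * b z.2 ^ ρ,
    fun z => a z.1 ^ ρ * k (z.1 - z.2) ^ r, fun z => b z.2 ^ ρ * k (z.1 - z.2) ^ r]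
  let p : Fin 3 → ℝ := ![p₁, p₂, p₂]
  have hpt : ∀ z : R3 × R3, a z.1 * b z.2 * k (z.1 - z.2) =
      ∏ i ∈ Finset.univ, f i z ^ p i := by
    intro z
    have e1 : ∀ c : ℝ≥0∞, (c ^ ρ) ^ p₁ * (c ^ ρ) ^ p₂ = c := by
      intro c
      rw [← ENNReal.rpow_add_of_nonneg _ _ h1 h2, hsum, ← ENNReal.rpow_mul,
        mul_one_div_cancel hρ0.ne', ENNReal.rpow_one]
    have e2 : ∀ c : ℝ≥0∞, (c ^ r) ^ p₂ * (c ^ r) ^ p₂ = c := by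
      intro c
      rw [← ENNReal.rpow_add_of_nonneg _ _ h2 h2, hsum2, ← ENNReal.rpow_mul,
        mul_one_div_cancel hr0.ne', ENNReal.rpow_one]
    simp only [Fin.prod_univ_three, f, p, Matrix.cons_val_zero, Matrix.cons_val_one,
      Matrix.cons_val, ENNReal.mul_rpow_of_nonneg _ _ h1,
      ENNReal.mul_rpow_of_nonneg _ _ h2]
    conv_lhs => rw [← e1 (a z.1), ← e1 (b z.2), ← e2 (k (z.1 - z.2))]
    ring
  have hfm : ∀ i ∈ (Finset.univ : Finset (Fin 3)), AEMeasurable (f i) (volume.prod volume) := by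
    intro i _
    fin_cases i
    · exact (ha'.pow_const _).mul (hb'.pow_const _)
    · exact (ha'.pow_const _).mul (hk'.pow_const _)
    · exact (hb'.pow_const _).mul (hk'.pow_const _)
  have hHolder := ENNReal.lintegral_prod_norm_pow_le (μ := (volume.prod volume : Measure (R3 × R3)))
    Finset.univ hfm (p := p) (by
      simp only [Fin.sum_univ_three, p, Matrix.cons_val_zero, Matrix.cons_val_one,
        Matrix.cons_val]
      linarith)
    (by
      intro i _
      fin_cases i
      · exact h1
      · exact h2
      · exact h2)
  have i1 : ∫⁻ z, f 0 z ∂(volume.prod volume) = (∫⁻ x, a x ^ ρ) * ∫⁻ x, b x ^ ρ :=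
    lintegral_prod_mul (ha.pow_const _) (hb.pow_const _)
  have i2 : ∫⁻ z, f 1 z ∂(volume.prod volume) = (∫⁻ x, a x ^ ρ) * ∫⁻ x, k x ^ r := by
    rw [lintegral_prod _ (hfm 1 (Finset.mem_univ _)), ← lintegral_mul_const'' _ (ha.pow_const _)]
    refine lintegral_congr fun x => ?_
    show ∫⁻ y, a x ^ ρ * k (x - y) ^ r = _
    rw [lintegral_const_mul _ (by fun_prop),
      lintegral_sub_left_eq_self (fun y => k y ^ r) x]
  have i3 : ∫⁻ z, f 2 z ∂(volume.prod volume) = (∫⁻ x, b x ^ ρ) * ∫⁻ x, k x ^ r := by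
    rw [lintegral_prod_symm _ (hfm 2 (Finset.mem_univ _)),
      ← lintegral_mul_const'' _ (hb.pow_const _)]
    refine lintegral_congr fun y => ?_
    show ∫⁻ x, b y ^ ρ * k (x - y) ^ r = _
    rw [lintegral_const_mul _ (by fun_prop),
      lintegral_sub_right_eq_self (fun y => k y ^ r) y]
  calc ∫⁻ z : R3 × R3, a z.1 * b z.2 * k (z.1 - z.2)
      = ∫⁻ z, ∏ i ∈ Finset.univ, f i z ^ p i ∂(volume.prod volume) := lintegral_congr hpt
    _ ≤ _ := hHolder
    _ = _ := by
      simp only [Fin.prod_univ_three, i1, i2, i3, p, Matrix.cons_val_zero, Matrix.cons_val_one,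
        Matrix.cons_val, ENNReal.mul_rpow_of_nonneg _ _ h1, ENNReal.mul_rpow_of_nonneg _ _ h2]
      rw [← hsum, ← hsum2, ENNReal.rpow_add_of_nonneg _ _ h1 h2,
        ENNReal.rpow_add_of_nonneg _ _ h1 h2, ENNReal.rpow_add_of_nonneg _ _ h2 h2]
      ring

/-! ### The nonlocal energy `∫ φ_u u²` on `H^s(ℝ³)` -/

theorem HSob.lintegral_enorm_sq_le {s : ℝ} (u : HSob s) :
    ∫⁻ x, ‖u x‖ₑ ^ 2 ≤ ENNReal.ofReal (‖u‖ ^ 2) := by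
  have h1 : ∫⁻ x, ‖u x‖ₑ ^ 2 = eLpNorm u 2 volume ^ 2 := by
    rw [eLpNorm_eq_lintegral_rpow_enorm_toReal two_ne_zero ENNReal.ofNat_ne_top,
      ← ENNReal.rpow_natCast, ← ENNReal.rpow_mul]
    simp
  rw [h1, ← Lp.enorm_def, ← ofReal_norm, ← ENNReal.ofReal_pow (norm_nonneg _)]
  refine ENNReal.ofReal_le_ofReal ?_
  gcongr
  exact HSob.norm_toL2_le u

/-- The quadrilinear estimate behind the term `∫ φ_u u²`. As `2t + 4s > 3` strictly, there is a
subcritical exponent `q > 12 / (3 + 2t)`, so Young's inequality for the local part of the kernel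
suffices; away from the diagonal the kernel is bounded. -/
theorem exists_lintegral_rieszKernel_le {s t : ℝ} (hs : 0 ≤ s) (hs3 : 2 * s < 3)
    (ht : t ∈ Set.Ioc (0 : ℝ) 1) (hst : 3 < 2 * t + 4 * s) :
    ∃ C : ℝ, 0 ≤ C ∧ ∀ u v : HSob s,
      ∫⁻ z : R3 × R3, ‖u z.1‖ₑ ^ 2 * ‖v z.2‖ₑ ^ 2 * rieszKernel t (z.1 - z.2) ≤
        ENNReal.ofReal ((C * ‖u‖ * ‖v‖) ^ 2) := by
  obtain ⟨ht0, ht1⟩ := ht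
  have h3s : 0 < 3 - 2 * s := by linarith
  have h3t : 0 < 3 + 2 * t := by linarith
  have hlt : 12 / (3 + 2 * t) < min 4 (6 / (3 - 2 * s)) := by
    rw [lt_min_iff, div_lt_iff₀ h3t, div_lt_div_iff₀ h3t h3s]
    constructor <;> nlinarith
  obtain ⟨q, hq1, hq2⟩ := exists_between hlt
  have hq4 : q < 4 := hq2.trans_le (min_le_left _ _)
  have hqs : q < 6 / (3 - 2 * s) := hq2.trans_le (min_le_right _ _)
  have hq2' : 2 < q := by
    refine lt_trans ?_ hq1
    rw [lt_div_iff₀ h3t]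
    linarith
  have hq0 : 0 < q := by linarith
  rw [div_lt_iff₀ h3t] at hq1
  -- the exponent `r` of the kernel is determined by `2 / (q / 2) + 1 / r = 2`
  set r := q / (2 * q - 4) with hr
  have hden : 0 < 2 * q - 4 := by linarith
  have hr1 : 1 ≤ r := by
    rw [hr, le_div_iff₀ hden]; linarith
  have hrt : r * (3 - 2 * t) < 3 := by
    rw [hr, div_mul_eq_mul_div, div_lt_iff₀ hden]
    nlinarith
  have hrel : 2 / (q / 2) + 1 / r = 2 := by
    rw [hr]
    field_simp
    ring
  obtain ⟨D, hD, hemb⟩ := HSob.exists_eLpNorm_le hs hs3 hq2'.le hqs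
  set κ := (∫⁻ x, localKernel t x ^ r) ^ (1 / r) with hκ
  have hκt : κ ≠ ∞ := ENNReal.rpow_ne_top_of_nonneg (by positivity)
    (lintegral_localKernel_rpow_lt_top (by linarith) hrt).ne
  have hLq : ∀ u : HSob s, (∫⁻ x, (‖u x‖ₑ ^ 2) ^ (q / 2)) ^ (1 / (q / 2)) ≤
      ENNReal.ofReal ((D * ‖u‖) ^ 2) := by
    intro u
    have h1 : (∫⁻ x, (‖u x‖ₑ ^ 2) ^ (q / 2)) ^ (1 / (q / 2)) =
        eLpNorm u (ENNReal.ofReal q) volume ^ 2 := by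
      rw [eLpNorm_eq_lintegral_rpow_enorm_toReal (by simpa using hq0) ENNReal.ofReal_ne_top,
        ENNReal.toReal_ofReal hq0.le, ← ENNReal.rpow_natCast, ← ENNReal.rpow_mul]
      congr 1
      · refine lintegral_congr fun x => ?_
        rw [← ENNReal.rpow_natCast, ← ENNReal.rpow_mul]
        congr 1
        push_cast
        ring
      · push_cast
        field_simp
    rw [h1, ENNReal.ofReal_pow (by positivity)]
    gcongr
    exact hemb u
  refine ⟨Real.sqrt (D ^ 4 * κ.toReal + 1), Real.sqrt_nonneg _, fun u v => ?_⟩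
  have hum : AEMeasurable (fun x => ‖u x‖ₑ ^ 2) :=
    (Lp.aestronglyMeasurable (HSob.toL2 u)).enorm.pow_const 2
  have hvm : AEMeasurable (fun x => ‖v x‖ₑ ^ 2) :=
    (Lp.aestronglyMeasurable (HSob.toL2 v)).enorm.pow_const 2
  have hloc := lintegral_mul_mul_sub_le hum hvm (measurable_localKernel t)
    (ρ := q / 2) (by linarith) hr1 hrel
  have hfar : ∫⁻ z : R3 × R3, ‖u z.1‖ₑ ^ 2 * ‖v z.2‖ₑ ^ 2 ≤
      ENNReal.ofReal (‖u‖ ^ 2) * ENNReal.ofReal (‖v‖ ^ 2) := by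
    refine (lintegral_prod_mul hum hvm).le.trans ?_
    exact mul_le_mul' (HSob.lintegral_enorm_sq_le u) (HSob.lintegral_enorm_sq_le v)
  calc ∫⁻ z : R3 × R3, ‖u z.1‖ₑ ^ 2 * ‖v z.2‖ₑ ^ 2 * rieszKernel t (z.1 - z.2)
      ≤ ∫⁻ z : R3 × R3, (‖u z.1‖ₑ ^ 2 * ‖v z.2‖ₑ ^ 2 * localKernel t (z.1 - z.2) +
          ‖u z.1‖ₑ ^ 2 * ‖v z.2‖ₑ ^ 2) := by
        refine lintegral_mono fun z => ?_
        refine (mul_le_mul_right (rieszKernel_le ht1 (z.1 - z.2)) _).trans (le_of_eq ?_)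
        rw [mul_add, mul_one]
    _ = (∫⁻ z : R3 × R3, ‖u z.1‖ₑ ^ 2 * ‖v z.2‖ₑ ^ 2 * localKernel t (z.1 - z.2)) +
          ∫⁻ z : R3 × R3, ‖u z.1‖ₑ ^ 2 * ‖v z.2‖ₑ ^ 2 :=
        lintegral_add_right' _ (hum.comp_fst.mul hvm.comp_snd)
    _ ≤ ENNReal.ofReal ((D * ‖u‖) ^ 2) * ENNReal.ofReal ((D * ‖v‖) ^ 2) * κ +
          ENNReal.ofReal (‖u‖ ^ 2) * ENNReal.ofReal (‖v‖ ^ 2) := by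
        refine add_le_add (hloc.trans ?_) hfar
        gcongr
        · exact hLq u
        · exact hLq v
    _ = _ := by
        rw [← ENNReal.ofReal_toReal hκt, ENNReal.toReal_ofReal ENNReal.toReal_nonneg,
          ← ENNReal.ofReal_mul (by positivity),
          ← ENNReal.ofReal_mul (by positivity), ← ENNReal.ofReal_mul (by positivity),
          ← ENNReal.ofReal_add (by positivity) (by positivity)]
        congr 1
        simp only [mul_pow]
        rw [Real.sq_sqrt (by positivity)]
        ring

/-- The measure `|x-y|^{-(3-2t)} dx dy` on `ℝ³ × ℝ³`. -/
def rieszMeasure (t : ℝ) : Measure (R3 × R3) :=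
  (volume.prod volume).withDensity fun z => rieszKernel t (z.1 - z.2)

theorem measurable_rieszKernel_sub (t : ℝ) :
    Measurable fun z : R3 × R3 => rieszKernel t (z.1 - z.2) :=
  (measurable_rieszKernel t).comp (measurable_fst.sub measurable_snd)

theorem rieszMeasure_absolutelyContinuous (t : ℝ) : rieszMeasure t ≪ volume.prod volume :=
  withDensity_absolutelyContinuous _ _

theorem ae_rieszMeasure_fst (t : ℝ) {p : R3 → Prop} (h : ∀ᵐ x, p x) :
    ∀ᵐ z ∂rieszMeasure t, p z.1 :=
  (rieszMeasure_absolutelyContinuous t).ae_le (Measure.quasiMeasurePreserving_fst.ae h)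

theorem ae_rieszMeasure_snd (t : ℝ) {p : R3 → Prop} (h : ∀ᵐ x, p x) :
    ∀ᵐ z ∂rieszMeasure t, p z.2 :=
  (rieszMeasure_absolutelyContinuous t).ae_le (Measure.quasiMeasurePreserving_snd.ae h)

theorem lintegral_rieszMeasure (t : ℝ) {g : R3 × R3 → ℝ≥0∞}
    (hg : AEMeasurable g (volume.prod volume)) :
    ∫⁻ z, g z ∂rieszMeasure t = ∫⁻ z : R3 × R3, g z * rieszKernel t (z.1 - z.2) := by
  rw [rieszMeasure, lintegral_withDensity_eq_lintegral_mul₀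
    (measurable_rieszKernel_sub t).aemeasurable hg]
  simp only [Pi.mul_apply, mul_comm]
  rfl

theorem integral_rieszMeasure (t : ℝ) (g : R3 × R3 → ℝ) :
    ∫ z, g z ∂rieszMeasure t =
      ∫ z, 1 / ‖z.1 - z.2‖ ^ (3 - 2 * t) * g z ∂(volume.prod volume) := by
  rw [rieszMeasure, integral_withDensity_eq_integral_toReal_smul (measurable_rieszKernel_sub t)
    (Eventually.of_forall fun z => ENNReal.ofReal_lt_top)]
  congr 1
  ext z
  rw [rieszKernel, ENNReal.toReal_ofReal (by positivity), smul_eq_mul]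

theorem integral_rieszMeasure_swap (t : ℝ) (g : R3 × R3 → ℝ) :
    ∫ z, g z.swap ∂rieszMeasure t = ∫ z, g z ∂rieszMeasure t := by
  rw [integral_rieszMeasure, integral_rieszMeasure, ← integral_prod_swap]
  simp only [Prod.fst_swap, Prod.snd_swap, Prod.swap_swap, norm_sub_rev]

theorem aestronglyMeasurable_tensor (u v : Lp ℝ 2 (volume : Measure R3)) :
    AEStronglyMeasurable (fun z : R3 × R3 => u z.1 * v z.2) (volume.prod volume) :=
  (Lp.aestronglyMeasurable u).comp_fst.mul (Lp.aestronglyMeasurable v).comp_snd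

theorem eLpNorm_tensor_sq (t : ℝ) (u v : Lp ℝ 2 (volume : Measure R3)) :
    eLpNorm (fun z => u z.1 * v z.2) 2 (rieszMeasure t) ^ 2 =
      ∫⁻ z : R3 × R3, ‖u z.1‖ₑ ^ 2 * ‖v z.2‖ₑ ^ 2 * rieszKernel t (z.1 - z.2) := by
  rw [eLpNorm_eq_lintegral_rpow_enorm_toReal two_ne_zero ENNReal.ofNat_ne_top,
    ← ENNReal.rpow_natCast, ← ENNReal.rpow_mul]
  simp only [ENNReal.toReal_ofNat, Nat.cast_ofNat, one_div, ENNReal.rpow_ofNat]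
  rw [inv_mul_cancel₀ two_ne_zero, ENNReal.rpow_one, lintegral_rieszMeasure t
    ((aestronglyMeasurable_tensor u v).enorm.pow_const 2)]
  refine lintegral_congr fun z => ?_
  rw [enorm_mul, mul_pow]

/-- The bilinear map `(u, v) ↦ u(x) v(y)` from `H^s` to `L²(|x-y|^{-(3-2t)} dx dy)`. -/
theorem exists_tensor {s t : ℝ} (hs : 0 ≤ s) (hs3 : 2 * s < 3)
    (ht : t ∈ Set.Ioc (0 : ℝ) 1) (hst : 3 < 2 * t + 4 * s) :
    ∃ P : HSob s →L[ℝ] HSob s →L[ℝ] Lp ℝ 2 (rieszMeasure t),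
      ∀ u v, P u v =ᵐ[rieszMeasure t] fun z => u z.1 * v z.2 := by
  obtain ⟨C, hC, hbd⟩ := exists_lintegral_rieszKernel_le hs hs3 ht hst
  have hnorm : ∀ u v : HSob s, eLpNorm (fun z : R3 × R3 => u z.1 * v z.2) 2 (rieszMeasure t) ≤
      ENNReal.ofReal (C * ‖u‖ * ‖v‖) := by
    intro u v
    have h := hbd u v
    rw [← eLpNorm_tensor_sq, ENNReal.ofReal_pow (by positivity)] at h
    exact (ENNReal.pow_le_pow_left_iff two_ne_zero).1 h
  have hmem : ∀ u v : HSob s, MemLp (fun z : R3 × R3 => u z.1 * v z.2) 2 (rieszMeasure t) :=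
    fun u v => ⟨(aestronglyMeasurable_tensor _ _).mono_ac (rieszMeasure_absolutelyContinuous t),
      (hnorm u v).trans_lt ENNReal.ofReal_lt_top⟩
  have hae : ∀ u v : HSob s, (hmem u v).toLp _ =ᵐ[rieszMeasure t] fun z => u z.1 * v z.2 :=
    fun u v => MemLp.coeFn_toLp _
  let B : HSob s →ₗ[ℝ] HSob s →ₗ[ℝ] Lp ℝ 2 (rieszMeasure t) := LinearMap.mk₂ ℝ
    (fun u v => (hmem u v).toLp _)
    (fun u u' v => by
      rw [Lp.ext_iff]
      have h1 := Lp.coeFn_add (HSob.toL2 u) (HSob.toL2 u')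
      rw [← map_add] at h1
      filter_upwards [hae (u + u') v, hae u v, hae u' v, ae_rieszMeasure_fst t h1,
        Lp.coeFn_add ((hmem u v).toLp _) ((hmem u' v).toLp _)] with z e1 e2 e3 e4 e5
      rw [e1, e5, Pi.add_apply, e2, e3, e4, Pi.add_apply, add_mul])
    (fun c u v => by
      rw [Lp.ext_iff]
      have h1 := Lp.coeFn_smul c (HSob.toL2 u)
      rw [← map_smul] at h1
      filter_upwards [hae (c • u) v, hae u v, ae_rieszMeasure_fst t h1,
        Lp.coeFn_smul c ((hmem u v).toLp _)] with z e1 e2 e4 e5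
      rw [e1, e5, Pi.smul_apply, e2, e4, Pi.smul_apply, smul_mul_assoc])
    (fun u v v' => by
      rw [Lp.ext_iff]
      have h1 := Lp.coeFn_add (HSob.toL2 v) (HSob.toL2 v')
      rw [← map_add] at h1
      filter_upwards [hae u (v + v'), hae u v, hae u v', ae_rieszMeasure_snd t h1,
        Lp.coeFn_add ((hmem u v).toLp _) ((hmem u v').toLp _)] with z e1 e2 e3 e4 e5
      rw [e1, e5, Pi.add_apply, e2, e3, e4, Pi.add_apply, mul_add])
    (fun c u v => by
      rw [Lp.ext_iff]
      have h1 := Lp.coeFn_smul c (HSob.toL2 v)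
      rw [← map_smul] at h1
      filter_upwards [hae u (c • v), hae u v, ae_rieszMeasure_snd t h1,
        Lp.coeFn_smul c ((hmem u v).toLp _)] with z e1 e2 e4 e5
      rw [e1, e5, Pi.smul_apply, e2, e4, Pi.smul_apply, mul_smul_comm])
  refine ⟨B.mkContinuous₂ C fun u v => ?_, fun u v => hae u v⟩
  show ‖(hmem u v).toLp _‖ ≤ _
  rw [Lp.norm_toLp]
  exact ENNReal.toReal_le_of_le_ofReal (by positivity) (hnorm u v)

section Tensor

variable {s t : ℝ} {P : HSob s →L[ℝ] HSob s →L[ℝ] Lp ℝ 2 (rieszMeasure t)}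

theorem inner_tensor (hP : ∀ u v, P u v =ᵐ[rieszMeasure t] fun z => u z.1 * v z.2)
    (a b c d : HSob s) :
    inner ℝ (P a b) (P c d) = ∫ z, (a z.1 * b z.2) * (c z.1 * d z.2) ∂rieszMeasure t := by
  rw [L2.inner_def]
  refine integral_congr_ae ?_
  filter_upwards [hP a b, hP c d] with z h1 h2
  rw [h1, h2, real_inner_eq_re_inner]
  simp [mul_comm]

theorem inner_tensor_swap (hP : ∀ u v, P u v =ᵐ[rieszMeasure t] fun z => u z.1 * v z.2)
    (a b c d : HSob s) :
    inner ℝ (P a b) (P c d) = (inner ℝ (P b a) (P d c) : ℝ) := by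
  rw [inner_tensor hP, inner_tensor hP, ← integral_rieszMeasure_swap]
  congr 1
  ext z
  simp only [Prod.fst_swap, Prod.snd_swap]
  ring

/-- The weight `|x-y|^{-(3-2t)}` multiplies the product of all four functions, so the two functions
of `y` may be exchanged between the factors. -/
theorem inner_tensor_exchange (hP : ∀ u v, P u v =ᵐ[rieszMeasure t] fun z => u z.1 * v z.2)
    (a b c d : HSob s) :
    inner ℝ (P a b) (P c d) = (inner ℝ (P a d) (P c b) : ℝ) := by
  rw [inner_tensor hP, inner_tensor hP]
  congr 1
  ext z
  ring

/-- The nonlocal energy is the square of a norm (Fubini). -/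
theorem integral_phi_mul_sq (hP : ∀ u v, P u v =ᵐ[rieszMeasure t] fun z => u z.1 * v z.2)
    (u : HSob s) :
    ∫ x, phi t u x * u x ^ 2 = rieszConst t * ‖P u u‖ ^ 2 := by
  have hint : Integrable (fun z : R3 × R3 =>
      1 / ‖z.1 - z.2‖ ^ (3 - 2 * t) * ((u z.1 * u z.2) * (u z.1 * u z.2)))
      (volume.prod volume) := by
    have h1 : Integrable (fun z : R3 × R3 => (u z.1 * u z.2) * (u z.1 * u z.2))
        (rieszMeasure t) := by
      have h := (memLp_two_iff_integrable_sq (Lp.aestronglyMeasurable _)).1 (Lp.memLp (P u u))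
      refine h.congr ?_
      filter_upwards [hP u u] with z hz
      rw [hz, sq]
    rw [rieszMeasure, integrable_withDensity_iff_integrable_smul' (measurable_rieszKernel_sub t)
      (Eventually.of_forall fun z => ENNReal.ofReal_lt_top)] at h1
    refine h1.congr (Eventually.of_forall fun z => ?_)
    show _ • _ = _
    rw [rieszKernel, ENNReal.toReal_ofReal (by positivity), smul_eq_mul]
  rw [← real_inner_self_eq_norm_sq, inner_tensor hP, integral_rieszMeasure,
    integral_prod _ hint, ← integral_const_mul]
  congr 1
  ext x
  rw [phi, mul_assoc, ← integral_mul_const]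
  congr 2
  ext y
  ring

/-- The quartic energy `‖P(u,u)‖²` is differentiable, with derivative `h ↦ 4 ⟨P(u,u), P(u,h)⟩`. -/
theorem hasFDerivAt_tensor_sq (hP : ∀ u v, P u v =ᵐ[rieszMeasure t] fun z => u z.1 * v z.2)
    (u : HSob s) :
    HasFDerivAt (fun v => ‖P v v‖ ^ 2) ((4 : ℝ) • (innerSL ℝ (P u u)).comp (P u)) u := by
  have h1 : HasFDerivAt (fun v => P v v) _ u :=
    ContinuousLinearMap.hasFDerivAt_of_bilinear P (hasFDerivAt_id u) (hasFDerivAt_id u)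
  refine h1.norm_sq.congr_fderiv ?_
  ext h
  show (2 : ℕ) • inner ℝ (P u u) (P u h + P h u) = 4 * inner ℝ (P u u) (P u h)
  rw [inner_add_right, inner_tensor_swap hP u u h u, nsmul_eq_mul]
  push_cast
  ring

/-- If `h` is bounded with bounded support, then `P(w_n, h) → 0` in norm for every bounded sequence
that tends to zero in `L²` of every ball: the potential of `h²` is bounded and vanishes at
infinity. -/
theorem tendsto_tensor_zero (ht : t ∈ Set.Ioc (0 : ℝ) 1)
    (hP : ∀ u v, P u v =ᵐ[rieszMeasure t] fun z => u z.1 * v z.2)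
    {w : ℕ → HSob s} {C : ℝ} (hC : ∀ n, ‖w n‖ ≤ C)
    (hw : ∀ T : ℝ, Tendsto (fun n => eLpNorm (w n) 2 (volume.restrict (Metric.ball 0 T)))
      atTop (𝓝 0))
    {h : HSob s} {M ρ : ℝ} (hM : ∀ᵐ x, |h x| ≤ M) (hρ : ∀ᵐ x, ρ ≤ ‖x‖ → h x = 0) :
    Tendsto (fun n => P (w n) h) atTop (𝓝 0) := by
  obtain ⟨ht0, ht1⟩ := ht
  have hexp : 0 < 3 - 2 * t := by linarith
  have hhm : AEMeasurable (fun y => ‖h y‖ₑ ^ 2) :=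
    (Lp.aestronglyMeasurable (HSob.toL2 h)).enorm.pow_const 2
  set H := ∫⁻ y, ‖h y‖ₑ ^ 2 with hH
  have hHt : H < ∞ := (HSob.lintegral_enorm_sq_le h).trans_lt ENNReal.ofReal_lt_top
  set κ := ∫⁻ y, localKernel t y with hκ
  have hκt : κ < ∞ := by
    have := lintegral_localKernel_rpow_lt_top (t := t) (r := 1) one_pos (by linarith)
    simpa using this
  -- the potential of `h²`
  set φ : R3 → ℝ≥0∞ := fun x => ∫⁻ y, ‖h y‖ₑ ^ 2 * rieszKernel t (x - y) with hφ
  set S := ENNReal.ofReal M ^ 2 * κ + H with hS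
  have hSt : S < ∞ := ENNReal.add_lt_top.2
    ⟨ENNReal.mul_lt_top (by simp) hκt, hHt⟩
  have hm1 : ∀ x, Measurable fun y => localKernel t (x - y) := fun x =>
    (measurable_localKernel t).comp (measurable_const.sub measurable_id)
  have hm2 : ∀ x, Measurable fun y => rieszKernel t (x - y) := fun x =>
    (measurable_rieszKernel t).comp (measurable_const.sub measurable_id)
  have hφS : ∀ x, φ x ≤ S := by
    intro x
    calc φ x ≤ ∫⁻ y, (ENNReal.ofReal M ^ 2 * localKernel t (x - y) + ‖h y‖ₑ ^ 2) := by
          refine lintegral_mono_ae ?_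
          filter_upwards [hM] with y hy
          refine (mul_le_mul_right (rieszKernel_le ht1 (x - y)) _).trans ?_
          rw [mul_add, mul_one]
          gcongr
          rw [← ofReal_norm]
          exact ENNReal.ofReal_le_ofReal hy
      _ = ENNReal.ofReal M ^ 2 * κ + H := by
          rw [lintegral_add_right' _ hhm, lintegral_const_mul _ (hm1 x),
            lintegral_sub_left_eq_self (localKernel t) x]
  have hφfar : ∀ L : ℝ, 0 < L → ∀ x : R3, ρ + L ≤ ‖x‖ →
      φ x ≤ H * ENNReal.ofReal (1 / L ^ (3 - 2 * t)) := by
    intro L hL x hx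
    rw [hH, ← lintegral_mul_const'' _ hhm]
    refine lintegral_mono_ae ?_
    filter_upwards [hρ] with y hy
    by_cases hy' : ρ ≤ ‖y‖
    · simp [hy hy']
    · refine mul_le_mul_right (rieszKernel_le_of_le ht1 hL ?_) _
      have := norm_sub_norm_le x y
      linarith [not_le.1 hy']
  have hnorm : ∀ n, ‖P (w n) h‖ₑ ^ 2 = ∫⁻ x, ‖w n x‖ₑ ^ 2 * φ x := by
    intro n
    rw [Lp.enorm_def, eLpNorm_congr_ae (hP (w n) h), eLpNorm_tensor_sq]
    have hwm : AEMeasurable (fun x => ‖w n x‖ₑ ^ 2) :=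
      (Lp.aestronglyMeasurable (HSob.toL2 (w n))).enorm.pow_const 2
    refine (lintegral_prod _ ((hwm.comp_fst.mul hhm.comp_snd).mul
      (measurable_rieszKernel_sub t).aemeasurable)).trans ?_
    refine lintegral_congr fun x => ?_
    have hm3 : AEMeasurable fun y => ‖h y‖ₑ ^ 2 * rieszKernel t (x - y) :=
      hhm.mul (hm2 x).aemeasurable
    simp only [hφ]
    rw [← lintegral_const_mul'' _ hm3]
    refine lintegral_congr fun y => ?_
    simp only [Pi.mul_apply]
    rw [mul_assoc]
  have hsplit : ∀ (L : ℝ), 0 < L → ∀ n, ‖P (w n) h‖ₑ ^ 2 ≤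
      eLpNorm (w n) 2 (volume.restrict (Metric.ball 0 (ρ + L))) ^ 2 * S +
        ENNReal.ofReal (C ^ 2) * (H * ENNReal.ofReal (1 / L ^ (3 - 2 * t))) := by
    intro L hL n
    have hwm : AEMeasurable (fun x => ‖w n x‖ₑ ^ 2) :=
      (Lp.aestronglyMeasurable (HSob.toL2 (w n))).enorm.pow_const 2
    rw [hnorm, ← lintegral_add_compl _ (measurableSet_ball (x := (0 : R3)) (ε := ρ + L))]
    refine add_le_add ?_ ?_
    · have e : eLpNorm (w n) 2 (volume.restrict (Metric.ball 0 (ρ + L))) ^ 2 =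
          ∫⁻ x in Metric.ball 0 (ρ + L), ‖w n x‖ₑ ^ 2 := by
        rw [eLpNorm_eq_lintegral_rpow_enorm_toReal two_ne_zero ENNReal.ofNat_ne_top,
          ← ENNReal.rpow_natCast, ← ENNReal.rpow_mul]
        simp
      rw [e, ← lintegral_mul_const'' _ hwm.restrict]
      exact lintegral_mono fun x => mul_le_mul_right (hφS x) _
    · calc _ ≤ ∫⁻ x in (Metric.ball (0 : R3) (ρ + L))ᶜ,
            ‖w n x‖ₑ ^ 2 * (H * ENNReal.ofReal (1 / L ^ (3 - 2 * t))) := by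
            refine setLIntegral_mono' measurableSet_ball.compl fun x hx => ?_
            refine mul_le_mul_right (hφfar L hL x ?_) _
            simpa using hx
        _ ≤ ∫⁻ x, ‖w n x‖ₑ ^ 2 * (H * ENNReal.ofReal (1 / L ^ (3 - 2 * t))) :=
            lintegral_mono' Measure.restrict_le_self le_rfl
        _ ≤ _ := by
            rw [lintegral_mul_const'' _ hwm]
            gcongr
            refine (HSob.lintegral_enorm_sq_le (w n)).trans (ENNReal.ofReal_le_ofReal ?_)
            gcongr
            exact hC n
  have hlim : Tendsto (fun n => ‖P (w n) h‖ₑ ^ 2) atTop (𝓝 0) := by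
    rw [ENNReal.tendsto_nhds_zero]
    intro ε hε
    have hfar : ∃ L : ℝ, 0 < L ∧
        ENNReal.ofReal (C ^ 2) * (H * ENNReal.ofReal (1 / L ^ (3 - 2 * t))) ≤ ε / 2 := by
      have h1 : Tendsto (fun L : ℝ => ENNReal.ofReal (1 / L ^ (3 - 2 * t))) atTop (𝓝 0) := by
        rw [← ENNReal.ofReal_zero]
        refine ENNReal.tendsto_ofReal ?_
        simp only [one_div]
        exact (tendsto_rpow_atTop hexp).inv_tendsto_atTop
      have h2 := ENNReal.Tendsto.const_mul (a := ENNReal.ofReal (C ^ 2))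
        (ENNReal.Tendsto.const_mul (a := H) h1 (Or.inr hHt.ne)) (Or.inr ENNReal.ofReal_ne_top)
      rw [mul_zero, mul_zero, ENNReal.tendsto_nhds_zero] at h2
      obtain ⟨L, h3, h4⟩ := ((h2 (ε / 2) (ENNReal.half_pos hε.ne')).and
        (eventually_gt_atTop 0)).exists
      exact ⟨L, h4, h3⟩
    obtain ⟨L, hL, hfar⟩ := hfar
    have hnear : Tendsto (fun n => eLpNorm (w n) 2
        (volume.restrict (Metric.ball 0 (ρ + L))) ^ 2 * S) atTop (𝓝 0) := by
      have h1 := ((ENNReal.continuous_pow 2).tendsto 0).comp (hw (ρ + L))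
      have h2 := ENNReal.Tendsto.mul_const h1 (Or.inr hSt.ne)
      simpa [Function.comp_def] using h2
    filter_upwards [ENNReal.tendsto_nhds_zero.1 hnear (ε / 2) (ENNReal.half_pos hε.ne')]
      with n hn
    refine (hsplit L hL n).trans ?_
    rw [← ENNReal.add_halves ε]
    exact add_le_add hn hfar
  rw [tendsto_zero_iff_norm_tendsto_zero]
  have h1 : Tendsto (fun n => ‖P (w n) h‖ ^ 2) atTop (𝓝 0) := by
    have h2 := (ENNReal.tendsto_toReal ENNReal.zero_ne_top).comp hlim
    simpa [Function.comp_def] using h2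
  have h2 := h1.sqrt
  simpa using h2

/-- Passage to the limit in the derivative of the quartic energy. Exchanging variables turns
`⟨P(uₙ,uₙ), P(u,h)⟩` into `⟨P(uₙ,h), P(u,uₙ)⟩`, a product of a strongly and a weakly convergent
sequence. -/
theorem tendsto_inner_tensor (ht : t ∈ Set.Ioc (0 : ℝ) 1)
    (hP : ∀ u v, P u v =ᵐ[rieszMeasure t] fun z => u z.1 * v z.2)
    {u : ℕ → HSob s} {u₀ : HSob s} {C : ℝ} (hC : ∀ n, ‖u n‖ ≤ C) (hu : WeaklyConverges u u₀)
    (hloc : ∀ T : ℝ, Tendsto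
      (fun n => eLpNorm (u n - u₀ : HSob s) 2 (volume.restrict (Metric.ball 0 T))) atTop (𝓝 0))
    {h : HSob s} {M ρ : ℝ} (hM : ∀ᵐ x, |h x| ≤ M) (hρ : ∀ᵐ x, ρ ≤ ‖x‖ → h x = 0) :
    Tendsto (fun n => (inner ℝ (P (u n) (u n)) (P (u n) h) : ℝ)) atTop
      (𝓝 (inner ℝ (P u₀ u₀) (P u₀ h))) := by
  have hC0 : 0 ≤ C := (norm_nonneg _).trans (hC 0)
  have hstr : Tendsto (fun n => P (u n - u₀) h) atTop (𝓝 0) :=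
    tendsto_tensor_zero ht hP (C := C + ‖u₀‖)
      (fun n => (norm_sub_le _ _).trans (by gcongr; exact hC n)) hloc hM hρ
  obtain ⟨K, hK, hPK⟩ : ∃ K : ℝ, 0 ≤ K ∧ ∀ u v, ‖P u v‖ ≤ K * ‖u‖ * ‖v‖ := by
    obtain ⟨c, hc⟩ : ∃ c : ℝ, ∀ u v, ‖P u v‖ ≤ c * ‖u‖ * ‖v‖ :=
      ⟨_, fun u v => ContinuousLinearMap.le_opNorm₂ P u v⟩
    exact ⟨|c|, abs_nonneg c, fun u v => (hc u v).trans (by gcongr; exact le_abs_self c)⟩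
  have hbdd : ∀ n, ‖P (u n) (u n)‖ ≤ K * C * C := fun n =>
    (hPK _ _).trans (by gcongr <;> exact hC n)
  have hbdd2 : ∀ n, ‖P u₀ (u n)‖ ≤ K * ‖u₀‖ * C := fun n =>
    (hPK _ _).trans (by gcongr; exact hC n)
  have hzero : ∀ (b : ℕ → Lp ℝ 2 (rieszMeasure t)) (K : ℝ), (∀ n, ‖b n‖ ≤ K) →
      Tendsto (fun n => (inner ℝ (b n) (P (u n - u₀) h) : ℝ)) atTop (𝓝 0) := by
    intro b K hb
    refine squeeze_zero_norm (a := fun n => K * ‖P (u n - u₀) h‖) (fun n => ?_) ?_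
    · exact (norm_inner_le_norm _ _).trans (by gcongr; exact hb n)
    · simpa using (tendsto_zero_iff_norm_tendsto_zero.1 hstr).const_mul K
  have hweak : Tendsto (fun n => (inner ℝ (P u₀ h) (P u₀ (u n)) : ℝ)) atTop
      (𝓝 (inner ℝ (P u₀ h) (P u₀ u₀))) :=
    hu ((innerSL ℝ (P u₀ h)).comp (P u₀))
  -- in the last term `P u₀ h` is fixed and `P u₀ (u n)` converges weakly, and in the other two
  -- `P (u n - u₀) h` converges to zero in norm
  have hdec : ∀ n, (inner ℝ (P (u n) (u n)) (P (u n) h) : ℝ) =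
      inner ℝ (P (u n) (u n)) (P (u n - u₀) h) + inner ℝ (P u₀ (u n)) (P (u n - u₀) h) +
        inner ℝ (P u₀ h) (P u₀ (u n)) := by
    intro n
    have e1 : P (u n) h = P (u n - u₀) h + P u₀ h := by
      rw [map_sub]; simp
    have e3 : (inner ℝ (P (u n) h) (P u₀ (u n)) : ℝ) =
        inner ℝ (P u₀ (u n)) (P (u n - u₀) h) + inner ℝ (P u₀ h) (P u₀ (u n)) := by
      rw [e1, inner_add_left, real_inner_comm]
    calc (inner ℝ (P (u n) (u n)) (P (u n) h) : ℝ)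
        = inner ℝ (P (u n) (u n)) (P (u n - u₀) h) + inner ℝ (P (u n) (u n)) (P u₀ h) := by
          conv_lhs => rw [e1]
          rw [inner_add_right]
      _ = _ := by
          rw [inner_tensor_exchange hP (u n) (u n) u₀ h, e3]
          ring
  have hfin := ((hzero _ _ hbdd).add (hzero _ _ hbdd2)).add hweak
  rw [zero_add, zero_add, real_inner_comm] at hfin
  exact hfin.congr fun n => (hdec n).symm

end Tensor

/-! ### Carathéodory functions -/

/-- A Carathéodory function agrees, for almost every `x`, with a jointly measurable one. -/
theorem IsCaratheodory.exists_measurable {f : R3 → ℝ → ℝ} (hf : IsCaratheodory f) :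
    ∃ g : R3 → ℝ → ℝ, Measurable (Function.uncurry g) ∧ ∀ᵐ x, ∀ r, f x r = g x r := by
  obtain ⟨hm, hc⟩ := hf
  have hae : ∀ᵐ x, ∀ q : ℚ, f x q = (hm q).mk _ x := ae_all_iff.2 fun q => (hm q).ae_eq_mk
  obtain ⟨S, hSsub, hSm, hS0⟩ := exists_measurable_superset_of_null (ae_iff.1 hae)
  let g : R3 → ℝ → ℝ := fun x r => Sᶜ.indicator (fun x => f x r) x
  have hgc : ∀ x, Continuous (g x) := by
    intro x
    by_cases hx : x ∈ Sᶜ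
    · have : g x = f x := by ext r; exact Set.indicator_of_mem hx _
      rw [this]; exact hc x
    · have : g x = fun _ => 0 := by ext r; exact Set.indicator_of_notMem hx _
      rw [this]; exact continuous_const
  have hgq : ∀ q : ℚ, Measurable fun x => g x q := by
    intro q
    have : (fun x => g x q) = Sᶜ.indicator ((hm q).mk _) := by
      ext x
      by_cases hx : x ∈ Sᶜ
      · simp only [g, Set.indicator_of_mem hx]
        have : ¬ ¬ ∀ q : ℚ, f x q = (hm q).mk _ x := fun h => hx (hSsub h)
        exact not_not.1 this q
      · simp only [g, Set.indicator_of_notMem hx]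
    rw [this]
    exact (hm q).measurable_mk.indicator hSm.compl
  have hgr : ∀ r : ℝ, Measurable fun x => g x r := by
    intro r
    choose q hq1 hq2 using fun n : ℕ => exists_rat_btwn
      (lt_add_of_pos_right r (Nat.one_div_pos_of_nat (n := n) (α := ℝ)))
    have hq : Tendsto (fun n => (q n : ℝ)) atTop (𝓝 r) := by
      refine tendsto_of_tendsto_of_tendsto_of_le_of_le tendsto_const_nhds ?_
        (fun n => (hq1 n).le) (fun n => (hq2 n).le)
      simpa using tendsto_const_nhds.add (tendsto_one_div_add_atTop_nhds_zero_nat (𝕜 := ℝ))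
    refine measurable_of_tendsto_metrizable (fun n => hgq (q n)) ?_
    rw [tendsto_pi_nhds]
    exact fun x => ((hgc x).tendsto r).comp hq
  refine ⟨g, ?_, ?_⟩
  · have h := measurable_uncurry_of_continuous_of_measurable (u := fun r x => g x r) hgc hgr
    exact h.comp measurable_swap
  · have hS : ∀ᵐ x, x ∈ Sᶜ := measure_eq_zero_iff_ae_notMem.1 hS0
    filter_upwards [hS] with x hx r
    exact (Set.indicator_of_mem hx fun x => f x r).symm

theorem IsCaratheodory.aemeasurable_comp {f : R3 → ℝ → ℝ} (hf : IsCaratheodory f)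
    {u : R3 → ℝ} (hu : AEMeasurable u) : AEMeasurable fun x => f x (u x) := by
  obtain ⟨g, hg, hfg⟩ := hf.exists_measurable
  have h1 : AEMeasurable fun x => g x (u x) := hg.comp_aemeasurable (aemeasurable_id.prodMk hu)
  refine h1.congr ?_
  filter_upwards [hfg] with x hx
  exact (hx _).symm

/-- This form, with a fixed interval of integration, shows the measurability of
`x ↦ F(x, u(x))`. -/
theorem primitive_eq_mul_integral (f : R3 → ℝ → ℝ) (x : R3) (r : ℝ) :
    primitive f x r = r * ∫ τ in (0 : ℝ)..1, f x (r * τ) := by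
  have h := intervalIntegral.mul_integral_comp_mul_left (f := f x) (a := 0) (b := 1) r
  rw [h, mul_zero, mul_one, primitive]

theorem IsCaratheodory.aemeasurable_primitive {f : R3 → ℝ → ℝ} (hf : IsCaratheodory f)
    {u : R3 → ℝ} (hu : Measurable u) : AEMeasurable fun x => primitive f x (u x) := by
  obtain ⟨g, hg, hfg⟩ := hf.exists_measurable
  have h1 : Measurable fun z : R3 × ℝ => g z.1 (u z.1 * z.2) :=
    hg.comp (measurable_fst.prodMk ((hu.comp measurable_fst).mul measurable_snd))
  have h2 : Measurable fun x => u x * ∫ τ in Set.Ioc (0 : ℝ) 1, g x (u x * τ) :=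
    hu.mul h1.stronglyMeasurable.integral_prod_right.measurable
  refine h2.aemeasurable.congr ?_
  filter_upwards [hfg] with x hx
  rw [primitive_eq_mul_integral, intervalIntegral.integral_of_le zero_le_one]
  simp only [hx]

theorem primitive_add_sub {f : R3 → ℝ → ℝ} (hf : IsCaratheodory f) (x : R3) (a w : ℝ) :
    primitive f x (a + w) - primitive f x a - f x a * w =
      ∫ τ in a..(a + w), (f x τ - f x a) := by
  have hi : ∀ b c, IntervalIntegrable (f x) volume b c := fun b c =>
    (hf.2 x).intervalIntegrable b c
  rw [primitive, primitive, intervalIntegral.integral_interval_sub_left (hi _ _) (hi _ _),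
    intervalIntegral.integral_sub (hi _ _) (by simp), intervalIntegral.integral_const]
  simp [mul_comm]

/-! ### The modulus of continuity relative to a power growth -/

/-- The excess of `|f(x, a + w) - f(x, a)|` over `K (|w| + |w|^{p-1})`, maximized over `w`.
The supremum runs over rational `w` so as to be measurable in `x`; by continuity this is
the supremum over all real `w`. -/
def excess (f : R3 → ℝ → ℝ) (p K : ℝ) (x : R3) (a : ℝ) : ℝ≥0∞ :=
  ⨆ w : ℚ, ENNReal.ofReal (|f x (a + w) - f x a| - K * (|(w : ℝ)| + |(w : ℝ)| ^ (p - 1)))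

theorem IsCaratheodory.aemeasurable_excess {f : R3 → ℝ → ℝ} (hf : IsCaratheodory f) (p K : ℝ)
    {u : R3 → ℝ} (hu : AEMeasurable u) : AEMeasurable fun x => excess f p K x (u x) := by
  refine AEMeasurable.iSup fun w => ?_
  exact (((hf.aemeasurable_comp (hu.add_const _)).sub
    (hf.aemeasurable_comp hu)).abs.sub_const _).ennreal_ofReal

theorem ofReal_abs_sub_le_excess {f : R3 → ℝ → ℝ} (hf : IsCaratheodory f) {p K : ℝ} (hp : 2 ≤ p)
    (x : R3) (a w : ℝ) :
    ENNReal.ofReal |f x (a + w) - f x a| ≤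
      excess f p K x a + ENNReal.ofReal (K * (|w| + |w| ^ (p - 1))) := by
  have hcl : IsClosed {w : ℝ |
      ENNReal.ofReal (|f x (a + w) - f x a| - K * (|w| + |w| ^ (p - 1))) ≤ excess f p K x a} := by
    refine isClosed_le (ENNReal.continuous_ofReal.comp ?_) continuous_const
    have h1 : Continuous fun w : ℝ => f x (a + w) := (hf.2 x).comp (continuous_const_add a)
    have h2 : Continuous fun w : ℝ => |w| ^ (p - 1) :=
      continuous_abs.rpow_const fun _ => Or.inr (by linarith)
    exact (h1.sub continuous_const).abs.sub (continuous_const.mul (continuous_abs.add h2))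
  have hw : ENNReal.ofReal (|f x (a + w) - f x a| - K * (|w| + |w| ^ (p - 1))) ≤
      excess f p K x a :=
    Rat.isDenseEmbedding_coe_real.dense.induction_on
      (p := fun w : ℝ => ENNReal.ofReal (|f x (a + w) - f x a| - K * (|w| + |w| ^ (p - 1))) ≤
        excess f p K x a) w hcl
      fun q => le_iSup (fun w : ℚ => ENNReal.ofReal
        (|f x (a + w) - f x a| - K * (|(w : ℝ)| + |(w : ℝ)| ^ (p - 1)))) q
  calc ENNReal.ofReal |f x (a + w) - f x a|
      = ENNReal.ofReal ((|f x (a + w) - f x a| - K * (|w| + |w| ^ (p - 1))) +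
          K * (|w| + |w| ^ (p - 1))) := by ring_nf
    _ ≤ _ := ENNReal.ofReal_add_le
    _ ≤ _ := by gcongr

section Growth

variable {f : R3 → ℝ → ℝ} {C₁ p : ℝ}

/-- The constant of the growth bound for `f(x, a + w) - f(x, a)`; the power of `2` comes from
`|a + w|^{p-1} ≤ 2^{p-1} (|a|^{p-1} + |w|^{p-1})`. -/
def diffConst (C₁ p : ℝ) : ℝ := C₁ * (2 ^ (p - 1) + 1)

theorem diffConst_pos (hC : 0 < C₁) : 0 < diffConst C₁ p := by
  unfold diffConst; positivity

theorem abs_sub_le_of_growth (hC : 0 < C₁) (hp : 2 ≤ p)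
    (hg : ∀ x u, |f x u| ≤ C₁ * (|u| + |u| ^ (p - 1))) (x : R3) (a w : ℝ) :
    |f x (a + w) - f x a| ≤ diffConst C₁ p * (|a| + |a| ^ (p - 1)) +
      diffConst C₁ p * (|w| + |w| ^ (p - 1)) := by
  have hp1 : 0 ≤ p - 1 := by linarith
  have h2 : (1 : ℝ) ≤ 2 ^ (p - 1) := Real.one_le_rpow one_le_two hp1
  have h3 : |a + w| ^ (p - 1) ≤ 2 ^ (p - 1) * (|a| ^ (p - 1) + |w| ^ (p - 1)) := by
    have h4 : |a + w| ≤ 2 * max |a| |w| := by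
      refine (abs_add_le a w).trans ?_
      linarith [le_max_left |a| |w|, le_max_right |a| |w|]
    calc |a + w| ^ (p - 1) ≤ (2 * max |a| |w|) ^ (p - 1) :=
          Real.rpow_le_rpow (abs_nonneg _) h4 hp1
      _ = 2 ^ (p - 1) * (max |a| |w|) ^ (p - 1) :=
          Real.mul_rpow zero_le_two (le_max_of_le_left (abs_nonneg _))
      _ ≤ _ := by
          gcongr
          rcases max_choice |a| |w| with h | h <;> rw [h]
          · exact le_add_of_nonneg_right (by positivity)
          · exact le_add_of_nonneg_left (by positivity)
  have h5 := hg x (a + w)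
  have h6 := hg x a
  have h7 : |f x (a + w) - f x a| ≤ |f x (a + w)| + |f x a| := abs_sub _ _
  have h8 := abs_add_le a w
  have e : |f x (a + w) - f x a| ≤ C₁ * (|a| + |w| +
      2 ^ (p - 1) * (|a| ^ (p - 1) + |w| ^ (p - 1)) + (|a| + |a| ^ (p - 1))) := by
    have : C₁ * (|a + w| + |a + w| ^ (p - 1)) ≤ C₁ * (|a| + |w| +
      2 ^ (p - 1) * (|a| ^ (p - 1) + |w| ^ (p - 1))) := by gcongr
    linarith
  refine e.trans ?_
  rw [diffConst, ← mul_add, mul_assoc]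
  refine mul_le_mul_of_nonneg_left ?_ hC.le
  have i1 : |a| ≤ 2 ^ (p - 1) * |a| := le_mul_of_one_le_left (abs_nonneg _) h2
  have i2 : 0 ≤ 2 ^ (p - 1) * |w| := by positivity
  have i3 : 0 ≤ |w| ^ (p - 1) := by positivity
  linarith

theorem excess_le (hC : 0 < C₁) (hp : 2 ≤ p)
    (hg : ∀ x u, |f x u| ≤ C₁ * (|u| + |u| ^ (p - 1))) {K : ℝ} (hK : diffConst C₁ p ≤ K)
    (x : R3) (a : ℝ) :
    excess f p K x a ≤ ENNReal.ofReal (diffConst C₁ p * (|a| + |a| ^ (p - 1))) := by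
  refine iSup_le fun w => ENNReal.ofReal_le_ofReal ?_
  have h := abs_sub_le_of_growth hC hp hg x a w
  have : diffConst C₁ p * (|(w : ℝ)| + |(w : ℝ)| ^ (p - 1)) ≤
    K * (|(w : ℝ)| + |(w : ℝ)| ^ (p - 1)) := by gcongr
  linarith

/-- For `|w| < δ` the difference `f(x, a + w) - f(x, a)` is small by continuity; for `|w| ≥ δ` the
growth bound for it is absorbed by the term `n |w|`. -/
theorem tendsto_excess (hf : IsCaratheodory f) (hC : 0 < C₁) (hp : 2 ≤ p)
    (hg : ∀ x u, |f x u| ≤ C₁ * (|u| + |u| ^ (p - 1))) (x : R3) (a : ℝ) :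
    Tendsto (fun n : ℕ => excess f p (diffConst C₁ p + n) x a) atTop (𝓝 0) := by
  set D := diffConst C₁ p
  have hD : 0 < D := diffConst_pos hC
  rw [ENNReal.tendsto_nhds_zero]
  intro ε hε
  rcases eq_or_ne ε ∞ with rfl | hεt
  · simp
  have hε' : 0 < ε.toReal := ENNReal.toReal_pos hε.ne' hεt
  obtain ⟨δ, hδ, hcont⟩ := Metric.continuous_iff.1 (hf.2 x) a ε.toReal hε'
  set A := D * (|a| + |a| ^ (p - 1)) with hA
  have hA0 : 0 ≤ A := by positivity
  obtain ⟨N, hN⟩ := exists_nat_ge (A / δ)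
  filter_upwards [eventually_ge_atTop N] with n hn
  refine iSup_le fun w => ?_
  rw [← ENNReal.ofReal_toReal hεt]
  refine ENNReal.ofReal_le_ofReal ?_
  have hpos : 0 ≤ |(w : ℝ)| + |(w : ℝ)| ^ (p - 1) := by positivity
  by_cases hw : |(w : ℝ)| < δ
  · have h1 := hcont (a + w) (by rw [Real.dist_eq, add_sub_cancel_left]; exact hw)
    rw [Real.dist_eq] at h1
    have h2 : 0 ≤ (D + n) * (|(w : ℝ)| + |(w : ℝ)| ^ (p - 1)) := by positivity
    linarith
  · have h1 := abs_sub_le_of_growth hC hp hg x a w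
    have h2 : A ≤ n * |(w : ℝ)| := by
      have h3 : A / δ ≤ n := hN.trans (by exact_mod_cast hn)
      rw [div_le_iff₀ hδ] at h3
      exact h3.trans (mul_le_mul_of_nonneg_left (not_lt.1 hw) (Nat.cast_nonneg n))
    have h4 : 0 ≤ (n : ℝ) * |(w : ℝ)| ^ (p - 1) := by positivity
    have h5 : (D + n) * (|(w : ℝ)| + |(w : ℝ)| ^ (p - 1)) =
      D * (|(w : ℝ)| + |(w : ℝ)| ^ (p - 1)) + n * |(w : ℝ)| + n * |(w : ℝ)| ^ (p - 1) := by ring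
    linarith

/-- The first-order Taylor remainder of `F(x, ·)` in terms of `excess`. -/
theorem ofReal_abs_primitive_sub_le (hf : IsCaratheodory f) (hC : 0 < C₁) (hp : 2 ≤ p)
    (hg : ∀ x u, |f x u| ≤ C₁ * (|u| + |u| ^ (p - 1))) {K : ℝ} (hK : diffConst C₁ p ≤ K)
    (x : R3) (a w : ℝ) :
    ENNReal.ofReal |primitive f x (a + w) - primitive f x a - f x a * w| ≤
      (excess f p K x a + ENNReal.ofReal (K * (|w| + |w| ^ (p - 1)))) * ENNReal.ofReal |w| := by
  have hK0 : 0 ≤ K := (diffConst_pos hC).le.trans hK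
  have hfin : excess f p K x a ≠ ∞ :=
    ((excess_le hC hp hg hK x a).trans_lt ENNReal.ofReal_lt_top).ne
  rw [primitive_add_sub hf]
  have hb := intervalIntegral.norm_integral_le_of_norm_le_const (a := a) (b := a + w)
    (f := fun τ => f x τ - f x a)
    (C := (excess f p K x a).toReal + K * (|w| + |w| ^ (p - 1))) (fun τ hτ => by
      have h1 := ofReal_abs_sub_le_excess hf hp (K := K) x a (τ - a)
      rw [add_sub_cancel] at h1
      have h2 : |τ - a| ≤ |w| := by
        have := Set.abs_sub_left_of_mem_uIcc (Set.uIoc_subset_uIcc hτ)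
        simpa using this
      have h3 : K * (|τ - a| + |τ - a| ^ (p - 1)) ≤ K * (|w| + |w| ^ (p - 1)) := by
        have : |τ - a| ^ (p - 1) ≤ |w| ^ (p - 1) :=
          Real.rpow_le_rpow (abs_nonneg _) h2 (by linarith)
        gcongr
      rw [← ENNReal.ofReal_toReal hfin, ← ENNReal.ofReal_add ENNReal.toReal_nonneg
        (by positivity), ENNReal.ofReal_le_ofReal_iff (by positivity)] at h1
      rw [Real.norm_eq_abs]
      linarith)
  rw [add_sub_cancel_left, Real.norm_eq_abs] at hb
  refine (ENNReal.ofReal_le_ofReal hb).trans (le_of_eq ?_)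
  rw [ENNReal.ofReal_mul (by positivity), ENNReal.ofReal_add ENNReal.toReal_nonneg
    (by positivity), ENNReal.ofReal_toReal hfin]

end Growth

/-! ### Duality with `L² ∩ L^p` -/

/-- The quantity `‖G 1_{|u| ≤ 1}‖_{L²} + ‖G 1_{|u| > 1}‖_{L^{p'}}`, which bounds the norm of `G` in
the dual of `L² ∩ L^p`. If `G` is of the order of `|u| + |u|^{p-1}`, then this cut makes both terms
finite. -/
def dualNorm (p : ℝ) (u : R3 → ℝ) (G : R3 → ℝ≥0∞) : ℝ≥0∞ :=
  (∫⁻ x in {x | |u x| ≤ 1}, G x ^ (2 : ℝ)) ^ (1 / 2 : ℝ) +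
    (∫⁻ x in {x | |u x| ≤ 1}ᶜ, G x ^ (p / (p - 1))) ^ (1 / (p / (p - 1)))

theorem HSob.measurable {s : ℝ} (u : HSob s) : Measurable (u : R3 → ℝ) :=
  (Lp.stronglyMeasurable (HSob.toL2 u)).measurable

theorem HSob.measurableSet_le_one {s : ℝ} (u : HSob s) : MeasurableSet {x | |u x| ≤ 1} :=
  measurableSet_le u.measurable.abs measurable_const

theorem HSob.eLpNorm_two_le {s : ℝ} (u : HSob s) :
    eLpNorm u 2 volume ≤ ENNReal.ofReal ‖u‖ := by
  rw [← Lp.enorm_def, ← ofReal_norm]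
  exact ENNReal.ofReal_le_ofReal (HSob.norm_toL2_le u)

theorem HSob.lintegral_rpow_eq {s : ℝ} (u : HSob s) {q : ℝ} (hq : 0 < q) :
    (∫⁻ x, ‖u x‖ₑ ^ q) ^ (1 / q) = eLpNorm u (ENNReal.ofReal q) volume := by
  rw [eLpNorm_eq_lintegral_rpow_enorm_toReal (by simpa using hq) ENNReal.ofReal_ne_top,
    ENNReal.toReal_ofReal hq.le]

/-- `C` is a constant of the embedding `H^s ⊆ L^p`. By `1 ≤ C` it is one for `H^s ⊆ L²`, too. -/
def IsEmbeddingConst (s p C : ℝ) : Prop :=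
  1 ≤ C ∧ ∀ u : HSob s, eLpNorm u (ENNReal.ofReal p) volume ≤ ENNReal.ofReal (C * ‖u‖)

theorem exists_isEmbeddingConst {s p : ℝ} (hs : 0 ≤ s) (hs3 : 2 * s < 3) (hp : 2 ≤ p)
    (hp' : p < 6 / (3 - 2 * s)) : ∃ C, IsEmbeddingConst s p C := by
  obtain ⟨C, -, h⟩ := HSob.exists_eLpNorm_le hs hs3 hp hp'
  refine ⟨max C 1, le_max_right _ _, fun u => (h u).trans (ENNReal.ofReal_le_ofReal ?_)⟩
  gcongr
  exact le_max_left _ _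

section

variable {s p C : ℝ}

theorem IsEmbeddingConst.lintegral_rpow_le (hC : IsEmbeddingConst s p C) (hp : 2 ≤ p)
    (u : HSob s) : ∫⁻ x, ‖u x‖ₑ ^ p ≤ ENNReal.ofReal ((C * ‖u‖) ^ p) := by
  have hp0 : 0 < p := by linarith
  have hC0 : 0 ≤ C := by linarith [hC.1]
  have h := hC.2 u
  rw [← u.lintegral_rpow_eq hp0] at h
  have h2 := ENNReal.rpow_le_rpow h hp0.le
  rwa [← ENNReal.rpow_mul, one_div_mul_cancel hp0.ne', ENNReal.rpow_one,
    ENNReal.ofReal_rpow_of_nonneg (by positivity) hp0.le] at h2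

theorem lintegral_mul_enorm_le (hC : IsEmbeddingConst s p C) (hp : 2 ≤ p) (u h : HSob s)
    {G : R3 → ℝ≥0∞} (hG : AEMeasurable G) :
    ∫⁻ x, G x * ‖h x‖ₑ ≤ dualNorm p u G * ENNReal.ofReal (C * ‖h‖) := by
  have hp0 : 0 < p := by linarith
  have hp1 : 1 < p := by linarith
  have hconj : (p / (p - 1)).HolderConjugate p := (Real.HolderConjugate.conjExponent hp1).symm
  have hhm : AEMeasurable fun x => ‖h x‖ₑ := h.measurable.enorm.aemeasurable
  have h1 := ENNReal.lintegral_mul_le_Lp_mul_Lq (volume.restrict {x | |u x| ≤ 1})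
    Real.HolderConjugate.two_two hG.restrict hhm.restrict
  have h2 := ENNReal.lintegral_mul_le_Lp_mul_Lq (volume.restrict {x | |u x| ≤ 1}ᶜ)
    hconj hG.restrict hhm.restrict
  have b1 : (∫⁻ x in {x | |u x| ≤ 1}, ‖h x‖ₑ ^ (2 : ℝ)) ^ (1 / 2 : ℝ) ≤
      ENNReal.ofReal (C * ‖h‖) := by
    calc _ ≤ (∫⁻ x, ‖h x‖ₑ ^ (2 : ℝ)) ^ (1 / 2 : ℝ) := by
          gcongr; exact Measure.restrict_le_self
      _ = eLpNorm h 2 volume := by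
          rw [h.lintegral_rpow_eq two_pos]; simp
      _ ≤ ENNReal.ofReal ‖h‖ := h.eLpNorm_two_le
      _ ≤ _ := ENNReal.ofReal_le_ofReal (le_mul_of_one_le_left (norm_nonneg _) hC.1)
  have b2 : (∫⁻ x in {x | |u x| ≤ 1}ᶜ, ‖h x‖ₑ ^ p) ^ (1 / p) ≤ ENNReal.ofReal (C * ‖h‖) := by
    calc _ ≤ (∫⁻ x, ‖h x‖ₑ ^ p) ^ (1 / p) := by
          gcongr; exact Measure.restrict_le_self
      _ ≤ _ := by rw [h.lintegral_rpow_eq hp0]; exact hC.2 h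
  rw [← lintegral_add_compl _ u.measurableSet_le_one, dualNorm, add_mul]
  exact add_le_add (h1.trans (mul_le_mul_right b1 _)) (h2.trans (mul_le_mul_right b2 _))

theorem setLIntegral_growth_sq_lt_top (hp : 2 ≤ p) (u : HSob s) {D : ℝ} (hD : 0 ≤ D) :
    ∫⁻ x in {x | |u x| ≤ 1}, ENNReal.ofReal (D * (|u x| + |u x| ^ (p - 1))) ^ (2 : ℝ) < ∞ := by
  calc _ ≤ ∫⁻ x in {x | |u x| ≤ 1}, ENNReal.ofReal (2 * D) ^ (2 : ℝ) * ‖u x‖ₑ ^ (2 : ℝ) := by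
        refine setLIntegral_mono' u.measurableSet_le_one fun x hx => ?_
        rw [← ENNReal.mul_rpow_of_nonneg _ _ zero_le_two]
        refine ENNReal.rpow_le_rpow ?_ zero_le_two
        rw [← ofReal_norm, Real.norm_eq_abs, ← ENNReal.ofReal_mul (by positivity)]
        refine ENNReal.ofReal_le_ofReal ?_
        have h1 : |u x| ^ (p - 1) ≤ |u x| := by
          simpa using Real.rpow_le_rpow_of_exponent_ge' (abs_nonneg (u x)) hx zero_le_one
            (by linarith : (1 : ℝ) ≤ p - 1)
        nlinarith
    _ ≤ ∫⁻ x, ENNReal.ofReal (2 * D) ^ (2 : ℝ) * ‖u x‖ₑ ^ (2 : ℝ) :=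
        lintegral_mono' Measure.restrict_le_self le_rfl
    _ < ∞ := by
        rw [lintegral_const_mul'' _ (u.measurable.enorm.pow_const _).aemeasurable]
        refine ENNReal.mul_lt_top
          (ENNReal.rpow_lt_top_of_nonneg zero_le_two ENNReal.ofReal_ne_top) ?_
        simp only [ENNReal.rpow_ofNat]
        exact u.lintegral_enorm_sq_le.trans_lt ENNReal.ofReal_lt_top

theorem setLIntegral_growth_rpow_lt_top (hC : IsEmbeddingConst s p C) (hp : 2 ≤ p) (u : HSob s)
    {D : ℝ} (hD : 0 ≤ D) :
    ∫⁻ x in {x | |u x| ≤ 1}ᶜ, ENNReal.ofReal (D * (|u x| + |u x| ^ (p - 1))) ^ (p / (p - 1))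
      < ∞ := by
  have hp1 : 0 < p - 1 := by linarith
  have hpp : 0 ≤ p / (p - 1) := by positivity
  calc _ ≤ ∫⁻ x in {x | |u x| ≤ 1}ᶜ, ENNReal.ofReal (2 * D) ^ (p / (p - 1)) * ‖u x‖ₑ ^ p := by
        refine setLIntegral_mono' u.measurableSet_le_one.compl fun x hx => ?_
        have hx1 : 1 ≤ |u x| := (not_le.1 (Set.notMem_of_mem_compl hx)).le
        have e : ‖u x‖ₑ ^ p = (‖u x‖ₑ ^ (p - 1)) ^ (p / (p - 1)) := by
          rw [← ENNReal.rpow_mul]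
          congr 1
          field_simp
        rw [e, ← ENNReal.mul_rpow_of_nonneg _ _ hpp]
        refine ENNReal.rpow_le_rpow ?_ hpp
        rw [← ofReal_norm, Real.norm_eq_abs, ENNReal.ofReal_rpow_of_nonneg (abs_nonneg _) hp1.le,
          ← ENNReal.ofReal_mul (by positivity)]
        refine ENNReal.ofReal_le_ofReal ?_
        have h1 : |u x| ≤ |u x| ^ (p - 1) := by
          simpa using Real.rpow_le_rpow_of_exponent_le hx1 (by linarith : (1 : ℝ) ≤ p - 1)
        nlinarith
    _ ≤ ∫⁻ x, ENNReal.ofReal (2 * D) ^ (p / (p - 1)) * ‖u x‖ₑ ^ p :=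
        lintegral_mono' Measure.restrict_le_self le_rfl
    _ < ∞ := by
        rw [lintegral_const_mul'' _ (u.measurable.enorm.pow_const _).aemeasurable]
        refine ENNReal.mul_lt_top (ENNReal.rpow_lt_top_of_nonneg hpp ENNReal.ofReal_ne_top) ?_
        exact (hC.lintegral_rpow_le hp u).trans_lt ENNReal.ofReal_lt_top

theorem dualNorm_growth_lt_top (hC : IsEmbeddingConst s p C) (hp : 2 ≤ p) (u : HSob s)
    {D : ℝ} (hD : 0 ≤ D) :
    dualNorm p u (fun x => ENNReal.ofReal (D * (|u x| + |u x| ^ (p - 1)))) < ∞ := by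
  have hp1 : 0 < p - 1 := by linarith
  exact ENNReal.add_lt_top.2
    ⟨ENNReal.rpow_lt_top_of_nonneg (by norm_num) (setLIntegral_growth_sq_lt_top hp u hD).ne,
      ENNReal.rpow_lt_top_of_nonneg (by positivity)
        (setLIntegral_growth_rpow_lt_top hC hp u hD).ne⟩

/-- Dominated convergence in `dualNorm`. -/
theorem tendsto_dualNorm_zero (hC : IsEmbeddingConst s p C) (hp : 2 ≤ p) (u : HSob s)
    {D : ℝ} (hD : 0 ≤ D) {G : ℕ → R3 → ℝ≥0∞} (hG : ∀ n, AEMeasurable (G n))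
    (hle : ∀ n x, G n x ≤ ENNReal.ofReal (D * (|u x| + |u x| ^ (p - 1))))
    (hlim : ∀ x, Tendsto (fun n => G n x) atTop (𝓝 0)) :
    Tendsto (fun n => dualNorm p u (G n)) atTop (𝓝 0) := by
  have hp1 : 0 < p - 1 := by linarith
  have hp0 : 0 < p := by linarith
  have key : ∀ (A : Set R3) (a : ℝ), 0 < a →
      ∫⁻ x in A, ENNReal.ofReal (D * (|u x| + |u x| ^ (p - 1))) ^ a < ∞ →
      Tendsto (fun n => (∫⁻ x in A, G n x ^ a) ^ (1 / a)) atTop (𝓝 0) := by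
    intro A a ha hfin
    have h1 := tendsto_lintegral_of_dominated_convergence' (μ := volume.restrict A)
      (F := fun n x => G n x ^ a) (f := fun _ => 0)
      (fun x => ENNReal.ofReal (D * (|u x| + |u x| ^ (p - 1))) ^ a)
      (fun n => ((hG n).pow_const a).restrict)
      (fun n => Eventually.of_forall fun x => ENNReal.rpow_le_rpow (hle n x) ha.le)
      hfin.ne
      (Eventually.of_forall fun x => by
        have h2 := ((ENNReal.continuous_rpow_const (y := a)).tendsto 0).comp (hlim x)
        rwa [ENNReal.zero_rpow_of_pos ha] at h2)
    rw [lintegral_zero] at h1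
    have h3 := ((ENNReal.continuous_rpow_const (y := 1 / a)).tendsto 0).comp h1
    rwa [ENNReal.zero_rpow_of_pos (by positivity)] at h3
  have h := (key _ 2 two_pos (setLIntegral_growth_sq_lt_top hp u hD)).add
    (key _ (p / (p - 1)) (by positivity) (setLIntegral_growth_rpow_lt_top hC hp u hD))
  rwa [add_zero] at h

theorem lintegral_growth_mul_enorm_le (hC : IsEmbeddingConst s p C) (hp : 2 ≤ p) (h : HSob s)
    {K : ℝ} (hK : 0 ≤ K) :
    ∫⁻ x, ENNReal.ofReal (K * (|h x| + |h x| ^ (p - 1))) * ‖h x‖ₑ ≤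
      ENNReal.ofReal (K * (‖h‖ ^ 2 + (C * ‖h‖) ^ p)) := by
  have hC0 : 0 ≤ C := by linarith [hC.1]
  have hp1 : 0 < p - 1 := by linarith
  have hpt : ∀ x, ENNReal.ofReal (K * (|h x| + |h x| ^ (p - 1))) * ‖h x‖ₑ =
      ENNReal.ofReal K * (‖h x‖ₑ ^ 2 + ‖h x‖ₑ ^ p) := by
    intro x
    rw [← ofReal_norm, Real.norm_eq_abs, ENNReal.ofReal_rpow_of_nonneg (abs_nonneg _)
      (by linarith), ← ENNReal.ofReal_pow (abs_nonneg _), ← ENNReal.ofReal_add (by positivity)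
      (by positivity), ← ENNReal.ofReal_mul hK, ← ENNReal.ofReal_mul (by positivity)]
    congr 1
    have e : |h x| ^ p = |h x| ^ (p - 1) * |h x| := by
      conv_lhs => rw [← sub_add_cancel p 1]
      rw [Real.rpow_add_one' (abs_nonneg _) (by linarith)]
    rw [e]
    ring
  simp only [hpt]
  have hm : Measurable fun x => ‖h x‖ₑ ^ 2 + ‖h x‖ₑ ^ p :=
    (h.measurable.enorm.pow_const 2).add (h.measurable.enorm.pow_const p)
  rw [lintegral_const_mul _ hm,
    lintegral_add_left (h.measurable.enorm.pow_const 2), ENNReal.ofReal_mul hK,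
    ENNReal.ofReal_add (by positivity) (by positivity)]
  gcongr
  · exact h.lintegral_enorm_sq_le
  · exact hC.lintegral_rpow_le hp h

end

/-! ### The superposition term `∫ F(x, u) dx` -/

section

variable {s p C C₁ : ℝ} {f : R3 → ℝ → ℝ}

theorem lintegral_comp_mul_lt_top (hC : IsEmbeddingConst s p C) (hp : 2 ≤ p) (hC₁ : 0 < C₁)
    (u h : HSob s) :
    ∫⁻ x, ENNReal.ofReal (C₁ * (|u x| + |u x| ^ (p - 1))) * ‖h x‖ₑ < ∞ := by
  have hm : Measurable fun x => ENNReal.ofReal (C₁ * (|u x| + |u x| ^ (p - 1))) := by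
    have := u.measurable
    fun_prop
  exact (lintegral_mul_enorm_le hC hp u h hm.aemeasurable).trans_lt
    (ENNReal.mul_lt_top (dualNorm_growth_lt_top hC hp u hC₁.le) ENNReal.ofReal_lt_top)

theorem integrable_comp_mul (hC : IsEmbeddingConst s p C) (hf : IsCaratheodory f) (hp : 2 ≤ p)
    (hC₁ : 0 < C₁) (hg : ∀ x u, |f x u| ≤ C₁ * (|u| + |u| ^ (p - 1))) (u h : HSob s) :
    Integrable fun x => f x (u x) * h x := by
  refine ⟨((hf.aemeasurable_comp u.measurable.aemeasurable).mul
    h.measurable.aemeasurable).aestronglyMeasurable, ?_⟩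
  refine lt_of_le_of_lt (lintegral_mono fun x => ?_) (lintegral_comp_mul_lt_top hC hp hC₁ u h)
  rw [enorm_mul, ← ofReal_norm (f x (u x)), Real.norm_eq_abs]
  gcongr
  exact hg x (u x)

theorem abs_primitive_le (hp : 2 ≤ p) (hC₁ : 0 < C₁)
    (hg : ∀ x u, |f x u| ≤ C₁ * (|u| + |u| ^ (p - 1))) (x : R3) (a : ℝ) :
    |primitive f x a| ≤ C₁ * (|a| + |a| ^ (p - 1)) * |a| := by
  have h := intervalIntegral.norm_integral_le_of_norm_le_const (a := 0) (b := a) (f := f x)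
    (C := C₁ * (|a| + |a| ^ (p - 1))) (fun τ hτ => by
      have h1 : |τ| ≤ |a| := by
        have := Set.abs_sub_left_of_mem_uIcc (Set.uIoc_subset_uIcc hτ)
        simpa using this
      refine (hg x τ).trans ?_
      have : |τ| ^ (p - 1) ≤ |a| ^ (p - 1) :=
        Real.rpow_le_rpow (abs_nonneg _) h1 (by linarith)
      gcongr)
  simpa [primitive] using h

theorem integrable_primitive (hC : IsEmbeddingConst s p C) (hf : IsCaratheodory f) (hp : 2 ≤ p)
    (hC₁ : 0 < C₁) (hg : ∀ x u, |f x u| ≤ C₁ * (|u| + |u| ^ (p - 1))) (u : HSob s) :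
    Integrable fun x => primitive f x (u x) := by
  refine ⟨(hf.aemeasurable_primitive u.measurable).aestronglyMeasurable, ?_⟩
  refine lt_of_le_of_lt (lintegral_mono fun x => ?_) (lintegral_comp_mul_lt_top hC hp hC₁ u u)
  rw [← ofReal_norm, ← ofReal_norm, Real.norm_eq_abs, Real.norm_eq_abs,
    ← ENNReal.ofReal_mul (by positivity)]
  exact ENNReal.ofReal_le_ofReal (abs_primitive_le hp hC₁ hg x _)

/-- The functional `h ↦ ∫ f(x, u) h dx` is continuous on `H^s`. -/
theorem exists_superposition (hC : IsEmbeddingConst s p C) (hf : IsCaratheodory f) (hp : 2 ≤ p)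
    (hC₁ : 0 < C₁) (hg : ∀ x u, |f x u| ≤ C₁ * (|u| + |u| ^ (p - 1))) (u : HSob s) :
    ∃ L : HSob s →L[ℝ] ℝ, ∀ h, L h = ∫ x, f x (u x) * h x := by
  have hC0 : 0 ≤ C := by linarith [hC.1]
  have hint := integrable_comp_mul hC hf hp hC₁ hg u
  set N := dualNorm p u (fun x => ENNReal.ofReal (C₁ * (|u x| + |u x| ^ (p - 1))))
  have hN : N ≠ ∞ := (dualNorm_growth_lt_top hC hp u hC₁.le).ne
  have hm : Measurable fun x => ENNReal.ofReal (C₁ * (|u x| + |u x| ^ (p - 1))) := by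
    have := u.measurable
    fun_prop
  let L₀ : HSob s →ₗ[ℝ] ℝ :=
    { toFun := fun h => ∫ x, f x (u x) * h x
      map_add' := fun h h' => by
        rw [← integral_add (hint h) (hint h')]
        refine integral_congr_ae ?_
        have e := Lp.coeFn_add (HSob.toL2 h) (HSob.toL2 h')
        rw [← map_add] at e
        filter_upwards [e] with x hx
        rw [hx, Pi.add_apply, mul_add]
      map_smul' := fun c h => by
        rw [RingHom.id_apply, smul_eq_mul, ← integral_const_mul]
        refine integral_congr_ae ?_
        have e := Lp.coeFn_smul c (HSob.toL2 h)
        rw [← map_smul] at e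
        filter_upwards [e] with x hx
        rw [hx, Pi.smul_apply, smul_eq_mul]
        ring }
  refine ⟨L₀.mkContinuous (N.toReal * C) fun h => ?_, fun h => rfl⟩
  refine (norm_integral_le_lintegral_norm _).trans ?_
  refine ENNReal.toReal_le_of_le_ofReal (by positivity) ?_
  calc ∫⁻ x, ENNReal.ofReal ‖f x (u x) * h x‖
      ≤ ∫⁻ x, ENNReal.ofReal (C₁ * (|u x| + |u x| ^ (p - 1))) * ‖h x‖ₑ := by
        refine lintegral_mono fun x => ?_
        rw [ofReal_norm, enorm_mul, ← ofReal_norm (f x (u x)), Real.norm_eq_abs]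
        gcongr
        exact hg x (u x)
    _ ≤ N * ENNReal.ofReal (C * ‖h‖) := lintegral_mul_enorm_le hC hp u h hm.aemeasurable
    _ = ENNReal.ofReal (N.toReal * C * ‖h‖) := by
        rw [mul_assoc, ENNReal.ofReal_mul ENNReal.toReal_nonneg, ENNReal.ofReal_toReal hN]

/-- Up to an error that is small in the dual norm, independently of `w`, the difference
`f(x, u + w) - f(x, u)` is of the order of `|w| + |w|^{p-1}`. This takes the place of the continuity
of the superposition operator `u ↦ f(x, u)`. -/
theorem exists_excess_small (hC : IsEmbeddingConst s p C) (hf : IsCaratheodory f) (hp : 2 ≤ p)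
    (hC₁ : 0 < C₁) (hg : ∀ x u, |f x u| ≤ C₁ * (|u| + |u| ^ (p - 1))) (u : HSob s)
    {ε : ℝ} (hε : 0 < ε) :
    ∃ K : ℝ, 0 ≤ K ∧ diffConst C₁ p ≤ K ∧
      dualNorm p u (fun x => excess f p K x (u x)) ≤ ENNReal.ofReal ε := by
  have hD : 0 < diffConst C₁ p := diffConst_pos hC₁
  have h := tendsto_dualNorm_zero hC hp u hD.le
    (G := fun (n : ℕ) x => excess f p (diffConst C₁ p + n) x (u x))
    (fun n => hf.aemeasurable_excess p _ u.measurable.aemeasurable)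
    (fun n x => excess_le hC₁ hp hg (le_add_of_nonneg_right (Nat.cast_nonneg n)) x (u x))
    (fun x => tendsto_excess hf hC₁ hp hg x (u x))
  obtain ⟨n, hn⟩ := (ENNReal.tendsto_nhds_zero.1 h (ENNReal.ofReal ε) (by simpa using hε)).exists
  exact ⟨diffConst C₁ p + n, by positivity, le_add_of_nonneg_right (Nat.cast_nonneg n), hn⟩

/-- `u ↦ ∫ F(x, u) dx` is Fréchet differentiable on `H^s`. -/
theorem hasFDerivAt_superposition (hC : IsEmbeddingConst s p C) (hf : IsCaratheodory f)
    (hp : 2 ≤ p) (hC₁ : 0 < C₁) (hg : ∀ x u, |f x u| ≤ C₁ * (|u| + |u| ^ (p - 1))) (u : HSob s)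
    {L : HSob s →L[ℝ] ℝ} (hL : ∀ h, L h = ∫ x, f x (u x) * h x) :
    HasFDerivAt (fun v : HSob s => ∫ x, primitive f x (v x)) L u := by
  have hC0 : 0 < C := by linarith [hC.1]
  have hp1 : 0 < p - 1 := by linarith
  rw [hasFDerivAt_iff_isLittleO_nhds_zero, Asymptotics.isLittleO_iff]
  intro c hc
  obtain ⟨K, hK0, hK, hdual⟩ := exists_excess_small hC hf hp hC₁ hg u
    (ε := c / (2 * C)) (by positivity)
  have hbound : ∀ h : HSob s,
      ‖(∫ x, primitive f x ((u + h : HSob s) x)) - (∫ x, primitive f x (u x)) - L h‖ ≤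
        c / 2 * ‖h‖ + K * (‖h‖ ^ 2 + (C * ‖h‖) ^ p) := by
    intro h
    have hadd := Lp.coeFn_add (HSob.toL2 u) (HSob.toL2 h)
    rw [← map_add] at hadd
    have i1 := integrable_primitive hC hf hp hC₁ hg (u + h)
    have i2 := integrable_primitive hC hf hp hC₁ hg u
    have i3 := integrable_comp_mul hC hf hp hC₁ hg u h
    have i4 : Integrable fun x => primitive f x ((u + h : HSob s) x) - primitive f x (u x) :=
      i1.sub i2
    rw [hL, ← integral_sub i1 i2, ← integral_sub i4 i3]
    refine (norm_integral_le_lintegral_norm _).trans ?_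
    refine ENNReal.toReal_le_of_le_ofReal (by positivity) ?_
    have hm : AEMeasurable fun x => excess f p K x (u x) :=
      hf.aemeasurable_excess p K u.measurable.aemeasurable
    calc _ ≤ ∫⁻ x, (excess f p K x (u x) * ‖h x‖ₑ +
          ENNReal.ofReal (K * (|h x| + |h x| ^ (p - 1))) * ‖h x‖ₑ) := by
          refine lintegral_mono_ae ?_
          filter_upwards [hadd] with x hx
          rw [hx, Pi.add_apply, Real.norm_eq_abs, ← add_mul, ← ofReal_norm (h x)]
          exact ofReal_abs_primitive_sub_le hf hC₁ hp hg hK x (u x) (h x)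
      _ = (∫⁻ x, excess f p K x (u x) * ‖h x‖ₑ) +
          ∫⁻ x, ENNReal.ofReal (K * (|h x| + |h x| ^ (p - 1))) * ‖h x‖ₑ :=
          lintegral_add_left' (hm.mul h.measurable.enorm.aemeasurable) _
      _ ≤ ENNReal.ofReal (c / (2 * C)) * ENNReal.ofReal (C * ‖h‖) +
          ENNReal.ofReal (K * (‖h‖ ^ 2 + (C * ‖h‖) ^ p)) := by
          refine add_le_add ?_ (lintegral_growth_mul_enorm_le hC hp h hK0)
          exact (lintegral_mul_enorm_le hC hp u h hm).trans (mul_le_mul_left hdual _)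
      _ = _ := by
          rw [← ENNReal.ofReal_mul (by positivity), ← ENNReal.ofReal_add (by positivity)
            (by positivity)]
          congr 2
          field_simp
  have hsmall : ∀ᶠ h : HSob s in 𝓝 0, K * (‖h‖ + C ^ p * ‖h‖ ^ (p - 1)) ≤ c / 2 := by
    have hcont : Continuous fun h : HSob s => K * (‖h‖ + C ^ p * ‖h‖ ^ (p - 1)) :=
      continuous_const.mul (continuous_norm.add (continuous_const.mul
        (continuous_norm.rpow_const fun _ => Or.inr hp1.le)))
    have h0 := hcont.tendsto 0
    simp only [norm_zero, Real.zero_rpow hp1.ne', mul_zero, add_zero] at h0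
    exact (h0.eventually_le_const (by positivity : 0 < c / 2))
  filter_upwards [hsmall] with h hh
  refine (hbound h).trans ?_
  have e : (C * ‖h‖) ^ p = C ^ p * ‖h‖ ^ (p - 1) * ‖h‖ := by
    rw [Real.mul_rpow hC0.le (norm_nonneg _), mul_assoc]
    conv_lhs => rw [← sub_add_cancel p 1, Real.rpow_add_one' (norm_nonneg _) (by linarith)]
    rw [sub_add_cancel]
  have e2 : K * (‖h‖ ^ 2 + (C * ‖h‖) ^ p) = K * (‖h‖ + C ^ p * ‖h‖ ^ (p - 1)) * ‖h‖ := by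
    rw [e]; ring
  rw [e2]
  nlinarith [norm_nonneg h, mul_le_mul_of_nonneg_right hh (norm_nonneg h)]

/-- A sequence bounded in `H^s` and tending to zero in `L²` of a ball tends to zero there in
`L^{p-1}` as well. -/
theorem tendsto_lintegral_ball_growth (hC : IsEmbeddingConst s p C) (hp : 2 ≤ p)
    {w : ℕ → HSob s} {B : ℝ} (hB : ∀ n, ‖w n‖ ≤ B) (T K : ℝ) (hK : 0 ≤ K)
    (hw : Tendsto (fun n => eLpNorm (w n) 2 (volume.restrict (Metric.ball 0 T))) atTop (𝓝 0)) :
    Tendsto (fun n => ∫⁻ x in Metric.ball 0 T,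
      ENNReal.ofReal (K * (|w n x| + |w n x| ^ (p - 1)))) atTop (𝓝 0) := by
  have hB0 : 0 ≤ B := (norm_nonneg _).trans (hB 0)
  have hC0 : 0 ≤ C := by linarith [hC.1]
  set μ := volume.restrict (Metric.ball (0 : R3) T) with hμ
  have hfin : IsFiniteMeasure μ :=
    ⟨by rw [Measure.restrict_apply_univ]; exact measure_ball_lt_top⟩
  have hL1 : Tendsto (fun n => ∫⁻ x, ‖w n x‖ₑ ∂μ) atTop (𝓝 0) := by
    have h1 : ∀ n, ∫⁻ x, ‖w n x‖ₑ ∂μ ≤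
        eLpNorm (w n) 2 μ * μ Set.univ ^ (1 / (1 : ℝ≥0∞).toReal - 1 / (2 : ℝ≥0∞).toReal) := by
      intro n
      rw [← eLpNorm_one_eq_lintegral_enorm]
      exact eLpNorm_le_eLpNorm_mul_rpow_measure_univ (by norm_num)
        (w n).measurable.aestronglyMeasurable
    have h2 := ENNReal.Tendsto.mul_const (b := μ Set.univ ^
      (1 / (1 : ℝ≥0∞).toReal - 1 / (2 : ℝ≥0∞).toReal)) hw
      (Or.inr (ENNReal.rpow_ne_top_of_nonneg (by norm_num) (measure_ne_top _ _)))
    rw [zero_mul] at h2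
    exact tendsto_of_tendsto_of_tendsto_of_le_of_le tendsto_const_nhds h2
      (fun _ => zero_le) h1
  -- `|w| + |w|^{p-1} ≤ (1 + R^{p-2}) |w| + |w|^p / R` for every `R > 0`
  have hpt : ∀ (R : ℝ), 0 < R → ∀ a : ℝ,
      ENNReal.ofReal (K * (|a| + |a| ^ (p - 1))) ≤
        ENNReal.ofReal (K * (1 + R ^ (p - 2))) * ‖a‖ₑ + ENNReal.ofReal (K / R) * ‖a‖ₑ ^ p := by
    intro R hR a
    rw [← ofReal_norm, Real.norm_eq_abs, ENNReal.ofReal_rpow_of_nonneg (abs_nonneg _)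
      (by linarith), ← ENNReal.ofReal_mul (by positivity), ← ENNReal.ofReal_mul (by positivity),
      ← ENNReal.ofReal_add (by positivity) (by positivity)]
    refine ENNReal.ofReal_le_ofReal ?_
    have key : |a| ^ (p - 1) ≤ R ^ (p - 2) * |a| + |a| ^ p / R := by
      have e1 : |a| ^ (p - 1) = |a| ^ (p - 2) * |a| := by
        rw [← Real.rpow_add_one' (abs_nonneg _) (by linarith)]
        congr 1
        ring
      have e2 : |a| ^ p = |a| ^ (p - 1) * |a| := by
        rw [← Real.rpow_add_one' (abs_nonneg _) (by linarith), sub_add_cancel]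
      by_cases ha : |a| ≤ R
      · have h1 : |a| ^ (p - 2) ≤ R ^ (p - 2) :=
          Real.rpow_le_rpow (abs_nonneg _) ha (by linarith)
        have h2 : 0 ≤ |a| ^ p / R := by positivity
        rw [e1]
        nlinarith [abs_nonneg a, mul_le_mul_of_nonneg_right h1 (abs_nonneg a)]
      · have h2 : |a| ^ (p - 1) ≤ |a| ^ p / R := by
          rw [le_div_iff₀ hR, e2]
          gcongr
          exact (not_le.1 ha).le
        have h3 : 0 ≤ R ^ (p - 2) * |a| := by positivity
        linarith
    calc K * (|a| + |a| ^ (p - 1)) ≤ K * (|a| + (R ^ (p - 2) * |a| + |a| ^ p / R)) := by gcongr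
      _ = _ := by ring
  rw [ENNReal.tendsto_nhds_zero]
  intro ε hε
  have hR : ∃ R : ℝ, 0 < R ∧
      ENNReal.ofReal (K / R) * ENNReal.ofReal ((C * B) ^ p) ≤ ε / 2 := by
    have h1 : Tendsto (fun R : ℝ => ENNReal.ofReal (K / R)) atTop (𝓝 0) := by
      rw [← ENNReal.ofReal_zero]
      exact ENNReal.tendsto_ofReal (tendsto_const_nhds.div_atTop tendsto_id)
    have h2 := ENNReal.Tendsto.mul_const (b := ENNReal.ofReal ((C * B) ^ p)) h1
      (Or.inr ENNReal.ofReal_ne_top)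
    rw [zero_mul, ENNReal.tendsto_nhds_zero] at h2
    obtain ⟨R, h3, h4⟩ := ((h2 (ε / 2) (ENNReal.half_pos hε.ne')).and
      (eventually_gt_atTop 0)).exists
    exact ⟨R, h4, h3⟩
  obtain ⟨R, hR0, hR⟩ := hR
  have h3 := ENNReal.Tendsto.const_mul (a := ENNReal.ofReal (K * (1 + R ^ (p - 2)))) hL1
    (Or.inr ENNReal.ofReal_ne_top)
  rw [mul_zero] at h3
  filter_upwards [ENNReal.tendsto_nhds_zero.1 h3 (ε / 2) (ENNReal.half_pos hε.ne')] with n hn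
  calc ∫⁻ x, ENNReal.ofReal (K * (|w n x| + |w n x| ^ (p - 1))) ∂μ
      ≤ ∫⁻ x, (ENNReal.ofReal (K * (1 + R ^ (p - 2))) * ‖w n x‖ₑ +
          ENNReal.ofReal (K / R) * ‖w n x‖ₑ ^ p) ∂μ := lintegral_mono fun x => hpt R hR0 _
    _ = ENNReal.ofReal (K * (1 + R ^ (p - 2))) * ∫⁻ x, ‖w n x‖ₑ ∂μ +
          ENNReal.ofReal (K / R) * ∫⁻ x, ‖w n x‖ₑ ^ p ∂μ := by
        rw [lintegral_add_left ((w n).measurable.enorm.const_mul _),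
          lintegral_const_mul _ (w n).measurable.enorm,
          lintegral_const_mul _ ((w n).measurable.enorm.pow_const p)]
    _ ≤ ε / 2 + ε / 2 := by
        refine add_le_add hn (le_trans ?_ hR)
        gcongr
        calc ∫⁻ x, ‖w n x‖ₑ ^ p ∂μ ≤ ∫⁻ x, ‖w n x‖ₑ ^ p :=
              lintegral_mono' Measure.restrict_le_self le_rfl
          _ ≤ ENNReal.ofReal ((C * ‖w n‖) ^ p) := hC.lintegral_rpow_le hp _
          _ ≤ _ := by
              gcongr
              exact hB n
    _ = ε := ENNReal.add_halves ε

/-- Passage to the limit in `∫ f(x, uₙ) h dx` for bounded `h` with bounded support. -/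
theorem tendsto_integral_comp_mul (hC : IsEmbeddingConst s p C) (hf : IsCaratheodory f)
    (hp : 2 ≤ p) (hC₁ : 0 < C₁) (hg : ∀ x u, |f x u| ≤ C₁ * (|u| + |u| ^ (p - 1)))
    {u : ℕ → HSob s} {u₀ : HSob s} {B : ℝ} (hB : ∀ n, ‖u n - u₀‖ ≤ B)
    (hloc : ∀ T : ℝ, Tendsto
      (fun n => eLpNorm (u n - u₀ : HSob s) 2 (volume.restrict (Metric.ball 0 T))) atTop (𝓝 0))
    {h : HSob s} {M ρ : ℝ} (hM : ∀ᵐ x, |h x| ≤ M) (hρ : ∀ᵐ x, ρ ≤ ‖x‖ → h x = 0) :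
    Tendsto (fun n => ∫ x, f x (u n x) * h x) atTop (𝓝 (∫ x, f x (u₀ x) * h x)) := by
  have hC0 : 0 < C := by linarith [hC.1]
  have hint := fun v : HSob s => integrable_comp_mul hC hf hp hC₁ hg v h
  have hlim : Tendsto (fun n => ∫⁻ x, ‖f x (u n x) * h x - f x (u₀ x) * h x‖ₑ) atTop (𝓝 0) := by
    rw [ENNReal.tendsto_nhds_zero]
    intro ε hε
    obtain ⟨δ, hδ, hδε⟩ : ∃ δ : ℝ, 0 < δ ∧
        ENNReal.ofReal δ * ENNReal.ofReal (C * ‖h‖) ≤ ε / 2 := by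
      have h1 : Tendsto (fun δ : ℝ => ENNReal.ofReal δ * ENNReal.ofReal (C * ‖h‖)) (𝓝[>] 0)
          (𝓝 (ENNReal.ofReal 0 * ENNReal.ofReal (C * ‖h‖))) :=
        ENNReal.Tendsto.mul_const (ENNReal.tendsto_ofReal
          (tendsto_nhdsWithin_of_tendsto_nhds tendsto_id)) (Or.inr ENNReal.ofReal_ne_top)
      rw [ENNReal.ofReal_zero, zero_mul, ENNReal.tendsto_nhds_zero] at h1
      obtain ⟨δ, h3, h4⟩ := ((h1 (ε / 2) (ENNReal.half_pos hε.ne')).and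
        self_mem_nhdsWithin).exists
      exact ⟨δ, h4, h3⟩
    obtain ⟨K, hK0, -, hdual⟩ := exists_excess_small hC hf hp hC₁ hg u₀ hδ
    have h5 := ENNReal.Tendsto.const_mul (a := ENNReal.ofReal M)
      (tendsto_lintegral_ball_growth hC hp hB ρ K hK0 (hloc ρ)) (Or.inr ENNReal.ofReal_ne_top)
    rw [mul_zero] at h5
    filter_upwards [ENNReal.tendsto_nhds_zero.1 h5 (ε / 2) (ENNReal.half_pos hε.ne')] with n hn
    have hm : AEMeasurable fun x => excess f p K x (u₀ x) :=
      hf.aemeasurable_excess p K u₀.measurable.aemeasurable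
    set w := u n - u₀ with hw
    have hadd := Lp.coeFn_add (HSob.toL2 u₀) (HSob.toL2 w)
    rw [← map_add, hw, add_sub_cancel, ← hw] at hadd
    calc ∫⁻ x, ‖f x (u n x) * h x - f x (u₀ x) * h x‖ₑ
        ≤ ∫⁻ x, (excess f p K x (u₀ x) * ‖h x‖ₑ + ENNReal.ofReal M *
            (Metric.ball (0 : R3) ρ).indicator
              (fun x => ENNReal.ofReal (K * (|w x| + |w x| ^ (p - 1)))) x) := by
          refine lintegral_mono_ae ?_
          filter_upwards [hadd, hM, hρ] with x hx h1 h2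
          by_cases hxρ : x ∈ Metric.ball (0 : R3) ρ
          · rw [Set.indicator_of_mem hxρ, ← sub_mul, enorm_mul, hx, Pi.add_apply, ← ofReal_norm,
              Real.norm_eq_abs]
            refine (mul_le_mul_left (ofReal_abs_sub_le_excess hf hp x (u₀ x) (w x)
              (K := K)) _).trans ?_
            rw [add_mul, mul_comm (ENNReal.ofReal (K * _))]
            gcongr
            rw [← ofReal_norm]
            exact ENNReal.ofReal_le_ofReal h1
          · have h3 : h x = 0 := h2 (by simpa using hxρ)
            simp [h3]
      _ = (∫⁻ x, excess f p K x (u₀ x) * ‖h x‖ₑ) + ENNReal.ofReal M *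
            ∫⁻ x in Metric.ball (0 : R3) ρ,
              ENNReal.ofReal (K * (|w x| + |w x| ^ (p - 1))) := by
          have hwm : Measurable fun x => ENNReal.ofReal (K * (|w x| + |w x| ^ (p - 1))) := by
            have := w.measurable
            fun_prop
          have hm' : AEMeasurable fun x => excess f p K x (u₀ x) * ‖h x‖ₑ :=
            hm.mul h.measurable.enorm.aemeasurable
          rw [lintegral_add_left' hm',
            lintegral_const_mul _ (hwm.indicator measurableSet_ball),
            lintegral_indicator measurableSet_ball]
      _ ≤ ε / 2 + ε / 2 := by
          refine add_le_add ?_ hn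
          exact (lintegral_mul_enorm_le hC hp u₀ h hm).trans
            ((mul_le_mul_left hdual _).trans hδε)
      _ = ε := ENNReal.add_halves ε
  rw [tendsto_iff_norm_sub_tendsto_zero]
  have h6 := (ENNReal.tendsto_toReal ENNReal.zero_ne_top).comp hlim
  rw [ENNReal.toReal_zero] at h6
  refine squeeze_zero (fun n => norm_nonneg _) (fun n => ?_) h6
  rw [← integral_sub (hint _) (hint _)]
  refine (norm_integral_le_lintegral_norm _).trans (le_of_eq ?_)
  simp only [Function.comp_apply, ofReal_norm]

end

/-! ### Test functions are total in `H^s(ℝ³)` -/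

/-- The Fourier transform is injective on `L¹`. -/
theorem ae_eq_zero_of_fourier_eq_zero {G : R3 → ℂ} (hG : Integrable G)
    (h : ∀ a, 𝓕 G a = 0) : ∀ᵐ ξ, G ξ = 0 := by
  refine ae_eq_zero_of_integral_contDiff_smul_eq_zero hG.locallyIntegrable fun φ hφ hφc => ?_
  have h₁ : HasCompactSupport (Complex.ofRealCLM ∘ φ) := hφc.comp_left rfl
  have h₂ : ContDiff ℝ (⊤ : ℕ∞) (Complex.ofRealCLM ∘ φ) := by fun_prop
  set ψ := h₁.toSchwartzMap h₂
  have hψ : ∀ x, ψ x = (φ x : ℂ) := fun x => rfl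
  have key := VectorFourier.integral_fourierIntegral_smul_eq_flip (L := innerₗ R3)
    (f := ((𝓕⁻ ψ : SchwartzMap R3 ℂ) : R3 → ℂ)) (g := G) (μ := volume) (ν := volume)
    Real.continuous_fourierChar continuous_inner (𝓕⁻ ψ).integrable hG
  have hfl : (innerₗ R3).flip = innerₗ R3 := by
    ext x y
    simp
  rw [hfl] at key
  have e1 : ∀ ξ, VectorFourier.fourierIntegral Real.fourierChar volume (innerₗ R3)
      ((𝓕⁻ ψ : SchwartzMap R3 ℂ) : R3 → ℂ) ξ = ψ ξ := by
    intro ξ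
    have : 𝓕 (𝓕⁻ ψ) = ψ := FourierTransform.fourier_fourierInv_eq ψ
    conv_rhs => rw [← this, SchwartzMap.fourier_coe]
    rfl
  have e2 : ∀ ξ, VectorFourier.fourierIntegral Real.fourierChar volume (innerₗ R3) G ξ = 0 := h
  simp only [e1, e2, smul_zero, integral_zero, hψ] at key
  simpa using key

namespace HSob

variable {s : ℝ}

theorem memLp_symbol_smul_schwartz (hs : s ∈ Set.Icc (0 : ℝ) 1) (ψ : SchwartzMap R3 ℂ) :
    MemLp (fun ξ => ((2 * Real.pi * ‖ξ‖) ^ s : ℝ) • ψ ξ) 2 volume := by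
  have hg : (fun ξ : R3 => (2 + (2 * Real.pi) ^ 2 * ‖ξ‖ ^ 2 : ℝ)).HasTemperateGrowth := by
    fun_prop
  refine ((SchwartzMap.smulLeftCLM ℂ
    (fun ξ : R3 => (2 + (2 * Real.pi) ^ 2 * ‖ξ‖ ^ 2 : ℝ)) ψ).memLp 2 volume).mono ?_ ?_
  · have hm : Measurable fun ξ : R3 => (2 * Real.pi * ‖ξ‖) ^ s := by fun_prop
    exact hm.aestronglyMeasurable.smul ψ.continuous.aestronglyMeasurable
  · refine Eventually.of_forall fun ξ => ?_
    rw [SchwartzMap.smulLeftCLM_apply_apply hg, norm_smul, norm_smul]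
    gcongr
    have hr : 0 ≤ 2 * Real.pi * ‖ξ‖ := by positivity
    rw [Real.norm_of_nonneg (by positivity), Real.norm_of_nonneg (by positivity), ← mul_pow]
    rcases le_total (2 * Real.pi * ‖ξ‖) 1 with h | h
    · have := Real.rpow_le_one hr h hs.1
      nlinarith [sq_nonneg (2 * Real.pi * ‖ξ‖)]
    · have := Real.rpow_le_rpow_of_exponent_le h hs.2
      rw [Real.rpow_one] at this
      nlinarith

/-- Smooth compactly supported functions belong to `H^s`, and their `L²` Fourier transform is the
Fourier integral. -/
theorem exists_of_contDiff (hs : s ∈ Set.Icc (0 : ℝ) 1) {φ : R3 → ℝ}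
    (hφ : ContDiff ℝ (⊤ : ℕ∞) φ) (hφc : HasCompactSupport φ) :
    ∃ h : HSob s, (h : R3 → ℝ) =ᵐ[volume] φ ∧
      fourierL2 (toL2 h) =ᵐ[volume] 𝓕 fun x => (φ x : ℂ) := by
  have h₁ : HasCompactSupport (Complex.ofRealCLM ∘ φ) := hφc.comp_left rfl
  have h₂ : ContDiff ℝ (⊤ : ℕ∞) (Complex.ofRealCLM ∘ φ) := by fun_prop
  set ψ := h₁.toSchwartzMap h₂
  have hψ : (ψ : R3 → ℂ) = fun x => (φ x : ℂ) := rfl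
  have hmem : MemLp φ 2 volume := hφ.continuous.memLp_of_hasCompactSupport hφc
  have hae := hmem.coeFn_toLp
  have hF : fourierL2 (hmem.toLp φ) =ᵐ[volume] 𝓕 fun x => (φ x : ℂ) := by
    have : toComplex (hmem.toLp φ) = ψ.toLp 2 := by
      refine Lp.ext ?_
      filter_upwards [coeFn_toComplex (hmem.toLp φ), hae, ψ.coeFn_toLp 2 volume] with x a b c
      rw [a, b, c, hψ]
    rw [fourierL2, this, SchwartzMap.toLp_fourier_eq, ← hψ, ← SchwartzMap.fourier_coe]
    exact SchwartzMap.coeFn_toLp _ _ _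
  have hsym : MemLp (symbolMul s (hmem.toLp φ)) 2 volume := by
    refine (memLp_congr_ae ?_).2 (memLp_symbol_smul_schwartz hs (𝓕 ψ))
    filter_upwards [hF] with ξ hξ
    rw [symbolMul, hξ, SchwartzMap.fourier_coe]
    rfl
  exact ⟨⟨hmem.toLp φ, hsym⟩, hae, hF⟩

/-- The integrand of `⟨u, v⟩` on the Fourier side, `(1 + |2πξ|^{2s}) conj(𝓕u) 𝓕v`. -/
def fourierInner (u v : HSob s) (ξ : R3) : ℂ :=
  ((1 + ((2 * Real.pi * ‖ξ‖) ^ s) ^ 2 : ℝ) : ℂ) *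
    ((starRingEnd ℂ) (fourierL2 (toL2 u) ξ) * fourierL2 (toL2 v) ξ)

theorem fourierInner_ae_eq (u v : HSob s) :
    fourierInner u v =ᵐ[volume] fun ξ =>
      inner ℂ ((𝓕 (halfLap u) : Lp ℂ 2 (volume : Measure R3)) ξ)
        ((𝓕 (halfLap v) : Lp ℂ 2 (volume : Measure R3)) ξ) +
      inner ℂ (fourierL2 (toL2 u) ξ) (fourierL2 (toL2 v) ξ) := by
  filter_upwards [coeFn_fourier_halfLap u, coeFn_fourier_halfLap v] with ξ h1 h2
  rw [h1, h2, fourierInner, symbolMul, symbolMul, RCLike.inner_apply, RCLike.inner_apply]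
  simp only [Complex.real_smul, map_mul, Complex.conj_ofReal]
  push_cast
  ring

theorem integrable_fourierInner (u v : HSob s) : Integrable (fourierInner u v) :=
  ((L2.integrable_inner _ _).add (L2.integrable_inner _ _)).congr (fourierInner_ae_eq u v).symm

/-- Plancherel's identity for the inner product of `H^s`. -/
theorem ofReal_inner_eq (u v : HSob s) :
    ((inner ℝ u v : ℝ) : ℂ) = ∫ ξ, fourierInner u v ξ := by
  have hre : ∀ a b : Lp ℂ 2 (volume : Measure R3), inner ℝ a b = (inner ℂ a b).re := by
    intro a b
    rw [L2.inner_def, L2.inner_def]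
    have := integral_re (L2.integrable_inner (𝕜 := ℂ) a b)
    simp only [RCLike.re_to_complex] at this
    rw [← this]
    rfl
  have hto : inner ℝ (toL2 u) (toL2 v) = inner ℝ (toComplex (toL2 u)) (toComplex (toL2 v)) := by
    rw [L2.inner_def, L2.inner_def]
    refine integral_congr_ae ?_
    filter_upwards [coeFn_toComplex (toL2 u), coeFn_toComplex (toL2 v)] with x h1 h2
    rw [h1, h2]
    simp [Complex.inner]
  have h1 : inner ℝ u v = (∫ ξ, fourierInner u v ξ).re := by
    rw [inner_def, hto, hre, hre, ← Lp.inner_fourier_eq, ← Lp.inner_fourier_eq (toComplex _),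
      ← Complex.add_re, L2.inner_def, L2.inner_def,
      ← integral_add (L2.integrable_inner _ _) (L2.integrable_inner _ _)]
    congr 1
    exact (integral_congr_ae (fourierInner_ae_eq u v)).symm
  -- the integrand is Hermitian, so that its integral is real
  have h2 : (starRingEnd ℂ) (∫ ξ, fourierInner u v ξ) = ∫ ξ, fourierInner u v ξ := by
    rw [← integral_conj, ← integral_neg_eq_self (fourierInner u v)]
    refine integral_congr_ae ?_
    filter_upwards [fourierL2_neg (toL2 u), fourierL2_neg (toL2 v)] with ξ e1 e2
    rw [fourierInner, fourierInner, e1, e2, norm_neg]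
    simp only [map_mul, Complex.conj_ofReal]
  rw [h1]
  exact Complex.conj_eq_iff_re.1 h2

theorem fourier_translate (φ : R3 → ℂ) (a ξ : R3) :
    𝓕 (fun x => φ (x - a)) ξ = Real.fourierChar (-inner ℝ ξ a) • 𝓕 φ ξ := by
  have := congrFun (VectorFourier.fourierIntegral_comp_add_right Real.fourierChar
    (volume : Measure R3) (innerₗ R3) φ (-a)) ξ
  have e : Real.fourierChar (-inner ℝ ξ a) = Real.fourierChar ((innerₗ R3) (-a) ξ) := by
    simp [real_inner_comm]
  rw [e]
  refine Eq.trans ?_ this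
  simp only [sub_eq_add_neg]
  rfl

/-- The Fourier transform of a bump function does not vanish at low frequencies. -/
theorem fourier_bump_ne_zero (φ : ContDiffBump (0 : R3)) {ξ : R3}
    (hξ : 2 * Real.pi * ‖ξ‖ * φ.rOut ≤ 1) : 𝓕 (fun x => (φ x : ℂ)) ξ ≠ 0 := by
  have hint : Integrable fun x =>
      Complex.exp (↑(-2 * Real.pi * inner ℝ x ξ) * Complex.I) • (φ x : ℂ) := by
    refine Continuous.integrable_of_hasCompactSupport ?_ ?_
    · have := φ.continuous
      fun_prop
    · refine φ.hasCompactSupport.mono fun x hx => ?_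
      contrapose! hx
      simp only [Function.mem_support, ne_eq, not_not] at hx
      simp [hx]
  intro h0
  rw [Real.fourier_eq'] at h0
  have h1 := congrArg Complex.re h0
  rw [← RCLike.re_to_complex, ← integral_re hint, Complex.zero_re] at h1
  have h2 : ∀ x, RCLike.re (Complex.exp (↑(-2 * Real.pi * inner ℝ x ξ) * Complex.I) • (φ x : ℂ))
      = Real.cos (2 * Real.pi * inner ℝ x ξ) * φ x := by
    intro x
    rw [Complex.exp_ofReal_mul_I, smul_eq_mul, RCLike.re_to_complex, Complex.re_mul_ofReal]
    congr 1
    rw [Complex.add_re, Complex.mul_I_re, Complex.ofReal_re, Complex.ofReal_im, neg_zero,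
      add_zero, ← Real.cos_neg]
    congr 1
    ring
  simp only [h2] at h1
  have h3 : 0 < ∫ x, Real.cos (2 * Real.pi * inner ℝ x ξ) * φ x := by
    refine Continuous.integral_pos_of_hasCompactSupport_nonneg_nonzero (x := 0) ?_ ?_ ?_ ?_
    · have := φ.continuous
      fun_prop
    · exact φ.hasCompactSupport.mul_left
    · intro x
      by_cases hx : x ∈ Metric.ball (0 : R3) φ.rOut
      · refine mul_nonneg (Real.cos_nonneg_of_mem_Icc ?_) φ.nonneg
        have hb : |2 * Real.pi * inner ℝ x ξ| ≤ 1 := by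
          rw [abs_mul, abs_of_pos (by positivity)]
          refine le_trans ?_ hξ
          have := abs_real_inner_le_norm x ξ
          have hx' : ‖x‖ ≤ φ.rOut := (mem_ball_zero_iff.1 hx).le
          calc 2 * Real.pi * |inner ℝ x ξ| ≤ 2 * Real.pi * (‖x‖ * ‖ξ‖) := by gcongr
            _ ≤ 2 * Real.pi * (φ.rOut * ‖ξ‖) := by gcongr
            _ = _ := by ring
        have hpi := Real.pi_gt_three
        rw [abs_le] at hb
        constructor <;> linarith [hb.1, hb.2]
      · simp [φ.zero_of_le_dist (x := x) (by simpa using hx)]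
    · rw [inner_zero_left, mul_zero, Real.cos_zero, one_mul]
      exact (φ.pos_of_mem_ball (Metric.mem_ball_self φ.rOut_pos)).ne'
  exact h3.ne' h1

/-- Test functions are total in `H^s`: the translates of one bump function `φ` already detect
every frequency `ξ` with `𝓕φ(ξ) ≠ 0`. -/
theorem eq_zero_of_inner_contDiff (hs : s ∈ Set.Icc (0 : ℝ) 1) (w : HSob s)
    (hw : ∀ (h : HSob s) (φ : R3 → ℝ), Continuous φ → HasCompactSupport φ →
      (h : R3 → ℝ) =ᵐ[volume] φ → inner ℝ w h = 0) : w = 0 := by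
  have main : ∀ φ : ContDiffBump (0 : R3), ∀ᵐ ξ, 2 * Real.pi * ‖ξ‖ * φ.rOut ≤ 1 →
      fourierL2 (toL2 w) ξ = 0 := by
    intro φ
    obtain ⟨h, hh, hF⟩ := exists_of_contDiff hs φ.contDiff φ.hasCompactSupport
    have hG : ∀ᵐ ξ, fourierInner w h ξ = 0 := by
      refine ae_eq_zero_of_fourier_eq_zero (integrable_fourierInner w h) fun a => ?_
      have hca : HasCompactSupport fun x => φ (x - a) :=
        φ.hasCompactSupport.comp_homeomorph (Homeomorph.subRight a)
      have hda : ContDiff ℝ (⊤ : ℕ∞) fun x => φ (x - a) :=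
        φ.contDiff.comp (contDiff_id.sub contDiff_const)
      obtain ⟨k, hk, hkF⟩ := exists_of_contDiff hs hda hca
      have e := ofReal_inner_eq w k
      rw [hw k _ hda.continuous hca hk, Complex.ofReal_zero] at e
      rw [Real.fourier_eq, e]
      refine integral_congr_ae ?_
      filter_upwards [hF, hkF] with ξ h1 h2
      rw [fourierInner, fourierInner, h1, h2, fourier_translate (fun x => (φ x : ℂ)) a ξ,
        Circle.smul_def, Circle.smul_def, smul_eq_mul, smul_eq_mul]
      ring
    filter_upwards [hG, hF] with ξ h1 h2 h3
    rw [fourierInner, h2] at h1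
    have hpos : (0 : ℝ) < 1 + ((2 * Real.pi * ‖ξ‖) ^ s) ^ 2 := by positivity
    simpa [hpos.ne', fourier_bump_ne_zero φ h3, -Complex.ofReal_add, -Complex.ofReal_pow] using h1
  have hn : ∀ n : ℕ, 0 < (1 : ℝ) / (n + 1) := fun n => by positivity
  have hall := ae_all_iff.2 fun n : ℕ => main
    ⟨1 / (n + 1) / 2, 1 / (n + 1), half_pos (hn n), half_lt_self (hn n)⟩
  have hz : fourierL2 (toL2 w) = 0 := by
    rw [Lp.eq_zero_iff_ae_eq_zero]
    filter_upwards [hall] with ξ hξ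
    obtain ⟨n, hn⟩ := exists_nat_ge (2 * Real.pi * ‖ξ‖)
    refine hξ n ?_
    rw [mul_one_div, div_le_one (by positivity)]
    linarith
  apply toL2_injective
  rw [map_zero, ← norm_eq_zero, ← norm_fourierL2, hz, norm_zero]

end HSob

/-! ### The derivative of the energy -/

theorem rieszConst_nonneg {t : ℝ} (ht : t ∈ Set.Ioc (0 : ℝ) 1) : 0 ≤ rieszConst t := by
  have h1 : 0 < (3 - 2 * t) / 2 := by linarith [ht.2]
  have h2 := Real.Gamma_pos_of_pos h1
  have h3 := Real.Gamma_pos_of_pos ht.1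
  rw [rieszConst]
  positivity

section

variable {s t : ℝ} {f : R3 → ℝ → ℝ} {P : HSob s →L[ℝ] HSob s →L[ℝ] Lp ℝ 2 (rieszMeasure t)}

theorem HSob.integral_sq_add_sq (u : HSob s) :
    ∫ x, (‖HSob.halfLap u x‖ ^ 2 + u x ^ 2) = ‖u‖ ^ 2 := by
  have h1 := (memLp_two_iff_integrable_sq_norm (Lp.aestronglyMeasurable _)).1
    (Lp.memLp (HSob.halfLap u))
  have h2 := (memLp_two_iff_integrable_sq (Lp.aestronglyMeasurable _)).1
    (Lp.memLp (HSob.toL2 u))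
  rw [integral_add h1 h2, HSob.norm_sq, Lp_two_norm_sq, Lp_two_norm_sq]
  simp only [Real.norm_eq_abs, sq_abs]

theorem functional_eq (hP : ∀ u v, P u v =ᵐ[rieszMeasure t] fun z => u z.1 * v z.2)
    (u : HSob s) :
    functional s t f u =
      1 / 2 * ‖u‖ ^ 2 + rieszConst t / 4 * ‖P u u‖ ^ 2 - ∫ x, primitive f x (u x) := by
  rw [functional, HSob.integral_sq_add_sq, integral_phi_mul_sq hP]
  ring

/-- The derivative of the energy at `u`, with `L` the contribution `h ↦ ∫ f(x, u) h dx` of the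
nonlinearity. -/
def energyDeriv (P : HSob s →L[ℝ] HSob s →L[ℝ] Lp ℝ 2 (rieszMeasure t)) (u : HSob s)
    (L : HSob s →L[ℝ] ℝ) : HSob s →L[ℝ] ℝ :=
  innerSL ℝ u + rieszConst t • (innerSL ℝ (P u u)).comp (P u) - L

theorem energyDeriv_apply (u h : HSob s) (L : HSob s →L[ℝ] ℝ) :
    energyDeriv P u L h = inner ℝ u h + rieszConst t * inner ℝ (P u u) (P u h) - L h := rfl

theorem hasFDerivAt_functional (hP : ∀ u v, P u v =ᵐ[rieszMeasure t] fun z => u z.1 * v z.2)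
    {u : HSob s} {L : HSob s →L[ℝ] ℝ}
    (hL : HasFDerivAt (fun v : HSob s => ∫ x, primitive f x (v x)) L u) :
    HasFDerivAt (functional s t f) (energyDeriv P u L) u := by
  have h1 : HasFDerivAt (fun v : HSob s => ‖v‖ ^ 2) _ u := (hasFDerivAt_id u).norm_sq
  have h2 := ((h1.const_mul (1 / 2)).add
    ((hasFDerivAt_tensor_sq hP u).const_mul (rieszConst t / 4))).sub hL
  have h3 : functional s t f = fun v => 1 / 2 * ‖v‖ ^ 2 + rieszConst t / 4 * ‖P v v‖ ^ 2 -
      ∫ x, primitive f x (v x) := funext fun v => functional_eq hP v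
  rw [h3]
  refine h2.congr_fderiv ?_
  ext h
  rw [energyDeriv_apply]
  show 1 / 2 * ((2 : ℕ) • inner ℝ u h) + rieszConst t / 4 * (4 * inner ℝ (P u u) (P u h)) - L h = _
  rw [nsmul_eq_mul]
  push_cast
  ring

/-- The Euler-Lagrange equation of the perturbed functional. It is tested along lines only, so
that the norm of `E` plays no role. -/
theorem energyDeriv_add_eq_zero {V : Potential} {lam : ℝ} {u : ESpace s V}
    (hcrit : IsCriticalPoint (perturbedFunctional s t f V lam) u)
    {D : HSob s →L[ℝ] ℝ} (hD : HasFDerivAt (functional s t f) D u.toHSob) (h : ESpace s V) :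
    D h.toHSob + lam * ∫ x, V x * (u.toHSob x * h.toHSob x) = 0 := by
  have h1 := hcrit.hasLineDerivAt h
  have h2 := hD.hasLineDerivAt h.toHSob
  rw [HasLineDerivAt] at h1 h2
  set a := ∫ x, V x * u.toHSob x ^ 2
  set b := ∫ x, V x * (u.toHSob x * h.toHSob x) with hb
  set c := ∫ x, V x * h.toHSob x ^ 2
  have hV : ∀ τ : ℝ, ∫ x, V x * (u + τ • h).toHSob x ^ 2 = a + τ * (2 * b) + τ ^ 2 * c := by
    intro τ
    have e : ∫ x, V x * (u + τ • h).toHSob x ^ 2 = ∫ x, (V x * u.toHSob x ^ 2 +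
        τ * (2 * (V x * (u.toHSob x * h.toHSob x))) + τ ^ 2 * (V x * h.toHSob x ^ 2)) := by
      have e1 := Lp.coeFn_add (HSob.toL2 u.toHSob) (τ • HSob.toL2 h.toHSob)
      have e2 := Lp.coeFn_smul τ (HSob.toL2 h.toHSob)
      rw [← map_smul, ← map_smul, ← map_add, ← map_add] at e1
      rw [← map_smul, ← map_smul] at e2
      refine integral_congr_ae ?_
      filter_upwards [e1, e2] with x h3 h4
      rw [h3, Pi.add_apply, h4, Pi.smul_apply, smul_eq_mul]
      ring
    have i1 := ((u.integrable_mul h).const_mul 2).const_mul τ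
    rw [e, integral_add (f := fun x => V x * u.toHSob x ^ 2 +
        τ * (2 * (V x * (u.toHSob x * h.toHSob x)))) (u.integrable_sq.add i1)
      (h.integrable_sq.const_mul _), integral_add u.integrable_sq i1, integral_const_mul,
      integral_const_mul, integral_const_mul]
  have h3 : HasDerivAt (fun τ : ℝ => lam / 2 * (a + τ * (2 * b) + τ ^ 2 * c)) (lam * b) 0 := by
    have h4 := ((((hasDerivAt_id (0 : ℝ)).mul_const (2 * b)).const_add a).add
      (((hasDerivAt_id (0 : ℝ)).pow 2).mul_const c)).const_mul (lam / 2)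
    refine h4.congr_deriv ?_
    simp
    ring
  have h5 := h2.add h3
  refine (h5.congr_of_eventuallyEq (Eventually.of_forall fun τ => ?_)).unique h1
  rw [perturbedFunctional, hV, map_add, map_smul, Pi.add_apply]

/-- Critical points of the perturbed functional with bounded energy are bounded, because `μ > 4`
makes all coefficients of `μ I_λ(u) - I_λ'(u) u` at the quadratic and the quartic terms positive. -/
theorem norm_sq_add_le (ht : t ∈ Set.Ioc (0 : ℝ) 1)
    (hP : ∀ u v, P u v =ᵐ[rieszMeasure t] fun z => u z.1 * v z.2)
    {μ : ℝ} (hμ : 4 < μ)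
    (hA3 : ∀ x u, u ≠ 0 → 0 < μ * primitive f x u ∧ μ * primitive f x u ≤ u * f x u)
    {V : Potential} {lam K : ℝ} (hlam : 0 ≤ lam) {u : ESpace s V} {L : HSob s →L[ℝ] ℝ}
    (hFint : Integrable fun x => primitive f x (u.toHSob x))
    (hfint : Integrable fun x => f x (u.toHSob x) * u.toHSob x)
    (hL : L u.toHSob = ∫ x, f x (u.toHSob x) * u.toHSob x)
    (heq : energyDeriv P u.toHSob L u.toHSob +
      lam * ∫ x, V x * (u.toHSob x * u.toHSob x) = 0)
    (hK : perturbedFunctional s t f V lam u ≤ K) :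
    ‖u.toHSob‖ ^ 2 + lam * ∫ x, V x * u.toHSob x ^ 2 ≤ μ * K := by
  have hF : μ * ∫ x, primitive f x (u.toHSob x) ≤ L u.toHSob := by
    rw [hL, ← integral_const_mul]
    refine integral_mono (hFint.const_mul μ) hfint fun x => ?_
    by_cases hx : u.toHSob x = 0
    -- the superquadraticity condition excludes the value zero, where both sides vanish
    · simp [hx, primitive]
    · simpa only [mul_comm (f x _)] using (hA3 x _ hx).2
  have hV0 : 0 ≤ lam * ∫ x, V x * u.toHSob x ^ 2 :=
    mul_nonneg hlam (integral_nonneg fun x => mul_nonneg (V.pos x).le (sq_nonneg _))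
  rw [energyDeriv_apply, real_inner_self_eq_norm_sq, real_inner_self_eq_norm_sq] at heq
  rw [perturbedFunctional, functional_eq hP] at hK
  simp only [← sq] at heq
  have hR : 0 ≤ rieszConst t * ‖P u.toHSob u.toHSob‖ ^ 2 :=
    mul_nonneg (rieszConst_nonneg ht) (sq_nonneg _)
  set a := ‖u.toHSob‖ ^ 2
  have ha : 0 ≤ a := sq_nonneg _
  set b := lam * ∫ x, V x * u.toHSob x ^ 2 with hb
  set r := rieszConst t * ‖P u.toHSob u.toHSob‖ ^ 2 with hr
  have hK' : 1 / 2 * a + r / 4 - (∫ x, primitive f x (u.toHSob x)) + b / 2 ≤ K := by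
    rw [hr, hb]
    linarith
  have h1 : μ * (1 / 2 * a + r / 4 - (∫ x, primitive f x (u.toHSob x)) + b / 2) ≤ μ * K :=
    mul_le_mul_of_nonneg_left hK' (by linarith)
  nlinarith [mul_nonneg (by linarith : (0 : ℝ) ≤ μ - 4) ha,
    mul_nonneg (by linarith : (0 : ℝ) ≤ μ - 4) hV0, mul_nonneg (by linarith : (0 : ℝ) ≤ μ - 4) hR]

/-- The cross term of the perturbation is of order `√λ`: with `r = √λ`, it follows from
`r² |u h| ≤ r (r² u² + h²)`. -/
theorem abs_mul_integral_le {V : Potential} {lam B : ℝ} (hlam : 0 ≤ lam) (u h : ESpace s V)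
    (hB : lam * ∫ x, V x * u.toHSob x ^ 2 ≤ B) :
    |lam * ∫ x, V x * (u.toHSob x * h.toHSob x)| ≤
      √lam * (B + ∫ x, V x * h.toHSob x ^ 2) := by
  have hsq := Real.sq_sqrt hlam
  set r := √lam
  have hr : 0 ≤ r := Real.sqrt_nonneg _
  rw [← integral_const_mul]
  refine (abs_integral_le_integral_abs).trans ?_
  have hi := ((u.integrable_sq).const_mul lam).add h.integrable_sq
  calc ∫ x, |lam * (V x * (u.toHSob x * h.toHSob x))|
      ≤ ∫ x, r * (lam * (V x * u.toHSob x ^ 2) + V x * h.toHSob x ^ 2) := by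
        refine integral_mono ((u.integrable_mul h).const_mul lam).abs (hi.const_mul r) fun x => ?_
        have hV := V.pos x
        simp only
        rw [abs_mul, abs_mul, abs_of_nonneg hlam, abs_of_pos hV, abs_mul, ← hsq,
          ← sq_abs (u.toHSob x), ← sq_abs (h.toHSob x)]
        have key : r * (|u.toHSob x| * |h.toHSob x|) ≤
            r ^ 2 * |u.toHSob x| ^ 2 + |h.toHSob x| ^ 2 := by
          nlinarith [sq_nonneg (r * |u.toHSob x| - |h.toHSob x|),
            mul_nonneg hr (mul_nonneg (abs_nonneg (u.toHSob x)) (abs_nonneg (h.toHSob x)))]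
        calc r ^ 2 * (V x * (|u.toHSob x| * |h.toHSob x|))
            = r * V x * (r * (|u.toHSob x| * |h.toHSob x|)) := by ring
          _ ≤ r * V x * (r ^ 2 * |u.toHSob x| ^ 2 + |h.toHSob x| ^ 2) := by gcongr
          _ = _ := by ring
    _ = r * (lam * (∫ x, V x * u.toHSob x ^ 2) + ∫ x, V x * h.toHSob x ^ 2) := by
        rw [integral_const_mul, integral_add (u.integrable_sq.const_mul lam) h.integrable_sq,
          integral_const_mul]
    _ ≤ _ := by gcongr

/-- Compactly supported functions of `H^s` belong to `E`. -/
theorem ESpace.exists_toHSob_eq (V : Potential) {h : HSob s} {φ : R3 → ℝ} (hφ : Continuous φ)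
    (hφc : HasCompactSupport φ) (hh : (h : R3 → ℝ) =ᵐ[volume] φ) :
    ∃ g : ESpace s V, g.toHSob = h := by
  have hc : HasCompactSupport fun x => V x * φ x ^ 2 := by
    refine hφc.mono fun x hx => ?_
    contrapose! hx
    simp only [Function.mem_support, ne_eq, not_not] at hx
    simp [hx]
  have hE : Integrable fun x => V x * h x ^ 2 := by
    refine ((V.continuous'.mul (hφ.pow 2)).integrable_of_hasCompactSupport hc).congr ?_
    filter_upwards [hh] with x hx
    rw [hx]
    rfl
  exact ⟨⟨h, hE⟩, rfl⟩

/-- The derivative of the energy, tested against a bounded function of bounded support, is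
continuous along bounded weakly convergent sequences. -/
theorem tendsto_energyDeriv (hs : s ∈ Set.Ioc (0 : ℝ) 1) (ht : t ∈ Set.Ioc (0 : ℝ) 1)
    (hP : ∀ u v, P u v =ᵐ[rieszMeasure t] fun z => u z.1 * v z.2)
    {p C C₁ : ℝ} (hC : IsEmbeddingConst s p C) (hf : IsCaratheodory f) (hp : 2 ≤ p)
    (hC₁ : 0 < C₁) (hg : ∀ x u, |f x u| ≤ C₁ * (|u| + |u| ^ (p - 1)))
    {L : HSob s → HSob s →L[ℝ] ℝ} (hL : ∀ v h, L v h = ∫ x, f x (v x) * h x)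
    {v : ℕ → HSob s} {u₀ : HSob s} {B : ℝ} (hB : ∀ n, ‖v n‖ ≤ B) (hw : WeaklyConverges v u₀)
    {h : HSob s} {M ρ : ℝ} (hM : ∀ᵐ x, |h x| ≤ M) (hρ : ∀ᵐ x, ρ ≤ ‖x‖ → h x = 0) :
    Tendsto (fun n => energyDeriv P (v n) (L (v n)) h) atTop (𝓝 (energyDeriv P u₀ (L u₀) h)) := by
  have hs3 : 2 * s < 3 := by linarith [hs.2]
  have hvB : ∀ n, ‖v n - u₀‖ ≤ B + ‖u₀‖ := fun n =>
    (norm_sub_le _ _).trans (by gcongr; exact hB _)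
  have hw0 : WeaklyConverges (fun n => v n - u₀) 0 := fun T => by
    have := (hw T).sub_const (T u₀)
    simpa using this
  have hloc := HSob.tendsto_eLpNorm_ball hs.1 hs3 hvB hw0
  have l1 : Tendsto (fun n => (inner ℝ (v n) h : ℝ)) atTop (𝓝 (inner ℝ u₀ h)) := by
    have := hw (innerSL ℝ h)
    simpa only [innerSL_apply_apply, real_inner_comm h] using this
  have l2 := (tendsto_inner_tensor ht hP hB hw hloc hM hρ).const_mul (rieszConst t)
  have l3 := tendsto_integral_comp_mul hC hf hp hC₁ hg hvB hloc hM hρ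
  simp only [energyDeriv_apply, hL]
  exact (l1.add l2).sub l3

end

end FracSP

end

open FracSP in
theorem theorem3p2 (s t : ℝ) (hs : s ∈ Set.Ioc (0 : ℝ) 1) (ht : t ∈ Set.Ioc (0 : ℝ) 1)
    (hst : 3 < 2 * t + 4 * s) (V : Potential) (f : R3 → ℝ → ℝ) (hf : IsCaratheodory f)
    (hA1 : GrowthCondition s f) (hA3 : SuperquadraticCondition f)
    (lam : ℕ → ℝ) (hlam : ∀ n, lam n ∈ Set.Ioc (0 : ℝ) 1) (hlim : Tendsto lam atTop (𝓝 0))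
    (u : ℕ → ESpace s V)
    (hcrit : ∀ n, IsCriticalPoint (perturbedFunctional s t f V (lam n)) (u n))
    (hbdd : ∃ C : ℝ, ∀ n, perturbedFunctional s t f V (lam n) (u n) ≤ C) :
    ∃ k : ℕ → ℕ, StrictMono k ∧ ∃ u₀ : HSob s,
      WeaklyConverges (fun n => (u (k n)).toHSob) u₀ ∧
        IsCriticalPoint (functional s t f) u₀ := by
  obtain ⟨C₁, p, hC₁, hp, hp', hg⟩ := hA1
  obtain ⟨μ, hμ, hA3⟩ := hA3
  obtain ⟨K, hK⟩ := hbdd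
  have hs3 : 2 * s < 3 := by linarith [hs.2]
  obtain ⟨P, hP⟩ := exists_tensor hs.1.le hs3 ht hst
  obtain ⟨C, hC⟩ := exists_isEmbeddingConst hs.1.le hs3 hp hp'
  choose L hL using exists_superposition hC hf hp hC₁ hg
  have hderiv : ∀ v : HSob s, HasFDerivAt (functional s t f) (energyDeriv P v (L v)) v :=
    fun v => hasFDerivAt_functional hP (hasFDerivAt_superposition hC hf hp hC₁ hg v (hL v))
  have heq : ∀ n (h : ESpace s V), energyDeriv P (u n).toHSob (L (u n).toHSob) h.toHSob +
      lam n * ∫ x, V x * ((u n).toHSob x * h.toHSob x) = 0 :=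
    fun n h => energyDeriv_add_eq_zero (hcrit n) (hderiv _) h
  have hbd : ∀ n, ‖(u n).toHSob‖ ^ 2 + lam n * ∫ x, V x * (u n).toHSob x ^ 2 ≤ μ * K :=
    fun n => norm_sq_add_le ht hP hμ hA3 (hlam n).1.le
      (integrable_primitive hC hf hp hC₁ hg _) (integrable_comp_mul hC hf hp hC₁ hg _ _)
      (hL _ _) (heq n (u n)) (hK n)
  have hVn : ∀ n, 0 ≤ lam n * ∫ x, V x * (u n).toHSob x ^ 2 := fun n =>
    mul_nonneg (hlam n).1.le (integral_nonneg fun x => mul_nonneg (V.pos x).le (sq_nonneg _))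
  have hnorm : ∀ n, ‖(u n).toHSob‖ ≤ √(μ * K) := fun n =>
    Real.le_sqrt_of_sq_le (by linarith [hbd n, hVn n])
  obtain ⟨k, hk, u₀, hw⟩ := exists_weaklyConverges_subseq (fun n => (u n).toHSob) _ hnorm
  refine ⟨k, hk, u₀, hw, ?_⟩
  have htest : ∀ (h : HSob s) (φ : R3 → ℝ), Continuous φ → HasCompactSupport φ →
      (h : R3 → ℝ) =ᵐ[volume] φ → energyDeriv P u₀ (L u₀) h = 0 := by
    intro h φ hφ hφc hh
    obtain ⟨M, hM⟩ := hφc.exists_bound_of_continuous hφ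
    obtain ⟨ρ, -, hρ⟩ := hφc.exists_pos_le_norm
    have hM' : ∀ᵐ x, |h x| ≤ M := by
      filter_upwards [hh] with x hx
      rw [hx]
      exact hM x
    have hρ' : ∀ᵐ x, ρ ≤ ‖x‖ → h x = 0 := by
      filter_upwards [hh] with x hx hx'
      rw [hx, hρ x hx']
    have l1 := tendsto_energyDeriv hs ht hP hC hf hp hC₁ hg hL (fun n => hnorm (k n)) hw hM' hρ'
    obtain ⟨g, rfl⟩ := ESpace.exists_toHSob_eq V hφ hφc hh
    have hsq : Tendsto (fun n => √(lam (k n)) * (μ * K + ∫ x, V x * g.toHSob x ^ 2)) atTop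
        (𝓝 0) := by
      have := ((((Real.continuous_sqrt.tendsto 0).comp hlim).comp hk.tendsto_atTop).mul_const
        (μ * K + ∫ x, V x * g.toHSob x ^ 2))
      rwa [Real.sqrt_zero, zero_mul] at this
    refine tendsto_nhds_unique l1 (squeeze_zero_norm (fun n => ?_) hsq)
    rw [eq_neg_of_add_eq_zero_left (heq (k n) g), norm_neg, Real.norm_eq_abs]
    exact abs_mul_integral_le (hlam _).1.le (u (k n)) g
      ((le_add_of_nonneg_left (sq_nonneg _)).trans (hbd (k n)))
  -- the Riesz representative of `I'(u₀)` is orthogonal to all test functions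
  set D := energyDeriv P u₀ (L u₀) with hD
  have hz : (InnerProductSpace.toDual ℝ (HSob s)).symm D = 0 := by
    refine HSob.eq_zero_of_inner_contDiff ⟨hs.1.le, hs.2⟩ _ fun h φ hφ hφc hh => ?_
    rw [InnerProductSpace.toDual_symm_apply]
    exact htest h φ hφ hφc hh
  have hD0 : D = 0 := by simpa using hz
  have := hderiv u₀
  rwa [← hD, hD0] at this
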